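/- **Setting.** Let $G=(V,E)$ be a finite tree with $n=|V|$ vertices and maximum degree $\Delta$, and let $1\le k\le n$. A *configuration* of $k$ agents is a tuple $(v_1,\dots,v_k)$ of pairwise distinct vertices that induce a connected subgraph of $G$. Two configurations are *adjacent* if, for each $i$, the $i$-th entries are equal or joined by an edge; the transition from $\mathcal C$ to an adjacent $\mathcal C'$ is a *1-transition* if exactly one vertex of $\mathcal C'$ is not in $\mathcal C$. The restricted $k$-agent Hamiltonian walk problem ($k$-RHWP) asks for a sequence of configurations $\mathcal C_0,\dots,\mathcal C_l$ of minimum length $l$ such that consecutive configurations are joined by a 1-transition and every vertex of $G$ lies in some $\mathcal C_t$. Its optimal value is denoted $h^r_k(G)$. For a path $P$ and an edge $e$ let $d^k_P(e)=0$ if $e\in P$; if $e=uv\notin P$ with $u$ closer to $P$ than $v$, let $d^k_P(e)=0$ if the component of $v$ in $G-e$, rooted at $v$, has height at most $k-2$, and $d^k_P(e)=1$ otherwise. **Algorithm $k$-RHWP-For-Tree.** The input is given by adjacency lists (in any order). 1. Find a longest path $P^*$, with ends $v_1^*,v_2^*$, by two depth-first searches, and the distances of all vertices to $P^*$. 2.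 Let a single agent start at $v_1^*$ and repeatedly move to an unexplored neighbour (preferably one not on $P^*$; its *parent* is the vertex it was reached from), or to the parent of the current vertex if all neighbours are explored. Place the $k$ agents on the first $k$ vertices explored; the $k$-th is the *head*, the first is the *tail*. 3. While the head is not $v_2^*$, make a transition. Let $G'$ be the subgraph induced by the occupied vertices. - *Head and target.* If the head has no unexplored neighbour but some occupied vertex has one, then such a vertex nearest to the head becomes the new head and the old head becomes the tail. The target is then an unexplored neighbour of the head, preferably not on $P^*$ (the head becomes its parent). If no occupied vertex has an unexplored neighbour, an occupied vertex nearest to $P^*$ becomes the head (and the old head, if different, the tail), and the target is the parent of the head. - *Tail.* If the tail is not a leaf of $G'$, it is replaced by a leaf of $G'$ other than the head and, if possible, other than the occupied vertex nearest to $P^*$; among the eligible leaves, the one that was explored last is taken. (For $k=1$ head and tail coincide.) - *Move.* The agent on the head moves to the target, each other agent on the path from the head to the tail moves one step towards the head, and all other agents stay. The target is explored and becomes the head; the vertex entered by the agent of the old tail becomes the tail. **Theorem.** For every finite tree $G$ and every $1\le k\le n$, and for every longest path $P^*$ of $G$, $$h^r_k(G)=(n-k)+\sum_{e\in E}d^k_{P^*}(e).$$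 The algorithm $k$-RHWP-For-Tree terminates on $G$, and the sequence of configurations it returns is an optimal solution of $k$-RHWP. On a unit-cost random access machine its running time is $O(nk\Delta)$ for $n\ge 2$, with an absolute constant; in particular it is polynomial. -/

import Mathlib

/-! ## Configurations and the restricted Hamiltonian walk problem -/

namespace RHWP

/-- A configuration of `k` agents: agent `i` stands on `c i`, the agents occupy pairwise distinct
vertices, and the occupied vertices induce a connected subgraph. -/
def IsConfiguration {V : Type} (G : SimpleGraph V) {k : ℕ} (c : Fin k → V) : Prop :=
  Function.Injective c ∧ (G.induce (Set.range c)).Connected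

/-- Two configurations are adjacent if every agent stays or moves along an edge. -/
def AdjacentConfigs {V : Type} (G : SimpleGraph V) {k : ℕ} (c c' : Fin k → V) : Prop :=
  ∀ i, c i = c' i ∨ G.Adj (c i) (c' i)

/-- An `r`-transition: the configurations are adjacent, and exactly `r` vertices of the second one
are not occupied in the first one. -/
def IsTransition {V : Type} (G : SimpleGraph V) (r : ℕ) {k : ℕ} (c c' : Fin k → V) : Prop :=
  AdjacentConfigs G c c' ∧ (Set.range c' \ Set.range c).ncard = r

/-- A feasible solution of the restricted `k`-agent Hamiltonian walk problem: a non-empty sequence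
of configurations, consecutive ones being joined by a 1-transition edge, such that every vertex
occurs in one of the configurations. -/
structure IsRestrictedSpanningWalk {V : Type} (G : SimpleGraph V) {k : ℕ}
    (W : List (Fin k → V)) : Prop where
  nonempty : W ≠ []
  config : ∀ c ∈ W, IsConfiguration G c
  chain : W.IsChain (IsTransition G 1)
  spanning : ∀ v, ∃ c ∈ W, v ∈ Set.range c

/-- The lengths (numbers of transitions) of the feasible solutions. -/
def restrictedWalkLengths {V : Type} (G : SimpleGraph V) (k : ℕ) : Set ℕ :=
  {l | ∃ W : List (Fin k → V), IsRestrictedSpanningWalk G W ∧ W.length = l + 1}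

/-! ## The quantity `d` of an edge with respect to a path -/

/-- `P` is a longest path of `G`. -/
def IsLongestPath {V : Type} (G : SimpleGraph V) {a b : V} (P : G.Walk a b) : Prop :=
  P.IsPath ∧ ∀ (x y : V) (Q : G.Walk x y), Q.IsPath → Q.length ≤ P.length

/-- The distance from `v` to (the vertex set of) the path `P`. -/
noncomputable def distToPath {V : Type} (G : SimpleGraph V) {a b : V} (P : G.Walk a b) (v : V) : ℕ :=
  sInf {m | ∃ w ∈ P.support, G.dist v w = m}

/-- The height of the component of `v` in `G` minus the edge `e`, rooted at `v`. (`SimpleGraph.dist`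
is `0` between different components, so only vertices of the component of `v` matter.) -/
noncomputable def branchHeight {V : Type} [Fintype V] (G : SimpleGraph V) (e : Sym2 V) (v : V) : ℕ :=
  Finset.univ.sup fun z => (G.deleteEdges {e}).dist v z

/-- `d` is `0` on the edges of `P`. For another edge `e = uv`, with `u` closer to `P` than `v`, it is
`0` if the branch at `v` has height at most `k - 2`, and `1` otherwise. -/
noncomputable def detour {V : Type} [Fintype V] (G : SimpleGraph V) (k : ℕ) {a b : V}
    (P : G.Walk a b) (e : Sym2 V) : ℕ :=
  open Classical in
  if e ∈ P.edges then 0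
  else if ∃ u v, e = s(u, v) ∧ distToPath G P u < distToPath G P v ∧ k < branchHeight G e v + 2
    then 1 else 0

/-! ## Step-counted computations

The cost model is the unit-cost random access machine. A computation returns its result and the
number of steps it took. Every round of every loop (one list entry, one neighbour, one agent, one
stack entry) is charged at least one step, and between two charges only a bounded number of
elementary operations is made: pattern matches on lists, comparisons of vertices or numbers,
increments, and reads and writes of single array cells. An array indexed by `ι` is a function on `ι`,
written by `Function.update`; each array is used linearly. -/

/-- A result together with the number of steps spent. -/
def Timed (α : Type) : Type := α × ℕ

/-- The result of a computation. -/
def Timed.val {α : Type} (x : Timed α) : α := x.1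

/-- The number of steps of a computation. -/
def Timed.cost {α : Type} (x : Timed α) : ℕ := x.2

instance : Monad Timed where
  pure a := (a, 0)
  bind x f := ((f x.1).1, x.2 + (f x.1).2)

/-- Spend `m` steps. -/
def charge (m : ℕ) : Timed Unit := ((), m)

/-- Spend one step. -/
def tick : Timed Unit := charge 1

/-- `WhileRun guard body s s' t`: the loop `while guard do body`, started in the state `s`, stops in
the state `s'` after `t` steps. -/
inductive WhileRun {σ : Type} (guard : σ → Bool) (body : σ → Timed σ) : σ → σ → ℕ → Prop
  | exit {s : σ} : guard s = false → WhileRun guard body s s 1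
  | iter {s s' : σ} {t : ℕ} : guard s = true → WhileRun guard body (body s).val s' t →
      WhileRun guard body s s' (1 + (body s).cost + t)

/-- The first entry with property `p`. -/
def findT {α : Type} (p : α → Bool) : List α → Timed (Option α)
  | [] => do tick; pure none
  | x :: xs => do
    tick
    if p x then pure (some x) else findT p xs

/-- The number of entries with property `p`. -/
def countT {α : Type} (p : α → Bool) : List α → Timed ℕ
  | [] => do tick; pure 0
  | x :: xs => do
    tick
    let m ← countT p xs
    pure (if p x then m + 1 else m)

/-- The entries that pass the test `p`, in the same order. -/
def filterT {α : Type} (p : α → Timed Bool) : List α → Timed (List α)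
  | [] => do tick; pure []
  | x :: xs => do
    tick
    let b ← p x
    let ys ← filterT p xs
    pure (if b then x :: ys else ys)

/-- An entry of `y :: xs` at which `f` is least. -/
def argMinT {α : Type} (f : α → ℕ) (y : α) : List α → Timed α
  | [] => do tick; pure y
  | x :: xs => do
    tick
    if f x < f y then argMinT f x xs else argMinT f y xs

/-- An entry of `y :: xs` at which `f` is greatest. -/
def argMaxT {α : Type} (f : α → ℕ) (y : α) : List α → Timed α
  | [] => do tick; pure y
  | x :: xs => do
    tick
    if f y < f x then argMaxT f x xs else argMaxT f y xs

/-- Write the values `g x` into the cells `key x` of an array. -/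
def storeT {α V β : Type} [DecidableEq V] (key : α → V) (g : α → β) :
    List α → (V → β) → Timed (V → β)
  | [], a => do tick; pure a
  | x :: xs, a => do
    tick
    storeT key g xs (Function.update a (key x) (g x))

/-! ## The input, and searching a tree -/

/-- A finite graph given by its list of vertices and its adjacency lists. -/
structure AdjLists (V : Type) where
  verts : List V
  nbrs : V → List V

/-- The adjacency lists describe the graph `G`; the order of the lists is arbitrary. -/
structure AdjLists.Represents {V : Type} (A : AdjLists V) (G : SimpleGraph V) : Prop where
  verts_nodup : A.verts.Nodup
  mem_verts : ∀ v, v ∈ A.verts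
  nbrs_nodup : ∀ v, (A.nbrs v).Nodup
  mem_nbrs : ∀ v w, w ∈ A.nbrs v ↔ G.Adj v w

/-- A fresh array whose cells, one for each vertex, all hold `x`. -/
def newArray {V β : Type} (A : AdjLists V) (x : β) : Timed (V → β) := do
  charge (A.verts.length + 1)
  pure fun _ => x

/-- A vertex met by a depth-first search, with its predecessor and its depth. -/
structure Visit (V : Type) where
  vertex : V
  pred : Option V
  depth : ℕ

/-- Push the active neighbours of `x`, except its predecessor, onto the stack. -/
def pushNbrs {V : Type} [DecidableEq V] (active : V → Bool) (x : Visit V) :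
    List V → List (Visit V) → Timed (List (Visit V))
  | [], st => do tick; pure st
  | w :: ws, st => do
    tick
    if active w && decide (x.pred ≠ some w) then
      pushNbrs active x ws (⟨w, some x.vertex, x.depth + 1⟩ :: st)
    else pushNbrs active x ws st

/-- Depth-first search of a forest inside the active vertices: at most `m` rounds, starting from the
given stack. The visits are returned in reverse order, in front of `acc`. -/
def search {V : Type} [DecidableEq V] (A : AdjLists V) (active : V → Bool) :
    ℕ → List (Visit V) → List (Visit V) → Timed (List (Visit V))
  | 0, _, acc => do tick; pure acc
  | _ + 1, [], acc => do tick; pure acc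
  | m + 1, x :: st, acc => do
    tick
    let st' ← pushNbrs active x (A.nbrs x.vertex) st
    search A active m st' (x :: acc)

/-- Follow the predecessors from a vertex back to the root of a search, given the visits in reverse
order. The result is the path from the vertex to the root. -/
def traceBack {V : Type} [DecidableEq V] : Option V → List (Visit V) → Timed (List V)
  | _, [] => do tick; pure []
  | none, _ :: _ => do tick; pure []
  | some v, x :: xs => do
    tick
    if x.vertex = v then
      let p ← traceBack x.pred xs
      pure (v :: p)
    else traceBack (some v) xs

/-! ## The algorithm: preparation -/

/-- The data computed before any agent is deployed: the end vertices of the selected longest path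
`P*`, the indicator of `P*`, and the distances to `P*`. -/
structure Prep (V : Type) where
  start : V
  goal : V
  onPath : V → Bool
  distP : V → ℕ

/-- Two depth-first searches find a longest path `P*`; a third one finds the distances to `P*`. -/
def prepare {V : Type} [DecidableEq V] (A : AdjLists V) (root : V) : Timed (Prep V) := do
  let n := A.verts.length
  let r₀ : Visit V := ⟨root, none, 0⟩
  let l₁ ← search A (fun _ => true) n [r₀] []
  let a ← argMaxT Visit.depth r₀ l₁
  let r₁ : Visit V := ⟨a.vertex, none, 0⟩
  let l₂ ← search A (fun _ => true) n [r₁] []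
  let b ← argMaxT Visit.depth r₁ l₂
  let p ← traceBack (some b.vertex) l₂
  let blank ← newArray A false
  let onPath ← storeT id (fun _ => true) p blank
  charge p.length
  let l₃ ← search A (fun v => !onPath v) n (p.map fun v => ⟨v, none, 0⟩) []
  let zero ← newArray A 0
  let distP ← storeT Visit.vertex Visit.depth l₃ zero
  pure ⟨b.vertex, a.vertex, onPath, distP⟩

/-- The next vertex to explore from a vertex with the given neighbours: an unexplored neighbour,
preferably one that is not on `P*`. -/
def nextUnexplored {V : Type} (S : Prep V) (explored : V → Bool) (nbrs : List V) :
    Timed (Option V) := do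
  let x ← findT (fun w => !explored w && !S.onPath w) nbrs
  match x with
  | some w => pure (some w)
  | none => findT (fun w => !explored w) nbrs

/-! ## The algorithm: deployment of the agents by the one-agent strategy -/

/-- The state of the one-agent traversal: the current vertex, the explored vertices, their parents,
the time at which each vertex was explored first, the number of vertices explored so far, and the
agents placed so far (agent `i` on `pos i`; `occ v` is the agent on `v`, if any). -/
structure Deploy (V : Type) where
  cur : V
  explored : V → Bool
  parent : V → Option V
  stamp : V → ℕ
  count : ℕ
  pos : ℕ → V
  occ : V → Option ℕ

/-- The first vertex explored is the start of `P*`; agent `0` is placed there. -/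
def deployInit {V : Type} [DecidableEq V] (A : AdjLists V) (k : ℕ) (S : Prep V) :
    Timed (Deploy V) := do
  let explored ← newArray A false
  let parent ← newArray A none
  let stamp ← newArray A 0
  let occ ← newArray A none
  charge (k + 1)
  pure
    { cur := S.start
      explored := Function.update explored S.start true
      parent := parent
      stamp := stamp
      count := 1
      pos := fun _ => S.start
      occ := Function.update occ S.start (some 0) }

/-- One move of the one-agent strategy: explore a new neighbour, preferably off `P*`, or go back to
the parent. The `i`-th explored vertex receives the `i`-th agent. -/
def deployStep {V : Type} [DecidableEq V] (A : AdjLists V) (S : Prep V) (d : Deploy V) :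
    Timed (Deploy V) := do
  tick
  let x ← nextUnexplored S d.explored (A.nbrs d.cur)
  match x with
  | some w =>
    pure {
        cur := w
        explored := Function.update d.explored w true
        parent := Function.update d.parent w (some d.cur)
        stamp := Function.update d.stamp w d.count
        count := d.count + 1
        pos := Function.update d.pos d.count w
        occ := Function.update d.occ w (some d.count) }
  | none => pure { d with cur := (d.parent d.cur).getD d.cur }

/-! ## The algorithm: transitions -/

/-- The state of the transition phase. `walk` is the list of the configurations so far, the latest
one first. -/
structure State (V : Type) (k : ℕ) where
  pos : ℕ → V
  occ : V → Option ℕ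
  explored : V → Bool
  parent : V → Option V
  stamp : V → ℕ
  clock : ℕ
  head : V
  tail : V
  walk : List (Fin k → V)

/-- Output the current configuration. -/
def snapshot {V : Type} (k : ℕ) (pos : ℕ → V) : Timed (Fin k → V) := do
  charge (k + 1)
  pure fun i => pos i

/-- The state after the deployment: the head is the `k`-th explored vertex, the tail is the first. -/
def startState {V : Type} (k : ℕ) (S : Prep V) (d : Deploy V) : Timed (State V k) := do
  let c ← snapshot k d.pos
  pure
    { pos := d.pos, occ := d.occ, explored := d.explored, parent := d.parent, stamp := d.stamp
      clock := d.count, head := d.pos (k - 1), tail := S.start, walk := [c] }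

/-- Is `v` a leaf of the subgraph induced by the occupied vertices? -/
def isLeafT {V : Type} (A : AdjLists V) (occ : V → Option ℕ) (v : V) : Timed Bool := do
  let m ← countT (fun w => (occ w).isSome) (A.nbrs v)
  pure (decide (m = 1))

/-- The choice of head, tail and target. If the head has an unexplored neighbour, head and tail are
kept. Otherwise, if some occupied vertex has an unexplored neighbour, the one nearest to the head
becomes the head, and the old head becomes the tail. In both cases the target is an unexplored
neighbour of the head, preferably off `P*`. If no occupied vertex has an unexplored neighbour, the
occupied vertex nearest to `P*` becomes the head (and the old head the tail, if it is different),
and the target is the parent of the head. Returns head, tail and target. -/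
def chooseHead {V : Type} [DecidableEq V] {k : ℕ} (A : AdjLists V) (S : Prep V) (s : State V k) :
    Timed (V × V × V) := do
  tick
  let x ← nextUnexplored S s.explored (A.nbrs s.head)
  match x with
  | some w => pure (s.head, s.tail, w)
  | none => do
    let l ← search A (fun v => (s.occ v).isSome) k [⟨s.head, none, 0⟩] []
    let cands ← filterT (fun y => do
      let z ← findT (fun w => !s.explored w) (A.nbrs y.vertex)
      pure z.isSome) l
    match cands with
    | y :: ys => do
      let h ← argMinT Visit.depth y ys
      let z ← nextUnexplored S s.explored (A.nbrs h.vertex)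
      pure (h.vertex, s.head, z.getD h.vertex)
    | [] => do
      let h ← argMinT (fun y : Visit V => S.distP y.vertex) ⟨s.head, none, 0⟩ l
      let t := if h.vertex = s.head then s.tail else s.head
      pure (h.vertex, t, (s.parent h.vertex).getD h.vertex)

/-- The choice of the tail. A tail that is a leaf of the occupied subgraph `G'` is kept. Otherwise
the tail becomes a leaf of `G'`, other than the head and, if possible, other than the occupied vertex
nearest to `P*`; among these leaves it is the one that was explored last. -/
def chooseTail {V : Type} [DecidableEq V] {k : ℕ} (A : AdjLists V) (S : Prep V) (s : State V k)
    (head tail : V) : Timed V := do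
  let ok ← isLeafT A s.occ tail
  if ok then pure tail
  else do
    charge k
    let occupied := (List.range k).map s.pos
    let u ← argMinT S.distP head occupied
    let leaves ← filterT (isLeafT A s.occ) occupied
    let l₁ ← filterT (fun v => pure (decide (v ≠ head))) leaves
    let l₂ ← filterT (fun v => pure (decide (v ≠ u))) l₁
    match l₂, l₁ with
    | y :: ys, _ => argMaxT s.stamp y ys
    | [], y :: ys => argMaxT s.stamp y ys
    | [], [] => pure tail

/-- Move the agents on the path `v₁, …, vₚ`, given as a list, to `dest, v₁, …, vₚ₋₁`, and free `vₚ`.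
Returns the new positions, the new occupation, and the vertex that the agent on `vₚ` moved to. -/
def followHead {V : Type} [DecidableEq V] :
    V → List V → (ℕ → V) → (V → Option ℕ) → Timed ((ℕ → V) × (V → Option ℕ) × V)
  | dest, [], pos, occ => do tick; pure (pos, occ, dest)
  | dest, v :: vs, pos, occ => do
    tick
    let i := (occ v).getD 0
    let pos' := Function.update pos i dest
    let occ' := Function.update (Function.update occ dest (some i)) v none
    match vs with
    | [] => pure (pos', occ', dest)
    | _ :: _ => followHead v vs pos' occ'

/-- One transition. -/
def transitionStep {V : Type} [DecidableEq V] {k : ℕ} (A : AdjLists V) (S : Prep V)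
    (s : State V k) : Timed (State V k) := do
  tick
  let hd ← chooseHead A S s
  let head := hd.1
  let target := hd.2.2
  let tail ← chooseTail A S s head hd.2.1
  let l ← search A (fun v => (s.occ v).isSome) k [⟨tail, none, 0⟩] []
  let p ← traceBack (some head) l
  let m ← followHead target p s.pos s.occ
  let c ← snapshot k m.1
  let new := !s.explored target
  pure
    { pos := m.1
      occ := m.2.1
      explored := Function.update s.explored target true
      parent := if new then Function.update s.parent target (some head) else s.parent
      stamp := if new then Function.update s.stamp target s.clock else s.stamp
      clock := s.clock + 1
      head := target
      tail := m.2.2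
      walk := c :: s.walk }

/-- `KRHWPForTree A k W t`: the algorithm, run with `k` agents on the graph given by the adjacency
lists `A`, halts after `t` steps and returns the sequence `W` of configurations. The agents are
deployed on the first `k` vertices explored by the one-agent strategy; then transitions are made
until the head is the end of `P*`. -/
def KRHWPForTree {V : Type} [DecidableEq V] (A : AdjLists V) (k : ℕ) (W : List (Fin k → V))
    (t : ℕ) : Prop :=
  ∃ root, A.verts.head? = some root ∧
    let prep := prepare A root
    let S := prep.val
    let init := deployInit A k S
    ∃ (d : Deploy V) (t₁ : ℕ),
      WhileRun (fun d => decide (d.count < k)) (deployStep A S) init.val d t₁ ∧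
      let first := startState k S d
      ∃ (s : State V k) (t₂ : ℕ),
        WhileRun (fun s => decide (s.head ≠ S.goal)) (transitionStep A S) first.val s t₂ ∧
        W = s.walk.reverse ∧
        t = prep.cost + init.cost + t₁ + first.cost + t₂ + s.walk.length

end RHWP

/-!
Root the tree at an end `r` of a longest path `P`, so that the edges correspond to the vertices
`v ≠ r`. Call a side of an edge deep if it contains a path of `k` vertices starting at that edge.

*Lower bound.* A transition enters exactly one new vertex, so it takes the agents across at most one
edge. The `n - k` edges not spanned by the initial configuration have to be crossed, and so has
every edge with two deep sides, because a configuration that reaches the far end of a deep side lies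
entirely on that side. If an edge of both kinds is crossed only once, then the walk ends on the side
on which it did not begin; such edges form at most two chains in the rooted tree, and as `P` is
longest, there are no more of them than edges with two deep sides in the middle of `P`. Since the
sides of a detour edge are deep as well, the number of crossings is at least `n - k` plus the number
of detour edges.

*Upper bound.* The algorithm explores the tree depth-first and leaves a branch off `P` only after
it has been explored completely. Replacing a tail that is not a leaf by the leaf explored last keeps
the agents from gathering inside a branch off `P` that is not deep. Hence every transition lowers
the number of unexplored vertices plus the number of deep branches off `P` that contain the head or
an unexplored vertex, and after the deployment this sum is at most `n - k` plus the number of detour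
edges.
-/

namespace RHWP

/-! ## Rooted trees -/

section Rooted

variable {V : Type*} {G : SimpleGraph V} {r : V}

/-- The parent of `v` in the tree `G` rooted at `r`: the neighbour of `v` that is closer to `r`. The
root is its own parent. -/
noncomputable def parent (G : SimpleGraph V) (r v : V) : V :=
  open Classical in
  if h : ∃ u, G.Adj v u ∧ G.dist r u + 1 = G.dist r v then h.choose else v

/-- `a` is an ancestor of `b` in the tree `G` rooted at `r`. Every vertex is its own ancestor. -/
def IsAnc (G : SimpleGraph V) (r a b : V) : Prop :=
  ∃ m, (parent G r)^[m] b = a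

theorem parent_root : parent G r r = r := by
  unfold parent
  rw [dif_neg]
  rintro ⟨u, -, h⟩
  simp at h

theorem exists_adj_dist_succ_eq (hG : G.IsTree) {v : V} (hv : v ≠ r) :
    ∃ u, G.Adj v u ∧ G.dist r u + 1 = G.dist r v := by
  obtain ⟨p, hp⟩ := hG.connected.exists_walk_length_eq_dist v r
  cases p with
  | nil => exact absurd rfl hv
  | @cons _ u _ hvu q =>
    refine ⟨u, hvu, ?_⟩
    have hq : G.dist u r ≤ q.length := SimpleGraph.dist_le q
    have hdist := hG.dist_eq_dist_add_one_of_adj r hvu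
    simp only [SimpleGraph.Walk.length_cons] at hp
    rw [SimpleGraph.dist_comm] at hq hp
    omega

theorem adj_parent (hG : G.IsTree) {v : V} (hv : v ≠ r) : G.Adj v (parent G r v) := by
  have h := exists_adj_dist_succ_eq hG hv
  rw [parent, dif_pos h]
  exact h.choose_spec.1

theorem dist_parent (hG : G.IsTree) {v : V} (hv : v ≠ r) :
    G.dist r (parent G r v) + 1 = G.dist r v := by
  have h := exists_adj_dist_succ_eq hG hv
  rw [parent, dif_pos h]
  exact h.choose_spec.2

theorem eq_of_adj_of_dist_succ_eq (hG : G.IsTree) {v u u' : V} (h : G.Adj v u) (h' : G.Adj v u')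
    (hd : G.dist r u + 1 = G.dist r v) (hd' : G.dist r u' + 1 = G.dist r v) : u = u' := by
  obtain ⟨p, hp⟩ := hG.connected.exists_walk_length_eq_dist r u
  obtain ⟨p', hp'⟩ := hG.connected.exists_walk_length_eq_dist r u'
  have hq : (p.concat h.symm).IsPath :=
    SimpleGraph.Walk.isPath_of_length_eq_dist _ (by simp [hp, hd])
  have hq' : (p'.concat h'.symm).IsPath :=
    SimpleGraph.Walk.isPath_of_length_eq_dist _ (by simp [hp', hd'])
  have hpenultimate : (p.concat h.symm).penultimate = (p'.concat h'.symm).penultimate := by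
    rw [(hG.existsUnique_path r v).unique hq hq']
  simpa using hpenultimate

theorem parent_eq_of_adj (hG : G.IsTree) {v u : V} (h : G.Adj v u)
    (hd : G.dist r u < G.dist r v) : v ≠ r ∧ parent G r v = u := by
  have hv : v ≠ r := by rintro rfl; simp at hd
  have huv := hG.dist_eq_dist_add_one_of_adj r h
  exact ⟨hv, eq_of_adj_of_dist_succ_eq hG (adj_parent hG hv) h (dist_parent hG hv) (by omega)⟩

theorem parent_eq_or_parent_eq_of_adj (hG : G.IsTree) {x y : V} (h : G.Adj x y) :
    (x ≠ r ∧ parent G r x = y) ∨ (y ≠ r ∧ parent G r y = x) := by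
  rcases lt_or_gt_of_ne (hG.dist_ne_of_adj r h) with hlt | hgt
  · exact Or.inr (parent_eq_of_adj hG h.symm hlt)
  · exact Or.inl (parent_eq_of_adj hG h hgt)

/-- The edge from `v` to its parent. Every edge of a tree is of this form, for exactly one `v` other
than the root. -/
noncomputable def parentEdge (G : SimpleGraph V) (r v : V) : Sym2 V :=
  s(v, parent G r v)

theorem parentEdge_injOn (hG : G.IsTree) : Set.InjOn (parentEdge G r) {r}ᶜ := by
  intro v hv w hw h
  rcases Sym2.eq_iff.1 h with ⟨heq, -⟩ | ⟨hvw, hwv⟩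
  · exact heq
  · have hdv := dist_parent hG hv
    have hdw := dist_parent hG hw
    rw [hwv] at hdv
    rw [← hvw] at hdw
    omega

theorem mem_edgeSet_iff_exists_parentEdge (hG : G.IsTree) {e : Sym2 V} :
    e ∈ G.edgeSet ↔ ∃ v, v ≠ r ∧ parentEdge G r v = e := by
  constructor
  · induction e using Sym2.ind with
    | _ x y =>
      intro h
      have hxy : G.Adj x y := h
      rcases parent_eq_or_parent_eq_of_adj (r := r) hG hxy with ⟨hx, rfl⟩ | ⟨hy, rfl⟩
      · exact ⟨x, hx, rfl⟩
      · exact ⟨y, hy, Sym2.eq_swap⟩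
  · rintro ⟨v, hv, rfl⟩
    exact adj_parent hG hv

theorem parent_induction (hG : G.IsTree) {motive : V → Prop} (root : motive r)
    (step : ∀ v, v ≠ r → motive (parent G r v) → motive v) (v : V) : motive v := by
  induction hn : G.dist r v generalizing v with
  | zero => exact hG.connected.dist_eq_zero_iff.1 hn ▸ root
  | succ n ih =>
    have hv : v ≠ r := by rintro rfl; simp at hn
    exact step v hv (ih _ (by have := dist_parent hG hv; omega))

namespace IsAnc

theorem refl (a : V) : IsAnc G r a a := ⟨0, rfl⟩

theorem trans {a b c : V} (hab : IsAnc G r a b) (hbc : IsAnc G r b c) : IsAnc G r a c := by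
  obtain ⟨m, rfl⟩ := hab
  obtain ⟨l, rfl⟩ := hbc
  exact ⟨m + l, by rw [Function.iterate_add_apply]⟩

theorem parent_left (v : V) : IsAnc G r (parent G r v) v := ⟨1, rfl⟩

theorem eq_or_parent_right {a b : V} (h : IsAnc G r a b) :
    a = b ∨ (b ≠ r ∧ IsAnc G r a (parent G r b)) := by
  obtain ⟨_ | m, rfl⟩ := h
  · exact Or.inl rfl
  · by_cases hb : b = r
    · subst hb
      exact Or.inl (Function.iterate_fixed parent_root _)
    · exact Or.inr ⟨hb, m, rfl⟩

theorem parent_right {a b : V} (h : IsAnc G r a b) (hab : a ≠ b) : IsAnc G r a (parent G r b) :=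
  (h.eq_or_parent_right.resolve_left hab).2

theorem ne_root {a b : V} (h : IsAnc G r a b) (hab : a ≠ b) : b ≠ r :=
  (h.eq_or_parent_right.resolve_left hab).1

theorem root (hG : G.IsTree) (v : V) : IsAnc G r r v :=
  parent_induction hG (refl r) (fun v _ h => h.trans (parent_left v)) v

theorem dist_add_dist (hG : G.IsTree) {a b : V} (h : IsAnc G r a b) :
    G.dist r a + G.dist a b = G.dist r b := by
  induction b using parent_induction hG (r := r) with
  | root =>
    have har : a = r := h.eq_or_parent_right.resolve_right fun hr => hr.1 rfl
    simp [har]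
  | step b hb ih =>
    rcases h.eq_or_parent_right with rfl | ⟨-, hparent⟩
    · simp
    · have hadj := SimpleGraph.dist_eq_one_iff_adj.2 (adj_parent hG hb).symm
      have hab : G.dist a b ≤ G.dist a (parent G r b) + G.dist (parent G r b) b :=
        hG.connected.dist_triangle
      have hrb : G.dist r b ≤ G.dist r a + G.dist a b := hG.connected.dist_triangle
      have := ih hparent
      have := dist_parent hG hb
      omega

theorem dist_le (hG : G.IsTree) {a b : V} (h : IsAnc G r a b) : G.dist r a ≤ G.dist r b :=
  (Nat.le_add_right _ _).trans_eq (h.dist_add_dist hG)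

theorem eq_of_dist_le (hG : G.IsTree) {a b : V} (h : IsAnc G r a b)
    (hd : G.dist r b ≤ G.dist r a) : a = b :=
  hG.connected.dist_eq_zero_iff.1 (by have := h.dist_add_dist hG; omega)

theorem dist_lt (hG : G.IsTree) {a b : V} (h : IsAnc G r a b) (hab : a ≠ b) :
    G.dist r a < G.dist r b :=
  lt_of_not_ge fun hd => hab (h.eq_of_dist_le hG hd)

theorem antisymm (hG : G.IsTree) {a b : V} (hab : IsAnc G r a b) (hba : IsAnc G r b a) : a = b :=
  hab.eq_of_dist_le hG (hba.dist_le hG)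

theorem total {a b c : V} (hac : IsAnc G r a c) (hbc : IsAnc G r b c) :
    IsAnc G r a b ∨ IsAnc G r b a := by
  obtain ⟨m, rfl⟩ := hac
  obtain ⟨l, rfl⟩ := hbc
  rcases le_total m l with hml | hlm
  · exact Or.inr ⟨l - m, by rw [← Function.iterate_add_apply, Nat.sub_add_cancel hml]⟩
  · exact Or.inl ⟨m - l, by rw [← Function.iterate_add_apply, Nat.sub_add_cancel hlm]⟩

theorem of_dist_le (hG : G.IsTree) {a b c : V} (hac : IsAnc G r a c) (hbc : IsAnc G r b c)
    (hd : G.dist r a ≤ G.dist r b) : IsAnc G r a b := by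
  rcases hac.total hbc with hab | hba
  · exact hab
  · rw [hba.eq_of_dist_le hG hd]
    exact refl _

theorem eq_of_dist_eq (hG : G.IsTree) {a b c : V} (hac : IsAnc G r a c) (hbc : IsAnc G r b c)
    (hd : G.dist r a = G.dist r b) : a = b :=
  (hac.of_dist_le hG hbc hd.le).eq_of_dist_le hG hd.ge

theorem exists_child (hG : G.IsTree) {a b : V} (h : IsAnc G r a b) (hab : a ≠ b) :
    ∃ c, c ≠ r ∧ parent G r c = a ∧ IsAnc G r c b := by
  induction b using parent_induction hG (r := r) with
  | root => exact absurd rfl (h.ne_root hab)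
  | step b hb ih =>
    by_cases hparent : a = parent G r b
    · exact ⟨b, hb, hparent.symm, refl b⟩
    · obtain ⟨c, hc, hca, hcb⟩ := ih (h.parent_right hab) hparent
      exact ⟨c, hc, hca, hcb.trans (parent_left b)⟩

theorem exists_dist_eq (hG : G.IsTree) {b : V} {i : ℕ} (hi : i ≤ G.dist r b) :
    ∃ a, IsAnc G r a b ∧ G.dist r a = i := by
  induction b using parent_induction hG (r := r) with
  | root => exact ⟨r, refl r, by simp at hi ⊢; omega⟩
  | step b hb ih =>
    rcases hi.eq_or_lt with rfl | hlt
    · exact ⟨b, refl b, rfl⟩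
    · obtain ⟨a, ha, had⟩ := ih (by have := dist_parent hG hb; omega)
      exact ⟨a, ha.trans (parent_left b), had⟩

end IsAnc

instance : Std.Refl (IsAnc G r) := ⟨IsAnc.refl⟩

theorem eq_and_eq_parent_of_adj_of_not_isAnc (hG : G.IsTree) {v x y : V} (h : G.Adj x y)
    (hx : IsAnc G r v x) (hy : ¬ IsAnc G r v y) : x = v ∧ v ≠ r ∧ y = parent G r v := by
  rcases parent_eq_or_parent_eq_of_adj (r := r) hG h with ⟨hxr, rfl⟩ | ⟨-, rfl⟩
  · obtain rfl : v = x := by_contra fun hvx => hy (hx.parent_right hvx)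
    exact ⟨rfl, hxr, rfl⟩
  · exact absurd (hx.trans (IsAnc.parent_left y)) hy

theorem not_isAnc_parent (hG : G.IsTree) {v : V} (hv : v ≠ r) : ¬ IsAnc G r v (parent G r v) := by
  intro h
  have := h.dist_le hG
  have := dist_parent hG hv
  omega

/-- The vertices of the subtree hanging at `v`, in the tree `G` rooted at `r`. -/
def subtree (G : SimpleGraph V) (r v : V) : Set V :=
  {x | IsAnc G r v x}

theorem exists_isAnc_dist_add_dist_le (hG : G.IsTree) (x y : V) :
    ∃ c, IsAnc G r c x ∧ IsAnc G r c y ∧ G.dist r x + G.dist r y ≤ G.dist x y + 2 * G.dist r c := by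
  obtain ⟨w, hw⟩ := hG.connected.exists_walk_length_eq_dist x y
  rw [← hw]
  clear hw
  induction w with
  | nil => exact ⟨_, IsAnc.refl _, IsAnc.refl _, by omega⟩
  | @cons x x' y h w ih =>
    obtain ⟨c, hcx', hcy, hc⟩ := ih
    rw [SimpleGraph.Walk.length_cons]
    rcases parent_eq_or_parent_eq_of_adj (r := r) hG h with ⟨hxr, rfl⟩ | ⟨hx'r, rfl⟩
    · have := dist_parent hG hxr
      exact ⟨c, hcx'.trans (IsAnc.parent_left x), hcy, by omega⟩
    · have := dist_parent hG hx'r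
      by_cases heq : c = x'
      · subst heq
        exact ⟨_, IsAnc.refl _, (IsAnc.parent_left c).trans hcy, by omega⟩
      · exact ⟨c, hcx'.parent_right heq, hcy, by omega⟩

theorem dist_add_le_of_isAnc_of_isAnc (hG : G.IsTree) {c x y : V} (hx : IsAnc G r c x)
    (hy : IsAnc G r c y) : G.dist x y + 2 * G.dist r c ≤ G.dist r x + G.dist r y := by
  have hrx := hx.dist_add_dist hG
  have hry := hy.dist_add_dist hG
  have htriangle : G.dist x y ≤ G.dist x c + G.dist c y := hG.connected.dist_triangle
  rw [SimpleGraph.dist_comm (u := x) (v := c)] at htriangle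
  omega

theorem isAnc_iff_dist (hG : G.IsTree) {a b : V} :
    IsAnc G r a b ↔ G.dist r a + G.dist a b = G.dist r b := by
  refine ⟨fun h => h.dist_add_dist hG, fun h => ?_⟩
  obtain ⟨c, hca, hcb, hc⟩ := exists_isAnc_dist_add_dist_le (r := r) hG a b
  rw [← hca.eq_of_dist_le hG (by omega)]
  exact hcb

theorem isAnc_comm (hG : G.IsTree) {a b w : V} : IsAnc G b w a ↔ IsAnc G a w b := by
  rw [isAnc_iff_dist hG, isAnc_iff_dist hG, add_comm, SimpleGraph.dist_comm (u := w) (v := a),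
    SimpleGraph.dist_comm (u := b) (v := w), SimpleGraph.dist_comm (u := b) (v := a)]

theorem dist_eq_of_not_isAnc_of_isAnc (hG : G.IsTree) {v y z : V} (hv : v ≠ r)
    (hy : ¬ IsAnc G r v y) (hz : IsAnc G r v z) :
    G.dist y z + G.dist r v = G.dist y (parent G r v) + 1 + G.dist r z := by
  obtain ⟨c, hcy, hcz, hc⟩ := exists_isAnc_dist_add_dist_le (r := r) hG y z
  have hcv : IsAnc G r c v := (hcz.total hz).resolve_right fun h => hy (h.trans hcy)
  have hne : c ≠ v := by rintro rfl; exact hy hcy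
  have hcommon := dist_add_le_of_isAnc_of_isAnc hG hcy (hcv.parent_right hne)
  have hparent := dist_parent hG hv
  have htriangle : G.dist y z ≤ G.dist y (parent G r v) + G.dist (parent G r v) z :=
    hG.connected.dist_triangle
  have hbelow := ((IsAnc.parent_left v).trans hz).dist_add_dist hG
  omega

theorem dist_four_point (hG : G.IsTree) (q a x y : V) :
    G.dist q a + G.dist x y ≤ max (G.dist q x + G.dist a y) (G.dist q y + G.dist a x) := by
  obtain ⟨c, hca, hcx, hc⟩ := exists_isAnc_dist_add_dist_le (r := q) hG a x
  obtain ⟨d, hda, hdy, hd⟩ := exists_isAnc_dist_add_dist_le (r := q) hG a y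
  rcases hca.total hda with hcd | hdc
  · have := dist_add_le_of_isAnc_of_isAnc hG hcx (hcd.trans hdy)
    exact le_max_of_le_right (by omega)
  · have := dist_add_le_of_isAnc_of_isAnc hG (hdc.trans hcx) hdy
    exact le_max_of_le_left (by omega)

theorem mem_and_parent_mem_of_connected (hG : G.IsTree) {S : Set V} (hS : (G.induce S).Connected)
    {v x y : V} (hx : x ∈ S) (hy : y ∈ S) (hvx : IsAnc G r v x) (hvy : ¬ IsAnc G r v y) :
    v ∈ S ∧ parent G r v ∈ S ∧ v ≠ r := by
  obtain ⟨w⟩ := hS.preconnected ⟨x, hx⟩ ⟨y, hy⟩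
  obtain ⟨d, -, hfst, hsnd⟩ := w.exists_boundary_dart {z | IsAnc G r v z} hvx hvy
  obtain ⟨heq, hr, hparent⟩ := eq_and_eq_parent_of_adj_of_not_isAnc hG d.adj hfst hsnd
  exact ⟨heq ▸ d.fst.2, hparent ▸ d.snd.2, hr⟩

/-- `t` is the top of the set `S` in the tree rooted at `r`: it belongs to `S`, and so does the
parent of every other vertex of `S`. The sets with a top are the non-empty connected ones. -/
def IsTop (G : SimpleGraph V) (r : V) (S : Set V) (t : V) : Prop :=
  t ∈ S ∧ ∀ x ∈ S, x ≠ t → x ≠ r ∧ parent G r x ∈ S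

namespace IsTop

variable {S : Set V} {t : V}

theorem isAnc (hG : G.IsTree) (h : IsTop G r S t) {x : V} (hx : x ∈ S) : IsAnc G r t x := by
  induction x using parent_induction hG (r := r) with
  | root =>
    obtain rfl : r = t := by_contra fun hrt => (h.2 r hx hrt).1 rfl
    exact IsAnc.refl r
  | step x _ ih =>
    by_cases hxt : x = t
    · exact hxt ▸ IsAnc.refl x
    · exact (ih (h.2 x hx hxt).2).trans (IsAnc.parent_left x)

theorem mem_of_isAnc (hG : G.IsTree) (h : IsTop G r S t) {a x : V} (hx : x ∈ S)
    (hta : IsAnc G r t a) (hax : IsAnc G r a x) : a ∈ S := by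
  induction x using parent_induction hG (r := r) with
  | root => exact (hax.antisymm hG (IsAnc.root hG a)).symm ▸ hx
  | step x _ ih =>
    by_cases hxa : a = x
    · exact hxa ▸ hx
    · have hxt : x ≠ t := by
        rintro rfl
        exact hxa (hax.antisymm hG hta)
      exact ih (h.2 x hx hxt).2 (hax.parent_right hxa)

theorem connected (hG : G.IsTree) (h : IsTop G r S t) : (G.induce S).Connected := by
  have hreach : ∀ x (hx : x ∈ S), (G.induce S).Reachable ⟨x, hx⟩ ⟨t, h.1⟩ := by
    intro x
    induction x using parent_induction hG (r := r) with
    | root =>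
      intro hr
      obtain rfl : r = t := by_contra fun hrt => (h.2 r hr hrt).1 rfl
      exact SimpleGraph.Reachable.refl _
    | step x hxr ih =>
      intro hx
      by_cases hxt : x = t
      · subst hxt
        exact SimpleGraph.Reachable.refl _
      · have hparent := (h.2 x hx hxt).2
        have hadj : (G.induce S).Adj ⟨x, hx⟩ ⟨_, hparent⟩ := adj_parent hG hxr
        exact hadj.reachable.trans (ih hparent)
  have : Nonempty S := ⟨⟨t, h.1⟩⟩
  exact ⟨fun x y => (hreach x x.2).trans (hreach y y.2).symm⟩

theorem parent_mem (hG : G.IsTree) (h : IsTop G r S t) {q v : V} (hq : q ∈ S) (hv : v ∈ S) :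
    parent G q v ∈ S := by
  by_cases hvq : v = q
  · rwa [hvq, parent_root]
  · exact (mem_and_parent_mem_of_connected hG (h.connected hG) hv hq (IsAnc.refl v)
      fun hvq' => hvq (hvq'.antisymm hG (IsAnc.root hG v))).2.1

theorem mem_of_isAnc_of_mem (hG : G.IsTree) (h : IsTop G r S t) {q x v : V} (hq : q ∈ S)
    (hv : v ∈ S) (hxv : IsAnc G q x v) : x ∈ S := by
  obtain ⟨m, rfl⟩ := hxv
  exact Function.Iterate.rec (· ∈ S) hv (fun _ hy => h.parent_mem hG hq hy) m

end IsTop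

theorem exists_isAnc_childless [Finite V] (hG : G.IsTree) {S : Set V} {x : V} (hx : x ∈ S) :
    ∃ y ∈ S, IsAnc G r x y ∧ ∀ z ∈ S, z ≠ r → parent G r z ≠ y := by
  obtain ⟨y, ⟨hy, hxy⟩, hmax⟩ := Set.exists_max_image {y | y ∈ S ∧ IsAnc G r x y} (G.dist r)
    (Set.toFinite _) ⟨x, hx, IsAnc.refl x⟩
  refine ⟨y, hy, hxy, fun z hz hr hzy => ?_⟩
  subst hzy
  have := hmax z ⟨hz, hxy.trans (IsAnc.parent_left z)⟩
  have := dist_parent hG hr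
  omega

end Rooted

/-! ## Boundary crossings of a sequence of sets -/

section Crossings

variable {V : Type*} {S : ℕ → Set V} {T : ℕ} {A B : Set V}

/-- The sequence `S` enters `A` in step `t`: the set `S t` is disjoint from `A`, the next one is
not. -/
def Enters (S : ℕ → Set V) (A : Set V) (t : ℕ) : Prop :=
  Disjoint (S t) A ∧ (S (t + 1) ∩ A).Nonempty

/-- The sequence `S` enters `A` or its complement in step `t`. -/
def Crosses (S : ℕ → Set V) (A : Set V) (t : ℕ) : Prop :=
  Enters S A t ∨ Enters S Aᶜ t

/-- The steps, among the first `T`, in which the sequence `S` enters `A` or its complement. -/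
noncomputable def crossings (S : ℕ → Set V) (T : ℕ) (A : Set V) : Finset ℕ :=
  open Classical in {t ∈ Finset.range T | Crosses S A t}

/-- The sequence starts outside `A`, lies inside `A` at some time, and still meets `A` at every
later time. -/
def EndsIn (S : ℕ → Set V) (T : ℕ) (A : Set V) : Prop :=
  Disjoint (S 0) A ∧ (∃ t ≤ T, S t ⊆ A) ∧ ∀ t t', t ≤ t' → t' ≤ T → S t ⊆ A → (S t' ∩ A).Nonempty

theorem mem_crossings {t : ℕ} : t ∈ crossings S T A ↔ t < T ∧ Crosses S A t := by
  simp [crossings]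

theorem crossings_compl : crossings S T Aᶜ = crossings S T A := by
  ext t
  rw [mem_crossings, mem_crossings, Crosses, Crosses, compl_compl, or_comm]

theorem exists_enters {i j : ℕ} (hij : i ≤ j) (hi : Disjoint (S i) A) (hj : (S j ∩ A).Nonempty) :
    ∃ t, i ≤ t ∧ t < j ∧ Enters S A t := by
  induction j, hij using Nat.le_induction with
  | base => exact absurd hi (Set.not_disjoint_iff_nonempty_inter.2 hj)
  | succ j hij ih =>
    by_cases h : (S j ∩ A).Nonempty
    · obtain ⟨t, hit, htj, ht⟩ := ih h
      exact ⟨t, hit, htj.trans (Nat.lt_succ_self j), ht⟩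
    · exact ⟨j, hij, Nat.lt_succ_self j,
        Set.disjoint_iff_inter_eq_empty.2 (Set.not_nonempty_iff_eq_empty.1 h), hj⟩

theorem card_crossings_pos {i j : ℕ} (hij : i ≤ j) (hjT : j ≤ T) (hi : Disjoint (S i) A)
    (hj : (S j ∩ A).Nonempty) : 0 < (crossings S T A).card := by
  obtain ⟨t, -, htj, ht⟩ := exists_enters hij hi hj
  exact Finset.card_pos.2 ⟨t, mem_crossings.2 ⟨htj.trans_le hjT, Or.inl ht⟩⟩

theorem card_crossings_pos_of_subset_of_subset_compl {i j : ℕ} (hi : i ≤ T) (hj : j ≤ T)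
    (hSi : (S i).Nonempty) (hSj : (S j).Nonempty) (hiA : S i ⊆ A) (hjA : S j ⊆ Aᶜ) :
    0 < (crossings S T A).card := by
  rcases le_total i j with hij | hji
  · rw [← crossings_compl]
    exact card_crossings_pos hij hj (Set.disjoint_compl_right_iff_subset.2 hiA)
      (by rwa [Set.inter_eq_left.2 hjA])
  · exact card_crossings_pos hji hi (Set.subset_compl_iff_disjoint_right.1 hjA)
      (by rwa [Set.inter_eq_left.2 hiA])

theorem endsIn_of_card_crossings_le_one (hne : ∀ t ≤ T, (S t).Nonempty)
    (hcard : (crossings S T A).card ≤ 1) (hstart : Disjoint (S 0) A) (hinside : ∃ t ≤ T, S t ⊆ A) :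
    EndsIn S T A := by
  refine ⟨hstart, hinside, fun i j hij hj hiA => ?_⟩
  by_contra hjA
  have hjA' : S j ⊆ Aᶜ := Set.subset_compl_iff_disjoint_right.2
    (Set.disjoint_iff_inter_eq_empty.2 (Set.not_nonempty_iff_eq_empty.1 hjA))
  obtain ⟨s, -, hsi, hs⟩ := exists_enters (Nat.zero_le i) hstart
    (by rw [Set.inter_eq_left.2 hiA]; exact hne i (hij.trans hj))
  obtain ⟨t, hit, htj, ht⟩ := exists_enters hij (Set.disjoint_compl_right_iff_subset.2 hiA)
    (by rw [Set.inter_eq_left.2 hjA']; exact hne j hj)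
  have hst := Finset.card_le_one.1 hcard s (mem_crossings.2 ⟨by omega, Or.inl hs⟩) t
    (mem_crossings.2 ⟨by omega, Or.inr ht⟩)
  omega

theorem EndsIn.inter_nonempty (hA : EndsIn S T A) (hB : EndsIn S T B) : (A ∩ B).Nonempty := by
  obtain ⟨-, ⟨s, hs, hsA⟩, hlaterA⟩ := hA
  obtain ⟨-, ⟨t, ht, htB⟩, hlaterB⟩ := hB
  rcases le_total s t with hst | hts
  · obtain ⟨x, hx, hxA⟩ := hlaterA s t hst ht hsA
    exact ⟨x, hxA, htB hx⟩
  · obtain ⟨x, hx, hxB⟩ := hlaterB t s hts hs htB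
    exact ⟨x, hsA hx, hxB⟩

theorem Enters.mem_and_notMem {x y : V} {t : ℕ} (h : Enters S A t) (hy : y ∈ S t)
    (hx : S (t + 1) ⊆ insert x (S t)) : x ∈ A ∧ y ∉ A := by
  obtain ⟨hdisj, z, hz, hzA⟩ := h
  obtain rfl : z = x := (hx hz).resolve_right fun hzt => Set.disjoint_left.1 hdisj hzt hzA
  exact ⟨hzA, Set.disjoint_left.1 hdisj hy⟩

end Crossings

/-! ## The lower bound -/

section LowerBound

variable {V : Type*} {G : SimpleGraph V} {r : V}

/-- The subtree hanging at `v` has height at least `k - 1`. -/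
def IsDeep (G : SimpleGraph V) (r : V) (k : ℕ) (v : V) : Prop :=
  ∃ z, IsAnc G r v z ∧ G.dist r v + k ≤ G.dist r z + 1

/-- Both components of the tree without the edge from `v` to its parent, rooted at the ends of that
edge, have height at least `k - 1`. -/
def IsBothDeep (G : SimpleGraph V) (r : V) (k : ℕ) (v : V) : Prop :=
  v ≠ r ∧ IsDeep G r k v ∧ ∃ y, ¬ IsAnc G r v y ∧ k ≤ G.dist y (parent G r v) + 1

theorem isBothDeep_of_isDeep (hG : G.IsTree) {k : ℕ} {v : V} (hv : v ≠ r) (hdeep : IsDeep G r k v)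
    (hk : k ≤ G.dist r v) : IsBothDeep G r k v :=
  ⟨hv, hdeep, r, fun h => hv (h.antisymm hG (IsAnc.root hG v)), by rwa [dist_parent hG hv]⟩

open Classical in
/-- The vertices off the path from `r` to `g` whose subtrees cost a detour: the lower ends of the
edges at which `detour` is `1`. -/
noncomputable def detourVertices [Fintype V] (G : SimpleGraph V) (r g : V) (k : ℕ) : Finset V :=
  {v | ¬ IsAnc G r v g ∧ IsDeep G r k v}

theorem exists_isAnc_dist_le_two_mul (hG : G.IsTree) {g : V} (hL : ∀ x y, G.dist x y ≤ G.dist r g)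
    {v z : V} (hv : ¬ IsAnc G r v g) (hz : IsAnc G r v z) :
    ∃ c, IsAnc G r c g ∧ IsAnc G r c v ∧ c ≠ v ∧ G.dist r z ≤ 2 * G.dist r c := by
  obtain ⟨c, hcz, hcg, hc⟩ := exists_isAnc_dist_add_dist_le (r := r) hG z g
  have := hL z g
  have hcv : IsAnc G r c v := (hcz.total hz).resolve_right fun h => hv (h.trans hcg)
  exact ⟨c, hcg, hcv, by rintro rfl; exact hv hcg, by omega⟩

theorem dist_lt_ncard_of_connected {S : Set V} [Finite S] (hS : (G.induce S).Connected) {x y : V}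
    (hx : x ∈ S) (hy : y ∈ S) : G.dist x y < S.ncard := by
  have := Fintype.ofFinite S
  obtain ⟨p, hp⟩ := hS.preconnected.exists_isPath ⟨x, hx⟩ ⟨y, hy⟩
  have hdist := SimpleGraph.dist_le (p.map (SimpleGraph.Embedding.induce S).toHom)
  rw [SimpleGraph.Walk.length_map] at hdist
  rw [← Nat.card_coe_set_eq, Nat.card_eq_fintype_card]
  exact hdist.trans_lt hp.length_lt

theorem card_detourVertices_add_le_card_isBothDeep [Fintype V] (hG : G.IsTree) {k : ℕ} (hk : 1 ≤ k)
    {g : V} (hL : ∀ x y, G.dist x y ≤ G.dist r g) :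
    open Classical in
    (detourVertices G r g k).card + (G.dist r g + 2 - 2 * k) ≤
      ({v | IsBothDeep G r k v} : Finset V).card := by
  classical
  -- The middle of the longest path from `r` to `g` consists of edges with two deep sides.
  have hmiddle : ∀ i ∈ Finset.Icc k (G.dist r g + 1 - k),
      ∃ v, IsAnc G r v g ∧ G.dist r v = i := fun i hi =>
    IsAnc.exists_dist_eq hG (by rw [Finset.mem_Icc] at hi; omega)
  have : Nonempty V := ⟨r⟩
  choose! f hfg hfd using hmiddle
  set D := detourVertices G r g k
  set M := (Finset.Icc k (G.dist r g + 1 - k)).image f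
  have hcard : M.card = G.dist r g + 2 - 2 * k := by
    rw [Finset.card_image_of_injOn fun i hi j hj hij => by rw [← hfd i hi, ← hfd j hj, hij],
      Nat.card_Icc]
    omega
  have hdisjoint : Disjoint D M := Finset.disjoint_left.2 fun v hvD hvM => by
    obtain ⟨i, hi, rfl⟩ := Finset.mem_image.1 hvM
    exact (Finset.mem_filter.1 hvD).2.1 (hfg i hi)
  rw [← hcard, ← Finset.card_union_of_disjoint hdisjoint]
  refine Finset.card_le_card (Finset.union_subset (fun v hv => ?_) fun v hv => ?_) <;>
    refine Finset.mem_filter.2 ⟨Finset.mem_univ v, ?_⟩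
  · obtain ⟨-, hvg, z, hvz, hz⟩ := Finset.mem_filter.1 hv
    obtain ⟨c, -, hcv, hne, hd⟩ := exists_isAnc_dist_le_two_mul hG hL hvg hvz
    have := hcv.dist_lt hG hne
    exact isBothDeep_of_isDeep hG (hcv.ne_root hne) ⟨z, hvz, hz⟩ (by omega)
  · obtain ⟨i, hi, rfl⟩ := Finset.mem_image.1 hv
    have hroot : f i ≠ r := by
      intro h
      have := hfd i hi
      rw [h, SimpleGraph.dist_self] at this
      rw [Finset.mem_Icc] at hi
      omega
    have hdist := hfd i hi
    have hanc := hfg i hi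
    rw [Finset.mem_Icc] at hi
    exact isBothDeep_of_isDeep hG hroot ⟨g, hanc, by omega⟩ (by omega)

theorem exists_dist_ge_of_isChain (hG : G.IsTree) {k : ℕ} {C : Finset V} (hne : C.Nonempty)
    (hC : IsChain (IsAnc G r) (C : Set V)) (hdeep : ∀ v ∈ C, IsDeep G r k v) :
    ∃ v ∈ C, ∃ z, IsAnc G r v z ∧ G.dist r v + C.card + k ≤ G.dist r z + 2 := by
  obtain ⟨v, hv, hmin⟩ := C.exists_min_image (G.dist r) hne
  obtain ⟨w, hw, hmax⟩ := C.exists_max_image (G.dist r) hne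
  obtain ⟨z, hwz, hz⟩ := hdeep w hw
  have hanc : ∀ x ∈ C, ∀ y ∈ C, G.dist r x ≤ G.dist r y → IsAnc G r x y := by
    intro x hx y hy hxy
    rcases hC.total hx hy with h | h
    · exact h
    · exact h.eq_of_dist_le hG hxy ▸ IsAnc.refl _
  refine ⟨v, hv, z, (hanc v hv w hw (hmin w hw)).trans hwz, ?_⟩
  have hcard : C.card ≤ (Finset.Icc (G.dist r v) (G.dist r w)).card := by
    refine Finset.card_le_card_of_injOn (G.dist r) (fun x hx => ?_) fun x hx y hy hxy => ?_
    · exact Finset.mem_coe.2 (Finset.mem_Icc.2 ⟨hmin x hx, hmax x hx⟩)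
    · exact (hanc x hx y hy hxy.le).antisymm hG (hanc y hy x hx hxy.ge)
  rw [Nat.card_Icc] at hcard
  have := hmin w hw
  omega

theorem card_add_le_of_isChain (hG : G.IsTree) {k L : ℕ} (hL : ∀ x y, G.dist x y ≤ L)
    {C : Finset V} (hne : C.Nonempty) (hC : IsChain (IsAnc G r) (C : Set V))
    (hdeep : ∀ v ∈ C, IsBothDeep G r k v) : C.card + 2 * k ≤ L + 2 := by
  obtain ⟨v, hv, z, hvz, hz⟩ := exists_dist_ge_of_isChain hG hne hC fun v hv => (hdeep v hv).2.1
  obtain ⟨hr, -, y, hvy, hy⟩ := hdeep v hv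
  have := dist_eq_of_not_isAnc_of_isAnc hG hr hvy hvz
  have := hL y z
  omega

theorem card_add_card_add_le_of_isChain_of_isChain (hG : G.IsTree) {k L : ℕ}
    (hL : ∀ x y, G.dist x y ≤ L) {C D : Finset V} (hneC : C.Nonempty) (hneD : D.Nonempty)
    (hC : IsChain (IsAnc G r) (C : Set V)) (hD : IsChain (IsAnc G r) (D : Set V))
    (hdeepC : ∀ v ∈ C, IsBothDeep G r k v) (hdeepD : ∀ v ∈ D, IsBothDeep G r k v)
    (hCD : ∀ v ∈ C, ∀ w ∈ D, ¬ IsAnc G r v w ∧ ¬ IsAnc G r w v) :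
    C.card + D.card + 2 * k ≤ L + 2 := by
  obtain ⟨v, hv, z, hvz, hz⟩ := exists_dist_ge_of_isChain hG hneC hC fun v hv => (hdeepC v hv).2.1
  obtain ⟨w, hw, y, hwy, hy⟩ := exists_dist_ge_of_isChain hG hneD hD fun v hv => (hdeepD v hv).2.1
  obtain ⟨hvw, hwv⟩ := hCD v hv w hw
  have hvy : ¬ IsAnc G r v y := fun h => (h.total hwy).elim hvw hwv
  have hwp : ¬ IsAnc G r w (parent G r v) := fun h => hwv (h.trans (IsAnc.parent_left v))
  have hyz := dist_eq_of_not_isAnc_of_isAnc hG (hdeepC v hv).1 hvy hvz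
  have hpy := dist_eq_of_not_isAnc_of_isAnc hG (hdeepD w hw).1 hwp hwy
  rw [SimpleGraph.dist_comm] at hpy
  have := hL y z
  omega

theorem isChain_of_endsIn_subtree {S : ℕ → Set V} {T : ℕ} {C : Set V}
    (hC : ∀ v ∈ C, EndsIn S T (subtree G r v)) : IsChain (IsAnc G r) C := by
  intro v hv w hw _
  obtain ⟨x, hvx, hwx⟩ := (hC v hv).inter_nonempty (hC w hw)
  exact IsAnc.total hvx hwx

theorem isChain_of_subset_subtree {A C : Set V} (hA : A.Nonempty)
    (hC : ∀ v ∈ C, A ⊆ subtree G r v) : IsChain (IsAnc G r) C := by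
  intro v hv w hw _
  obtain ⟨x, hx⟩ := hA
  exact IsAnc.total (hC v hv hx) (hC w hw hx)

theorem not_isAnc_and_not_isAnc_of_endsIn {S : ℕ → Set V} {T : ℕ} (hS : (S 0).Nonempty) {v w : V}
    (hv : EndsIn S T (subtree G r v)) (hw : EndsIn S T (subtree G r w)ᶜ) :
    ¬ IsAnc G r v w ∧ ¬ IsAnc G r w v := by
  constructor
  · intro hvw
    obtain ⟨x, hx⟩ := hS
    have hwx : IsAnc G r w x := Set.disjoint_compl_right_iff_subset.1 hw.1 hx
    exact Set.disjoint_left.1 hv.1 hx (hvw.trans hwx)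
  · intro hwv
    obtain ⟨x, hvx, hwx⟩ := hv.inter_nonempty hw
    exact hwx (hwv.trans hvx)

theorem Crosses.ne_root_and_parentEdge_eq (hG : G.IsTree) {S : ℕ → Set V} {v x y : V} {t : ℕ}
    (h : Crosses S (subtree G r v) t) (hyx : G.Adj y x) (hy : y ∈ S t)
    (hx : S (t + 1) ⊆ insert x (S t)) : v ≠ r ∧ parentEdge G r v = s(x, y) := by
  rcases h with h | h
  · obtain ⟨hvx, hvy⟩ := h.mem_and_notMem hy hx
    obtain ⟨rfl, hr, rfl⟩ := eq_and_eq_parent_of_adj_of_not_isAnc hG hyx.symm hvx hvy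
    exact ⟨hr, rfl⟩
  · obtain ⟨hvx, hvy⟩ := h.mem_and_notMem hy hx
    obtain ⟨rfl, hr, rfl⟩ :=
      eq_and_eq_parent_of_adj_of_not_isAnc hG hyx (not_not.1 hvy) hvx
    exact ⟨hr, Sym2.eq_swap⟩

/-- The set `A` does not contain both ends of the edge from `v` to its parent, so a sweep that
starts at `A` still has to cross this edge. -/
def IsExposed (G : SimpleGraph V) (r : V) (A : Set V) (v : V) : Prop :=
  v ≠ r ∧ ¬ (v ∈ A ∧ parent G r v ∈ A)

theorem IsExposed.disjoint_or_subset (hG : G.IsTree) {A : Set V} (hA : (G.induce A).Connected)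
    {v : V} (hv : IsExposed G r A v) : Disjoint A (subtree G r v) ∨ A ⊆ subtree G r v := by
  by_contra! h
  obtain ⟨⟨x, hx, hvx⟩, hsubset⟩ := And.imp_left Set.not_disjoint_iff.1 h
  obtain ⟨y, hy, hvy⟩ := Set.not_subset.1 hsubset
  obtain ⟨hvA, hparent, -⟩ := mem_and_parent_mem_of_connected hG hA hx hy hvx hvy
  exact hv.2 ⟨hvA, hparent⟩

theorem card_le_card_isExposed_add_ncard [Fintype V] (hG : G.IsTree) {A : Set V}
    (hA : A.Nonempty) : open Classical in
    Fintype.card V ≤ ({v | IsExposed G r A v} : Finset V).card + A.ncard := by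
  classical
  obtain ⟨t, ht, hmin⟩ := Set.exists_min_image A (G.dist r) (Set.toFinite _) hA
  set X : Finset V := {v | IsExposed G r A v}
  have hcover : Finset.univ ⊆ X ∪ insert r (A.toFinset.erase t) := by
    intro v _
    by_cases hvr : v = r
    · simp [hvr]
    by_cases hv : v ∈ A ∧ parent G r v ∈ A
    · have hvt : v ≠ t := by
        rintro rfl
        have := hmin _ hv.2
        have := dist_parent hG hvr
        omega
      simp [hvt, hv.1]
    · exact Finset.mem_union_left _ (Finset.mem_filter.2 ⟨Finset.mem_univ v, hvr, hv⟩)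
  have hcard : (insert r (A.toFinset.erase t)).card ≤ A.ncard := by
    refine (Finset.card_insert_le _ _).trans ?_
    rw [Finset.card_erase_add_one (by simpa using ht), Set.ncard_eq_toFinset_card']
  exact ((Finset.card_le_card hcover).trans (Finset.card_union_le _ _)).trans (by omega)

/-- A sequence of connected vertex sets of size `k` that grows by at most one vertex in each
step. The occupied sets of a restricted spanning walk form a sweep. -/
structure IsSweep (G : SimpleGraph V) (k T : ℕ) (S : ℕ → Set V) : Prop where
  connected : ∀ t ≤ T, (G.induce (S t)).Connected
  ncard : ∀ t ≤ T, (S t).ncard = k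
  step : ∀ t < T, ∃ x y, G.Adj y x ∧ y ∈ S t ∧ S (t + 1) ⊆ insert x (S t)
  spanning : ∀ v, ∃ t ≤ T, v ∈ S t

namespace IsSweep

variable {k T : ℕ} {S : ℕ → Set V}

theorem nonempty (hS : IsSweep G k T S) {t : ℕ} (ht : t ≤ T) : (S t).Nonempty :=
  have := (hS.connected t ht).nonempty
  Set.Nonempty.of_subtype

theorem exists_subset_subtree [Finite V] (hG : G.IsTree) (hS : IsSweep G k T S) {v : V}
    (hv : IsBothDeep G r k v) : ∃ t ≤ T, S t ⊆ subtree G r v := by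
  obtain ⟨hr, ⟨z, hvz, hz⟩, -⟩ := hv
  obtain ⟨t, ht, hzt⟩ := hS.spanning z
  refine ⟨t, ht, fun x hx => by_contra fun hvx => ?_⟩
  have hxz := dist_lt_ncard_of_connected (hS.connected t ht) hx hzt
  have := dist_eq_of_not_isAnc_of_isAnc hG hr hvx hvz
  rw [hS.ncard t ht] at hxz
  omega

theorem exists_subset_compl_subtree [Finite V] (hG : G.IsTree) (hS : IsSweep G k T S) {v : V}
    (hv : IsBothDeep G r k v) : ∃ t ≤ T, S t ⊆ (subtree G r v)ᶜ := by
  obtain ⟨hr, -, y, hvy, hy⟩ := hv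
  obtain ⟨t, ht, hyt⟩ := hS.spanning y
  refine ⟨t, ht, fun x hx hvx => ?_⟩
  have hyx := dist_lt_ncard_of_connected (hS.connected t ht) hyt hx
  have := dist_eq_of_not_isAnc_of_isAnc hG hr hvy hvx
  have := hvx.dist_le hG
  rw [hS.ncard t ht] at hyx
  omega

theorem sum_card_crossings_le [Fintype V] (hG : G.IsTree) (hS : IsSweep G k T S) :
    ∑ v, (crossings S T (subtree G r v)).card ≤ T := by
  classical
  have hcount := Finset.sum_card_bipartiteAbove_eq_sum_card_bipartiteBelow (s := Finset.univ)
    (t := Finset.range T) fun v => Crosses S (subtree G r v)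
  have hone : ∀ t ∈ Finset.range T,
      (Finset.univ.bipartiteBelow (fun v => Crosses S (subtree G r v)) t).card ≤ 1 := by
    intro t ht
    obtain ⟨x, y, hyx, hy, hx⟩ := hS.step t (Finset.mem_range.1 ht)
    refine Finset.card_le_one.2 fun v hv w hw => ?_
    obtain ⟨hvr, hvxy⟩ :=
      (Finset.mem_filter.1 hv).2.ne_root_and_parentEdge_eq hG hyx hy hx
    obtain ⟨hwr, hwxy⟩ :=
      (Finset.mem_filter.1 hw).2.ne_root_and_parentEdge_eq hG hyx hy hx
    exact parentEdge_injOn hG hvr hwr (hvxy.trans hwxy.symm)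
  calc ∑ v, (crossings S T (subtree G r v)).card
      = ∑ t ∈ Finset.range T,
          (Finset.univ.bipartiteBelow (fun v => Crosses S (subtree G r v)) t).card := by
        rw [← hcount]
        refine Finset.sum_congr rfl fun v _ => congrArg Finset.card ?_
        ext t
        simp [mem_crossings, Finset.mem_bipartiteAbove]
    _ ≤ ∑ _t ∈ Finset.range T, 1 := Finset.sum_le_sum hone
    _ = T := by simp

theorem card_crossings_pos_of_isBothDeep [Finite V] (hG : G.IsTree) (hS : IsSweep G k T S) {v : V}
    (hv : IsBothDeep G r k v) : 0 < (crossings S T (subtree G r v)).card := by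
  obtain ⟨i, hi, hiv⟩ := hS.exists_subset_subtree hG hv
  obtain ⟨j, hj, hjv⟩ := hS.exists_subset_compl_subtree hG hv
  exact card_crossings_pos_of_subset_of_subset_compl hi hj (hS.nonempty hi) (hS.nonempty hj) hiv hjv

theorem card_crossings_pos_of_isExposed (hG : G.IsTree) (hS : IsSweep G k T S) {v : V}
    (hv : IsExposed G r (S 0) v) : 0 < (crossings S T (subtree G r v)).card := by
  rcases hv.disjoint_or_subset hG (hS.connected 0 (Nat.zero_le _)) with h | h
  · obtain ⟨j, hj, hjv⟩ := hS.spanning v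
    exact card_crossings_pos (Nat.zero_le j) hj h ⟨v, hjv, IsAnc.refl v⟩
  · obtain ⟨j, hj, hjv⟩ := hS.spanning (parent G r v)
    rw [← crossings_compl]
    exact card_crossings_pos (Nat.zero_le j) hj (Set.disjoint_compl_right_iff_subset.2 h)
      ⟨_, hjv, not_isAnc_parent hG hv.1⟩

theorem endsIn_of_card_crossings_le_one [Finite V] (hG : G.IsTree) (hS : IsSweep G k T S) {v : V}
    (hdeep : IsBothDeep G r k v) (hexposed : IsExposed G r (S 0) v)
    (hcard : (crossings S T (subtree G r v)).card ≤ 1) :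
    EndsIn S T (subtree G r v) ∨ EndsIn S T (subtree G r v)ᶜ := by
  rcases hexposed.disjoint_or_subset hG (hS.connected 0 (Nat.zero_le _)) with h | h
  · exact Or.inl (RHWP.endsIn_of_card_crossings_le_one (fun t => hS.nonempty) hcard h
      (hS.exists_subset_subtree hG hdeep))
  · exact Or.inr (RHWP.endsIn_of_card_crossings_le_one (fun t => hS.nonempty)
      (by rwa [crossings_compl]) (Set.disjoint_compl_right_iff_subset.2 h)
      (hS.exists_subset_compl_subtree hG hdeep))

theorem card_le_of_card_crossings_le_one [Finite V] (hG : G.IsTree) (hS : IsSweep G k T S) {L : ℕ}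
    (hL : ∀ x y, G.dist x y ≤ L) {F : Finset V} (hdeep : ∀ v ∈ F, IsBothDeep G r k v)
    (hexposed : ∀ v ∈ F, IsExposed G r (S 0) v)
    (hcard : ∀ v ∈ F, (crossings S T (subtree G r v)).card ≤ 1) : F.card ≤ L + 2 - 2 * k := by
  classical
  set C := F.filter fun v => EndsIn S T (subtree G r v)
  set D := F.filter fun v => EndsIn S T (subtree G r v)ᶜ
  have hFCD : F.card ≤ C.card + D.card := by
    refine (Finset.card_le_card fun v hv => ?_).trans (Finset.card_union_le _ _)
    rw [← Finset.filter_or]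
    exact Finset.mem_filter.2
      ⟨hv, hS.endsIn_of_card_crossings_le_one hG (hdeep v hv) (hexposed v hv) (hcard v hv)⟩
  have hdeepC : ∀ v ∈ C, IsBothDeep G r k v := fun v hv => hdeep v (Finset.mem_filter.1 hv).1
  have hdeepD : ∀ v ∈ D, IsBothDeep G r k v := fun v hv => hdeep v (Finset.mem_filter.1 hv).1
  have hne := hS.nonempty (Nat.zero_le _)
  have hC : IsChain (IsAnc G r) (C : Set V) :=
    isChain_of_endsIn_subtree fun v hv => (Finset.mem_filter.1 hv).2
  have hD : IsChain (IsAnc G r) (D : Set V) := isChain_of_subset_subtree hne fun v hv =>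
    Set.disjoint_compl_right_iff_subset.1 (Finset.mem_filter.1 hv).2.1
  have hCD : ∀ v ∈ C, ∀ w ∈ D, ¬ IsAnc G r v w ∧ ¬ IsAnc G r w v := fun v hv w hw =>
    not_isAnc_and_not_isAnc_of_endsIn hne (Finset.mem_filter.1 hv).2 (Finset.mem_filter.1 hw).2
  rcases C.eq_empty_or_nonempty with hC0 | hneC <;> rcases D.eq_empty_or_nonempty with hD0 | hneD
  · simp only [hC0, hD0, Finset.card_empty] at hFCD
    omega
  · have := card_add_le_of_isChain hG hL hneD hD hdeepD
    rw [hC0, Finset.card_empty] at hFCD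
    omega
  · have := card_add_le_of_isChain hG hL hneC hC hdeepC
    rw [hD0, Finset.card_empty] at hFCD
    omega
  · have := card_add_card_add_le_of_isChain_of_isChain hG hL hneC hneD hC hD hdeepC hdeepD hCD
    omega

theorem card_add_card_detourVertices_le [Fintype V] (hG : G.IsTree) (hS : IsSweep G k T S)
    (hk : 1 ≤ k) {g : V} (hL : ∀ x y, G.dist x y ≤ G.dist r g) :
    Fintype.card V + (detourVertices G r g k).card ≤ T + k := by
  classical
  set X : Finset V := {v | IsExposed G r (S 0) v}
  set E : Finset V := {v | IsBothDeep G r k v}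
  set F := E.filter fun v =>
    IsExposed G r (S 0) v ∧ (crossings S T (subtree G r v)).card ≤ 1
  have hpaid : X.card + (E \ F).card ≤ T := by
    calc X.card + (E \ F).card
        = ∑ v, ((if v ∈ X then 1 else 0) + if v ∈ E \ F then 1 else 0) := by
          simp only [Finset.sum_add_distrib, Finset.sum_ite_mem, Finset.univ_inter,
            Finset.sum_const, smul_eq_mul, mul_one]
      _ ≤ ∑ v, (crossings S T (subtree G r v)).card := by
          refine Finset.sum_le_sum fun v _ => ?_
          have hpos : v ∈ X → 0 < (crossings S T (subtree G r v)).card := fun hv =>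
            hS.card_crossings_pos_of_isExposed hG (Finset.mem_filter.1 hv).2
          have hdeep : v ∈ E → 0 < (crossings S T (subtree G r v)).card := fun hv =>
            hS.card_crossings_pos_of_isBothDeep hG (Finset.mem_filter.1 hv).2
          have htwice : v ∈ E \ F → v ∈ X → 1 < (crossings S T (subtree G r v)).card := by
            intro hv hvX
            by_contra! hle
            exact (Finset.mem_sdiff.1 hv).2 (Finset.mem_filter.2
              ⟨(Finset.mem_sdiff.1 hv).1, (Finset.mem_filter.1 hvX).2, hle⟩)
          have hsubset : v ∈ E \ F → v ∈ E := fun hv => (Finset.mem_sdiff.1 hv).1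
          split_ifs <;> grind
      _ ≤ T := hS.sum_card_crossings_le hG
  have hFcard : F.card ≤ G.dist r g + 2 - 2 * k :=
    hS.card_le_of_card_crossings_le_one hG hL
      (fun v hv => (Finset.mem_filter.1 (Finset.mem_filter.1 hv).1).2)
      (fun v hv => (Finset.mem_filter.1 hv).2.1) fun v hv => (Finset.mem_filter.1 hv).2.2
  have hEF : (E \ F).card + F.card = E.card :=
    Finset.card_sdiff_add_card_eq_card (Finset.filter_subset _ _)
  have hstart : Fintype.card V ≤ X.card + k := by
    rw [← hS.ncard 0 (Nat.zero_le _)]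
    exact card_le_card_isExposed_add_ncard hG (hS.nonempty (Nat.zero_le _))
  have hdeep : (detourVertices G r g k).card + (G.dist r g + 2 - 2 * k) ≤ E.card :=
    card_detourVertices_add_le_card_isBothDeep hG hk hL
  omega

end IsSweep

theorem IsRestrictedSpanningWalk.isSweep {V : Type} {G : SimpleGraph V} {k : ℕ}
    {W : List (Fin k → V)} (hW : IsRestrictedSpanningWalk G W) :
    IsSweep G k (W.length - 1) fun t => {x | ∃ c, W[t]? = some c ∧ x ∈ Set.range c} := by
  have hpos := List.length_pos_of_ne_nil hW.nonempty
  have hrange : ∀ t (ht : t < W.length),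
      {x | ∃ c, W[t]? = some c ∧ x ∈ Set.range c} = Set.range W[t] := by
    intro t ht
    ext x
    simp [List.getElem?_eq_getElem ht]
  constructor
  · intro t ht
    rw [hrange t (by omega)]
    exact (hW.config _ (List.getElem_mem _)).2
  · intro t ht
    rw [hrange t (by omega), ← Nat.card_coe_set_eq,
      Nat.card_range_of_injective (hW.config _ (List.getElem_mem _)).1, Nat.card_fin]
  · intro t ht
    rw [hrange t (by omega), hrange (t + 1) (by omega)]
    obtain ⟨hadj, hone⟩ := List.isChain_iff_getElem.1 hW.chain t (by omega)
    obtain ⟨x, hx⟩ := Set.ncard_eq_one.1 hone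
    obtain ⟨⟨i, hi⟩, hxt⟩ : x ∈ Set.range W[t + 1] \ Set.range W[t] := by rw [hx]; rfl
    refine ⟨x, W[t] i, ?_, ⟨i, rfl⟩, fun y hy => ?_⟩
    · rw [← hi]
      exact (hadj i).resolve_left fun h => hxt ⟨i, by rw [h, hi]⟩
    · by_cases hyt : y ∈ Set.range W[t]
      · exact Or.inr hyt
      · have hynew : y ∈ Set.range W[t + 1] \ Set.range W[t] := ⟨hy, hyt⟩
        rw [hx] at hynew
        exact Or.inl hynew
  · intro v
    obtain ⟨c, hc, hv⟩ := hW.spanning v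
    obtain ⟨t, ht, rfl⟩ := List.getElem_of_mem hc
    exact ⟨t, by omega, W[t], List.getElem?_eq_getElem ht, hv⟩

end LowerBound

/-! ## Detour edges -/

section Detour

variable {V : Type} {G : SimpleGraph V} {a b : V}

theorem IsLongestPath.length_eq_dist (hG : G.IsTree) {P : G.Walk a b} (hP : IsLongestPath G P) :
    P.length = G.dist a b := by
  obtain ⟨p, hp, hpdist⟩ := hG.connected.exists_path_of_dist a b
  rw [← hpdist, (hG.existsUnique_path a b).unique hp hP.1]

theorem IsLongestPath.dist_le (hG : G.IsTree) {P : G.Walk a b} (hP : IsLongestPath G P) (x y : V) :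
    G.dist x y ≤ G.dist a b := by
  obtain ⟨p, hp, hpdist⟩ := hG.connected.exists_path_of_dist x y
  rw [← hpdist, ← hP.length_eq_dist hG]
  exact hP.2 x y p hp

theorem parentEdge_mem_edges {V : Type*} {G : SimpleGraph V} {r x y v : V} (hG : G.IsTree)
    (p : G.Walk x y) (hx : ¬ IsAnc G r v x) (hy : IsAnc G r v y) :
    parentEdge G r v ∈ p.edges := by
  induction p with
  | nil => exact absurd hy hx
  | @cons x x' y h p ih =>
    rw [SimpleGraph.Walk.edges_cons]
    by_cases hx' : IsAnc G r v x'
    · obtain ⟨rfl, -, rfl⟩ := eq_and_eq_parent_of_adj_of_not_isAnc hG h.symm hx' hx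
      rw [parentEdge, Sym2.eq_swap]
      exact List.mem_cons_self
    · exact List.mem_cons_of_mem _ (ih hx' hy)

theorem IsLongestPath.mem_support (hG : G.IsTree) {P : G.Walk a b} (hP : IsLongestPath G P)
    {w : V} : w ∈ P.support ↔ IsAnc G a w b := by
  constructor
  · intro hw
    obtain ⟨q, q', rfl⟩ := SimpleGraph.Walk.mem_support_iff_exists_append.1 hw
    have hlength := hP.length_eq_dist hG
    rw [SimpleGraph.Walk.length_append] at hlength
    have := SimpleGraph.dist_le q
    have := SimpleGraph.dist_le q'
    have : G.dist a b ≤ G.dist a w + G.dist w b := hG.connected.dist_triangle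
    exact (isAnc_iff_dist hG).2 (by omega)
  · intro hw
    by_cases hwa : w = a
    · exact hwa ▸ P.start_mem_support
    · exact P.fst_mem_support_of_mem_edges (parentEdge_mem_edges hG P
        (fun h => hwa (h.antisymm hG (IsAnc.root hG w))) hw)

theorem IsLongestPath.parentEdge_mem_edges_iff (hG : G.IsTree) {P : G.Walk a b}
    (hP : IsLongestPath G P) {v : V} (hv : v ≠ a) :
    parentEdge G a v ∈ P.edges ↔ IsAnc G a v b :=
  ⟨fun h => (hP.mem_support hG).1 (P.fst_mem_support_of_mem_edges h), fun h =>
    parentEdge_mem_edges hG P (fun h' => hv (h'.antisymm hG (IsAnc.root hG v))) h⟩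

theorem IsLongestPath.distToPath_parent_lt (hG : G.IsTree) {P : G.Walk a b}
    (hP : IsLongestPath G P) {v : V} (hv : ¬ IsAnc G a v b) :
    distToPath G P (parent G a v) < distToPath G P v := by
  have hva : v ≠ a := by rintro rfl; exact hv (IsAnc.root hG b)
  obtain ⟨w, hw, hvw : G.dist v w = distToPath G P v⟩ :=
    Nat.sInf_mem (s := {m | ∃ w ∈ P.support, G.dist v w = m}) ⟨_, a, P.start_mem_support, rfl⟩
  have hwv : ¬ IsAnc G a v w := fun h => hv (h.trans ((hP.mem_support hG).1 hw))
  have hdist := dist_eq_of_not_isAnc_of_isAnc hG hva hwv (IsAnc.refl v)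
  rw [SimpleGraph.dist_comm (u := w), SimpleGraph.dist_comm (u := w)] at hdist
  have : distToPath G P (parent G a v) ≤ G.dist (parent G a v) w := Nat.sInf_le ⟨w, hw, rfl⟩
  omega

section Branch

variable {V : Type*} {G : SimpleGraph V} {r v z : V}

theorem exists_walk_deleteEdges_length_eq (hG : G.IsTree) (hv : v ≠ r) (hz : IsAnc G r v z) :
    ∃ p : (G.deleteEdges {parentEdge G r v}).Walk v z, p.length = G.dist v z := by
  induction z using parent_induction hG (r := r) with
  | root => exact absurd (hz.antisymm hG (IsAnc.root hG v)) hv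
  | step z hzr ih =>
    by_cases hvz : v = z
    · subst hvz
      exact ⟨SimpleGraph.Walk.nil, by simp⟩
    · obtain ⟨p, hp⟩ := ih (hz.parent_right hvz)
      have hadj : (G.deleteEdges {parentEdge G r v}).Adj (parent G r z) z := by
        rw [SimpleGraph.deleteEdges_adj]
        refine ⟨(adj_parent hG hzr).symm, fun h => ?_⟩
        rcases Sym2.eq_iff.1 (show s(parent G r z, z) = s(v, parent G r v) from h) with
          ⟨-, hzv⟩ | ⟨-, hzv⟩
        · exact not_isAnc_parent hG hv (hzv ▸ hz)
        · exact hvz hzv.symm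
      refine ⟨p.concat hadj, ?_⟩
      have := hz.dist_add_dist hG
      have := (hz.parent_right hvz).dist_add_dist hG
      have := dist_parent hG hzr
      rw [SimpleGraph.Walk.length_concat]
      omega

theorem dist_deleteEdges_of_isAnc (hG : G.IsTree) (hv : v ≠ r) (hz : IsAnc G r v z) :
    (G.deleteEdges {parentEdge G r v}).dist v z = G.dist v z := by
  obtain ⟨p, hp⟩ := exists_walk_deleteEdges_length_eq hG hv hz
  exact le_antisymm (hp ▸ SimpleGraph.dist_le p)
    (p.reachable.dist_anti (G.deleteEdges_le {parentEdge G r v}))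

theorem isAnc_of_reachable_deleteEdges (hG : G.IsTree)
    (h : (G.deleteEdges {parentEdge G r v}).Reachable v z) : IsAnc G r v z := by
  obtain ⟨p⟩ := h
  by_contra hz
  obtain ⟨d, -, hfst, hsnd⟩ := p.exists_boundary_dart (subtree G r v) (IsAnc.refl v) hz
  have hadj := SimpleGraph.deleteEdges_adj.1 d.adj
  obtain ⟨hv, -, hparent⟩ := eq_and_eq_parent_of_adj_of_not_isAnc hG hadj.1 hfst hsnd
  exact hadj.2 (by rw [hv, hparent]; rfl)

end Branch

theorem lt_branchHeight_iff [Fintype V] (hG : G.IsTree) {r v : V} {k : ℕ} (hv : v ≠ r) :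
    k < branchHeight G (parentEdge G r v) v + 2 ↔ IsDeep G r k v := by
  unfold branchHeight
  constructor
  · intro h
    obtain ⟨z, -, hz⟩ := Finset.exists_mem_eq_sup Finset.univ ⟨v, Finset.mem_univ v⟩
      fun z => (G.deleteEdges {parentEdge G r v}).dist v z
    rw [hz] at h
    by_cases hvz : (G.deleteEdges {parentEdge G r v}).Reachable v z
    · have hanc := isAnc_of_reachable_deleteEdges hG hvz
      rw [dist_deleteEdges_of_isAnc hG hv hanc] at h
      exact ⟨z, hanc, by have := hanc.dist_add_dist hG; omega⟩
    · rw [SimpleGraph.dist_eq_zero_of_not_reachable hvz] at h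
      exact ⟨v, IsAnc.refl v, by omega⟩
  · rintro ⟨z, hvz, hz⟩
    have hsup := Finset.le_sup (f := fun z => (G.deleteEdges {parentEdge G r v}).dist v z)
      (Finset.mem_univ z)
    simp only [dist_deleteEdges_of_isAnc hG hv hvz] at hsup
    have := hvz.dist_add_dist hG
    omega

theorem detour_parentEdge [Fintype V] (hG : G.IsTree) {P : G.Walk a b} (hP : IsLongestPath G P)
    (k : ℕ) {v : V} (hv : v ≠ a) : open Classical in
    detour G k P (parentEdge G a v) = if ¬ IsAnc G a v b ∧ IsDeep G a k v then 1 else 0 := by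
  classical
  unfold detour
  by_cases hvb : IsAnc G a v b
  · rw [if_pos ((hP.parentEdge_mem_edges_iff hG hv).2 hvb), if_neg (by simp [hvb])]
  · rw [if_neg (fun h => hvb ((hP.parentEdge_mem_edges_iff hG hv).1 h))]
    have hlt := hP.distToPath_parent_lt hG hvb
    congr 1
    refine propext ⟨?_, ?_⟩
    · rintro ⟨u, w, he, hd, hk⟩
      rcases Sym2.eq_iff.1 (show s(v, parent G a v) = s(u, w) from he) with
        ⟨rfl, rfl⟩ | ⟨rfl, rfl⟩
      · omega
      · exact ⟨hvb, (lt_branchHeight_iff hG hv).1 hk⟩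
    · rintro ⟨-, hdeep⟩
      exact ⟨_, v, Sym2.eq_swap, hlt, (lt_branchHeight_iff hG hv).2 hdeep⟩

theorem sum_detour [Fintype V] [DecidableRel G.Adj] (hG : G.IsTree) {P : G.Walk a b}
    (hP : IsLongestPath G P) (k : ℕ) :
    ∑ e ∈ G.edgeFinset, detour G k P e = (detourVertices G a b k).card := by
  classical
  have hinj : Set.InjOn (parentEdge G a) (Finset.univ.erase a : Finset V) :=
    (parentEdge_injOn hG).mono fun v hv => Finset.ne_of_mem_erase hv
  have hedges : G.edgeFinset = (Finset.univ.erase a).image (parentEdge G a) := by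
    ext e
    simp [mem_edgeSet_iff_exists_parentEdge (r := a) hG]
  rw [hedges, Finset.sum_image hinj,
    Finset.sum_congr rfl fun v hv => detour_parentEdge hG hP k (Finset.ne_of_mem_erase hv),
    ← Finset.card_filter]
  congr 1
  ext v
  simp only [Finset.mem_filter, Finset.mem_erase, Finset.mem_univ, and_true]
  rw [detourVertices, Finset.mem_filter_univ]
  refine ⟨fun h => h.2, fun h => ⟨?_, h⟩⟩
  rintro rfl
  exact h.1 (IsAnc.root hG b)

end Detour

/-! ## Costs and results of the basic routines -/

namespace Timed

variable {α β : Type}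

theorem val_bind (x : Timed α) (f : α → Timed β) : (x >>= f).val = (f x.val).val := rfl

theorem cost_bind (x : Timed α) (f : α → Timed β) : (x >>= f).cost = x.cost + (f x.val).cost := rfl

theorem val_pure (a : α) : (pure a : Timed α).val = a := rfl

theorem cost_pure (a : α) : (pure a : Timed α).cost = 0 := rfl

theorem cost_tick : tick.cost = 1 := rfl

theorem cost_charge (m : ℕ) : (charge m).cost = m := rfl

end Timed

open Timed

section ListRoutines

variable {α : Type}

theorem findT_val (p : α → Bool) (l : List α) : (findT p l).val = l.find? p := by
  induction l with
  | nil => rfl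
  | cons x xs ih =>
    rw [findT, val_bind, List.find?_cons]
    cases h : p x
    · simpa using ih
    · rfl

theorem findT_cost_le (p : α → Bool) (l : List α) : (findT p l).cost ≤ l.length + 1 := by
  induction l with
  | nil => exact le_rfl
  | cons x xs ih =>
    rw [findT, cost_bind, cost_tick, List.length_cons]
    split_ifs
    · rw [cost_pure]
      omega
    · omega

theorem countT_val (p : α → Bool) (l : List α) : (countT p l).val = (l.filter p).length := by
  induction l with
  | nil => rfl
  | cons x xs ih =>
    rw [countT, val_bind, val_bind, val_pure, ih, List.filter_cons]
    split_ifs <;> rfl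

theorem countT_cost (p : α → Bool) (l : List α) : (countT p l).cost = l.length + 1 := by
  induction l with
  | nil => rfl
  | cons x xs ih =>
    rw [countT, cost_bind, cost_bind, cost_pure, ih, cost_tick, List.length_cons]
    omega

theorem filterT_val (p : α → Timed Bool) (l : List α) :
    (filterT p l).val = l.filter fun x => (p x).val := by
  induction l with
  | nil => rfl
  | cons x xs ih => rw [filterT, val_bind, val_bind, val_bind, val_pure, ih, List.filter_cons]

theorem filterT_cost_le (p : α → Timed Bool) (l : List α) {c : ℕ} (hc : ∀ x, (p x).cost ≤ c) :
    (filterT p l).cost ≤ l.length * (c + 1) + 1 := by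
  induction l with
  | nil => simp [filterT, cost_bind, cost_pure, cost_tick]
  | cons x xs ih =>
    rw [filterT, cost_bind, cost_bind, cost_bind, cost_pure, cost_tick, List.length_cons,
      Nat.succ_mul]
    have := hc x
    omega

theorem argMinT_cost (f : α → ℕ) (y : α) (l : List α) : (argMinT f y l).cost = l.length + 1 := by
  induction l generalizing y with
  | nil => rfl
  | cons x xs ih =>
    rw [argMinT, cost_bind, cost_tick, List.length_cons]
    split_ifs <;> rw [ih] <;> omega

theorem argMaxT_cost (f : α → ℕ) (y : α) (l : List α) : (argMaxT f y l).cost = l.length + 1 := by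
  induction l generalizing y with
  | nil => rfl
  | cons x xs ih =>
    rw [argMaxT, cost_bind, cost_tick, List.length_cons]
    split_ifs <;> rw [ih] <;> omega

theorem argMinT_mem_and_le (f : α → ℕ) (y : α) (l : List α) :
    (argMinT f y l).val ∈ y :: l ∧ ∀ x ∈ y :: l, f (argMinT f y l).val ≤ f x := by
  induction l generalizing y with
  | nil => simp [argMinT, val_bind, val_pure]
  | cons x xs ih =>
    rw [argMinT, val_bind]
    split_ifs with hxy
    · have := ih x
      grind
    · have := ih y
      grind

theorem argMaxT_mem_and_le (f : α → ℕ) (y : α) (l : List α) :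
    (argMaxT f y l).val ∈ y :: l ∧ ∀ x ∈ y :: l, f x ≤ f (argMaxT f y l).val := by
  induction l generalizing y with
  | nil => simp [argMaxT, val_bind, val_pure]
  | cons x xs ih =>
    rw [argMaxT, val_bind]
    split_ifs with hxy
    · have := ih x
      grind
    · have := ih y
      grind

theorem storeT_cost {V β : Type} [DecidableEq V] (key : α → V) (g : α → β) (l : List α)
    (a : V → β) : (storeT key g l a).cost = l.length + 1 := by
  induction l generalizing a with
  | nil => rfl
  | cons x xs ih =>
    rw [storeT, cost_bind, cost_tick, List.length_cons, ih]
    omega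

theorem storeT_val {V β : Type} [DecidableEq V] (key : α → V) (g : α → β) (f : V → β) (l : List α)
    (hf : ∀ x ∈ l, g x = f (key x)) (a : V → β) (v : V) :
    (storeT key g l a).val v = if v ∈ l.map key then f v else a v := by
  induction l generalizing a with
  | nil => rfl
  | cons x xs ih =>
    rw [storeT, val_bind, ih fun y hy => hf y (List.mem_cons_of_mem _ hy), List.map_cons]
    have := hf x List.mem_cons_self
    by_cases hv : v = key x <;> simp_all

end ListRoutines

section IterateParent

variable {V : Type*} {G : SimpleGraph V} {q v : V}

theorem mem_iterate_parent (hG : G.IsTree) {x : V} :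
    x ∈ List.iterate (parent G q) v (G.dist q v + 1) ↔ IsAnc G q x v := by
  rw [List.mem_iterate]
  constructor
  · rintro ⟨m, -, rfl⟩
    exact ⟨m, rfl⟩
  · induction v using parent_induction hG (r := q) with
    | root =>
      intro hx
      exact ⟨0, by simp, hx.antisymm hG (IsAnc.root hG x)⟩
    | step v hv ih =>
      intro hx
      by_cases hxv : x = v
      · exact ⟨0, by omega, by simp [hxv]⟩
      · obtain ⟨m, hm, rfl⟩ := ih (hx.parent_right hxv)
        exact ⟨m + 1, by have := dist_parent hG hv; omega, rfl⟩

theorem dist_iterate_parent (hG : G.IsTree) {i : ℕ} (hi : i ≤ G.dist q v) :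
    G.dist q ((parent G q)^[i] v) + i = G.dist q v := by
  induction i with
  | zero => simp
  | succ i ih =>
    have hdist := ih (by omega)
    have hne : (parent G q)^[i] v ≠ q := by
      intro h
      rw [h, SimpleGraph.dist_self] at hdist
      omega
    rw [Function.iterate_succ_apply']
    have := dist_parent hG hne
    omega

theorem iterate_parent_dist (hG : G.IsTree) (q v : V) : (parent G q)^[G.dist q v] v = q := by
  have := dist_iterate_parent hG (le_refl (G.dist q v))
  exact (hG.connected.dist_eq_zero_iff.1 (by omega)).symm

theorem nodup_iterate_parent (hG : G.IsTree) :
    (List.iterate (parent G q) v (G.dist q v + 1)).Nodup := by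
  rw [List.nodup_iff_injective_getElem]
  rintro ⟨i, hi⟩ ⟨j, hj⟩ hij
  simp only [List.getElem_iterate] at hij
  rw [List.length_iterate] at hi hj
  have hdisti := dist_iterate_parent hG (q := q) (v := v) (i := i) (by omega)
  have hdistj := dist_iterate_parent hG (q := q) (v := v) (i := j) (by omega)
  rw [hij] at hdisti
  exact Fin.ext (by change i = j; omega)

theorem isChain_iterate_parent (hG : G.IsTree) :
    (List.iterate (parent G q) v (G.dist q v + 1)).IsChain G.Adj := by
  induction v using parent_induction hG (r := q) with
  | root => simp
  | step v hv ih =>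
    rw [← dist_parent hG hv]
    exact List.isChain_cons_cons.2 ⟨adj_parent hG hv, ih⟩

end IterateParent

/-! ## Depth-first search of a forest -/

section SearchState

variable {V : Type}

/-- In the list of visits, every predecessor occurs after its successors: lists of visits are in
reverse order. -/
def PredBelow : List (Visit V) → Prop
  | [] => True
  | e :: l => (∀ u, e.pred = some u → u ∈ l.map Visit.vertex) ∧ PredBelow l

/-- The predecessors `pr` and the depths `dp` are those found by a search of a forest inside the
active vertices that only meets vertices of `D`. -/
def IsLabelling (G : SimpleGraph V) (active : V → Bool) (pr : V → Option V) (dp : V → ℕ)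
    (D : Set V) : Prop :=
  ∀ x w, x ∈ D → G.Adj x w → active w = true → pr x ≠ some w →
    w ∈ D ∧ pr w = some x ∧ dp w = dp x + 1

/-- The invariant of a search with the labels `pr` and `dp`: `st` is the stack, `acc` the list of
the visits made so far. The search is complete when the stack is empty. -/
structure IsSearchState (G : SimpleGraph V) (active : V → Bool) (pr : V → Option V) (dp : V → ℕ)
    (D : Set V) (st acc : List (Visit V)) : Prop where
  label : ∀ e ∈ st ++ acc, e.vertex ∈ D ∧ e.pred = pr e.vertex ∧ e.depth = dp e.vertex
  nodup : ((st ++ acc).map Visit.vertex).Nodup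
  pred_mem : ∀ e ∈ st ++ acc, ∀ u, e.pred = some u → u ∈ acc.map Visit.vertex
  predBelow : PredBelow acc
  closed : ∀ x ∈ acc.map Visit.vertex, ∀ w, G.Adj x w → active w = true → pr x ≠ some w →
    w ∈ (st ++ acc).map Visit.vertex

theorem IsSearchState.length_le [Finite V] {G : SimpleGraph V} {active : V → Bool}
    {pr : V → Option V} {dp : V → ℕ} {D : Set V} {st acc : List (Visit V)}
    (h : IsSearchState G active pr dp D st acc) :
    st.length + acc.length ≤ D.ncard := by
  classical
  rw [← List.length_append, ← List.length_map (f := Visit.vertex),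
    ← List.toFinset_card_of_nodup h.nodup, ← Set.ncard_coe_finset]
  refine Set.ncard_le_ncard (fun v hv => ?_) (Set.toFinite _)
  obtain ⟨e, he, rfl⟩ := List.mem_map.1 (List.mem_toFinset.1 hv)
  exact (h.label e he).1

end SearchState

section Search

variable {V : Type} [DecidableEq V]

/-- The visits that `pushNbrs` puts on the stack for the neighbours `ws` of `x`. -/
def pushedVisits (active : V → Bool) (x : Visit V) (ws : List V) : List (Visit V) :=
  (ws.filter fun w => active w && decide (x.pred ≠ some w)).map
    fun w => ⟨w, some x.vertex, x.depth + 1⟩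

theorem pushNbrs_val (active : V → Bool) (x : Visit V) (ws : List V) (st : List (Visit V)) :
    (pushNbrs active x ws st).val = (pushedVisits active x ws).reverse ++ st := by
  induction ws generalizing st with
  | nil => rfl
  | cons w ws ih =>
    rw [pushNbrs, val_bind, pushedVisits, List.filter_cons]
    split_ifs with h
    · rw [ih]
      simp [pushedVisits]
    · rw [ih, pushedVisits]

theorem pushNbrs_cost (active : V → Bool) (x : Visit V) (ws : List V) (st : List (Visit V)) :
    (pushNbrs active x ws st).cost = ws.length + 1 := by
  induction ws generalizing st with
  | nil => rfl
  | cons w ws ih =>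
    rw [pushNbrs, cost_bind, cost_tick, List.length_cons]
    split_ifs <;> rw [ih] <;> omega

theorem search_cost_le (A : AdjLists V) (active : V → Bool) {d : ℕ}
    (hd : ∀ v, (A.nbrs v).length ≤ d) (m : ℕ) (st acc : List (Visit V)) :
    (search A active m st acc).cost ≤ m * (d + 2) + 1 := by
  induction m generalizing st acc with
  | zero => simp [search, cost_bind, cost_pure, cost_tick]
  | succ m ih =>
    cases st with
    | nil => simp [search, cost_bind, cost_pure, cost_tick]
    | cons x st =>
      rw [search, cost_bind, cost_tick, cost_bind, pushNbrs_cost, Nat.succ_mul]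
      have := hd x.vertex
      have := ih (pushNbrs active x (A.nbrs x.vertex) st).val (x :: acc)
      omega

theorem search_length_le (A : AdjLists V) (active : V → Bool) (m : ℕ) (st acc : List (Visit V)) :
    (search A active m st acc).val.length ≤ m + acc.length := by
  induction m generalizing st acc with
  | zero => simp [search, val_bind, val_pure]
  | succ m ih =>
    cases st with
    | nil => simp [search, val_bind, val_pure]
    | cons x st =>
      rw [search, val_bind, val_bind]
      refine (ih _ _).trans ?_
      rw [List.length_cons]
      omega

theorem traceBack_cost_le (o : Option V) (l : List (Visit V)) :
    (traceBack o l).cost ≤ l.length + 1 := by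
  induction l generalizing o with
  | nil => cases o <;> exact le_rfl
  | cons x xs ih =>
    cases o with
    | none => simp [traceBack, cost_bind, cost_pure, cost_tick]
    | some v =>
      rw [traceBack, cost_bind, cost_tick, List.length_cons]
      split_ifs
      · rw [cost_bind, cost_pure]
        have := ih x.pred
        omega
      · have := ih (some v)
        omega

theorem traceBack_length_le (o : Option V) (l : List (Visit V)) :
    (traceBack o l).val.length ≤ l.length := by
  induction l generalizing o with
  | nil => cases o <;> exact le_rfl
  | cons x xs ih =>
    cases o with
    | none => simp [traceBack, val_bind, val_pure]
    | some v =>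
      rw [traceBack, val_bind, List.length_cons]
      split_ifs
      · rw [val_bind, val_pure, List.length_cons]
        have := ih x.pred
        omega
      · have := ih (some v)
        omega

namespace IsSearchState

variable {G : SimpleGraph V} {A : AdjLists V} {active : V → Bool} {pr : V → Option V}
  {dp : V → ℕ} {D : Set V} {x : Visit V} {st acc : List (Visit V)}

theorem exists_of_mem_pushedVisits (hA : A.Represents G) (hlabel : IsLabelling G active pr dp D)
    (h : IsSearchState G active pr dp D (x :: st) acc) {e : Visit V}
    (he : e ∈ pushedVisits active x (A.nbrs x.vertex)) :
    e.pred = some x.vertex ∧ e.vertex ∈ D ∧ e.pred = pr e.vertex ∧ e.depth = dp e.vertex := by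
  obtain ⟨hxD, hxpred, hxdepth⟩ := h.label x List.mem_cons_self
  obtain ⟨w, hw, rfl⟩ := List.mem_map.1 he
  obtain ⟨hwx, hactive⟩ := List.mem_filter.1 hw
  rw [Bool.and_eq_true, decide_eq_true_eq, hxpred] at hactive
  obtain ⟨hwD, hwpred, hwdepth⟩ :=
    hlabel _ _ hxD ((hA.mem_nbrs _ _).1 hwx) hactive.1 hactive.2
  exact ⟨rfl, hwD, hwpred.symm, by rw [hwdepth, ← hxdepth]⟩

theorem nodup_pushedVisits_append (hA : A.Represents G) (hlabel : IsLabelling G active pr dp D)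
    (h : IsSearchState G active pr dp D (x :: st) acc) :
    ((pushedVisits active x (A.nbrs x.vertex) ++ (x :: st ++ acc)).map Visit.vertex).Nodup := by
  have hxacc : x.vertex ∉ acc.map Visit.vertex := by
    have hnodup := h.nodup
    rw [List.cons_append, List.map_cons, List.nodup_cons] at hnodup
    exact fun hx => hnodup.1 (by rw [List.map_append]; exact List.mem_append_right _ hx)
  rw [List.map_append, List.nodup_append]
  refine ⟨?_, h.nodup, ?_⟩
  · rw [pushedVisits, List.map_map]
    exact ((hA.nbrs_nodup _).filter _).map fun _ _ => id
  · rintro v hv _ hv' rfl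
    obtain ⟨e, he, rfl⟩ := List.mem_map.1 hv
    obtain ⟨e', he', hee'⟩ := List.mem_map.1 hv'
    obtain ⟨hpred, -, hpr, -⟩ := h.exists_of_mem_pushedVisits hA hlabel he
    exact hxacc (h.pred_mem e' he' _ (by rw [(h.label e' he').2.1, hee', ← hpr, hpred]))

theorem push (hA : A.Represents G) (hlabel : IsLabelling G active pr dp D)
    (h : IsSearchState G active pr dp D (x :: st) acc) :
    IsSearchState G active pr dp D (pushNbrs active x (A.nbrs x.vertex) st).val (x :: acc) := by
  have hperm : ((pushNbrs active x (A.nbrs x.vertex) st).val ++ x :: acc).Perm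
      (pushedVisits active x (A.nbrs x.vertex) ++ (x :: st ++ acc)) := by
    rw [pushNbrs_val, List.append_assoc]
    exact (List.reverse_perm _).append List.perm_middle
  constructor
  · intro e he
    rcases List.mem_append.1 (hperm.mem_iff.1 he) with he | he
    · exact (h.exists_of_mem_pushedVisits hA hlabel he).2
    · exact h.label e he
  · exact ((hperm.map _).nodup_iff).2 (h.nodup_pushedVisits_append hA hlabel)
  · intro e he u hu
    rw [List.map_cons, List.mem_cons]
    rcases List.mem_append.1 (hperm.mem_iff.1 he) with he | he
    · rw [(h.exists_of_mem_pushedVisits hA hlabel he).1] at hu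
      exact Or.inl (Option.some.inj hu).symm
    · exact Or.inr (h.pred_mem e he u hu)
  · exact ⟨h.pred_mem x List.mem_cons_self, h.predBelow⟩
  · intro y hy w hyw hactive hpred
    rw [(hperm.map _).mem_iff, List.map_append, List.mem_append]
    rcases List.mem_cons.1 hy with rfl | hy
    · refine Or.inl (List.mem_map.2 ⟨_, List.mem_map.2 ⟨w, ?_, rfl⟩, rfl⟩)
      rw [List.mem_filter, hA.mem_nbrs, (h.label x List.mem_cons_self).2.1]
      simp [hyw, hactive, hpred]
    · exact Or.inr (h.closed y hy w hyw hactive hpred)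

theorem search [Finite V] (hA : A.Represents G) (hlabel : IsLabelling G active pr dp D) {m : ℕ}
    (h : IsSearchState G active pr dp D st acc) (hm : D.ncard ≤ m + acc.length) :
    IsSearchState G active pr dp D [] (search A active m st acc).val ∧
      ∀ e ∈ st ++ acc, e.vertex ∈ (search A active m st acc).val.map Visit.vertex := by
  induction m generalizing st acc with
  | zero =>
    obtain rfl : st = [] := List.length_eq_zero_iff.1 (by have := h.length_le; omega)
    exact ⟨h, fun e he => List.mem_map_of_mem he⟩
  | succ m ih =>
    cases st with
    | nil => exact ⟨h, fun e he => List.mem_map_of_mem he⟩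
    | cons x st =>
      rw [RHWP.search, val_bind, val_bind]
      refine And.imp_right (fun hmem e he => hmem e ?_)
        (ih (h.push hA hlabel) (by rw [List.length_cons]; omega))
      rw [pushNbrs_val]
      simp only [List.mem_append, List.mem_cons] at he ⊢
      tauto

end IsSearchState

theorem traceBack_none (l : List (Visit V)) : (traceBack none l).val = [] := by
  cases l <;> rfl

theorem traceBack_eq_iterate {f : V → V} {pr : V → Option V} {n : V → ℕ}
    (hnone : ∀ v, pr v = none → n v = 0)
    (hsome : ∀ v u, pr v = some u → f v = u ∧ n v = n u + 1)
    {l : List (Visit V)} (hl : ∀ e ∈ l, e.pred = pr e.vertex) (hbelow : PredBelow l) {v : V}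
    (hv : v ∈ l.map Visit.vertex) : (traceBack (some v) l).val = List.iterate f v (n v + 1) := by
  induction l generalizing v with
  | nil => simp at hv
  | cons e l ih =>
    have ih := @ih (fun e he => hl e (List.mem_cons_of_mem _ he)) hbelow.2
    rw [traceBack, val_bind]
    split_ifs with hev
    · have hpred := hl e List.mem_cons_self
      rw [hev] at hpred
      rw [val_bind, val_pure]
      cases hpr : pr v with
      | none =>
        rw [hpred, hpr, traceBack_none, hnone v hpr]
        rfl
      | some u =>
        obtain ⟨rfl, hn⟩ := hsome v u hpr
        rw [hpred, hpr, ih (hbelow.1 _ (by rw [hpred, hpr])), hn]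
        rfl
    · exact ih ((List.mem_cons.1 hv).resolve_left fun h => hev h.symm)

/-- The predecessor of `v` in a search of the tree `G` from `q`. -/
noncomputable def treePred (G : SimpleGraph V) (q v : V) : Option V :=
  if v = q then none else some (parent G q v)

variable {G : SimpleGraph V} {A : AdjLists V} {active : V → Bool} {q : V}

theorem treePred_eq_some_iff {v u : V} : treePred G q v = some u ↔ v ≠ q ∧ parent G q v = u := by
  simp [treePred]

theorem isLabelling_treePred (hG : G.IsTree) :
    IsLabelling G active (treePred G q) (G.dist q) {v | active v = true} := by
  intro x w _ hxw hw hpred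
  rcases parent_eq_or_parent_eq_of_adj (r := q) hG hxw with hx | ⟨hwq, hparent⟩
  · exact absurd (treePred_eq_some_iff.2 hx) hpred
  · exact ⟨hw, treePred_eq_some_iff.2 ⟨hwq, hparent⟩, by rw [← dist_parent hG hwq, hparent]⟩

theorem isSearchState_search_of_forall_active_parent [Finite V] (hG : G.IsTree)
    (hA : A.Represents G) (hq : active q = true)
    (hparent : ∀ v, active v = true → active (parent G q v) = true) {m : ℕ}
    (hm : {v | active v = true}.ncard ≤ m) :
    IsSearchState G active (treePred G q) (G.dist q) {v | active v = true} []
      (search A active m [⟨q, none, 0⟩] []).val ∧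
    ∀ v, active v = true → v ∈ (search A active m [⟨q, none, 0⟩] []).val.map Visit.vertex := by
  have hinitial : IsSearchState G active (treePred G q) (G.dist q) {v | active v = true}
      [⟨q, none, 0⟩] [] :=
    ⟨by simp [hq, treePred], by simp, by simp, trivial, by simp⟩
  obtain ⟨hresult, hmem⟩ := hinitial.search hA (isLabelling_treePred hG) (m := m)
    (by simpa using hm)
  refine ⟨hresult, fun v => ?_⟩
  induction v using parent_induction hG (r := q) with
  | root => exact fun _ => hmem ⟨q, none, 0⟩ (by simp)
  | step v hv ih =>
    intro hactive
    refine hresult.closed _ (ih (hparent v hactive)) v (adj_parent hG hv).symm hactive fun h => ?_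
    obtain ⟨hne, hback⟩ := treePred_eq_some_iff.1 h
    have := dist_parent hG hv
    have := dist_parent hG hne
    rw [hback] at this
    omega

theorem traceBack_eq_iterate_parent (hG : G.IsTree) {D : Set V} {l : List (Visit V)}
    (hl : IsSearchState G active (treePred G q) (G.dist q) D [] l) {v : V}
    (hv : v ∈ l.map Visit.vertex) :
    (traceBack (some v) l).val = List.iterate (parent G q) v (G.dist q v + 1) := by
  refine traceBack_eq_iterate (pr := treePred G q) (fun v h => ?_) (fun v u h => ?_)
    (fun e he => (hl.label e he).2.1) hl.predBelow hv
  · rw [treePred, ite_eq_left_iff] at h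
    rw [show v = q from by_contra fun hvq => by simp [hvq] at h, SimpleGraph.dist_self]
  · obtain ⟨hvq, rfl⟩ := treePred_eq_some_iff.1 h
    exact ⟨rfl, (dist_parent hG hvq).symm⟩

end Search

/-! ## The preparation -/

section Prepare

variable {V : Type} {G : SimpleGraph V} {r g : V}

/-- The number of steps from `v` towards the root `r` until the path to `g` is met. -/
noncomputable def pathDist (G : SimpleGraph V) (r g v : V) : ℕ :=
  sInf {m | IsAnc G r ((parent G r)^[m] v) g}

theorem pathDist_eq_zero {v : V} (h : IsAnc G r v g) : pathDist G r g v = 0 :=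
  Nat.sInf_eq_zero.2 (Or.inl h)

theorem isAnc_iterate_pathDist (hG : G.IsTree) (v : V) :
    IsAnc G r ((parent G r)^[pathDist G r g v] v) g := by
  obtain ⟨m, hm⟩ := IsAnc.root (r := r) hG v
  exact Nat.sInf_mem (s := {m | IsAnc G r ((parent G r)^[m] v) g})
    ⟨m, show IsAnc G r ((parent G r)^[m] v) g from hm.symm ▸ IsAnc.root hG g⟩

theorem pathDist_eq_succ (hG : G.IsTree) {v : V} (h : ¬ IsAnc G r v g) :
    pathDist G r g v = pathDist G r g (parent G r v) + 1 := by
  refine le_antisymm (Nat.sInf_le (isAnc_iterate_pathDist hG (parent G r v))) ?_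
  have hanc := isAnc_iterate_pathDist (r := r) (g := g) hG v
  cases hm : pathDist G r g v with
  | zero =>
    rw [hm] at hanc
    exact absurd hanc h
  | succ m =>
    rw [hm] at hanc
    exact Nat.succ_le_succ (Nat.sInf_le hanc)

/-- The data `S` describe a longest path of the tree `G`, and the distances to it. -/
structure IsPrep (G : SimpleGraph V) (S : Prep V) : Prop where
  onPath : ∀ v, S.onPath v = true ↔ IsAnc G S.start v S.goal
  dist_on : ∀ v, IsAnc G S.start v S.goal → S.distP v = 0
  dist_off : ∀ v, ¬ IsAnc G S.start v S.goal → S.distP v = S.distP (parent G S.start v) + 1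
  diam : ∀ x y, G.dist x y ≤ G.dist S.start S.goal

theorem IsLongestPath.exists_isPrep (hG : G.IsTree) {a b : V} {P : G.Walk a b}
    (hP : IsLongestPath G P) : ∃ S : Prep V, IsPrep G S ∧ S.start = a ∧ S.goal = b := by
  classical
  exact ⟨⟨a, b, fun v => decide (IsAnc G a v b), pathDist G a b⟩,
    ⟨fun v => decide_eq_true_iff, fun v => pathDist_eq_zero, fun v => pathDist_eq_succ hG,
      hP.dist_le hG⟩, rfl, rfl⟩

theorem dist_le_of_farthest (hG : G.IsTree) {q a b : V} (ha : ∀ v, G.dist q v ≤ G.dist q a)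
    (hb : ∀ v, G.dist a v ≤ G.dist a b) (x y : V) : G.dist x y ≤ G.dist a b := by
  have := ha x
  have := ha y
  have := hb x
  have := hb y
  rcases le_max_iff.1 (dist_four_point hG q a x y) with h | h <;> omega

theorem AdjLists.Represents.length_verts [Fintype V] {A : AdjLists V} (hA : A.Represents G) :
    A.verts.length = Fintype.card V := by
  classical
  rw [← List.toFinset_card_of_nodup hA.verts_nodup, ← Finset.card_univ]
  congr 1
  ext v
  simp [hA.mem_verts v]

theorem AdjLists.Represents.ncard_le_length_verts {A : AdjLists V} (hA : A.Represents G)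
    (D : Set V) : D.ncard ≤ A.verts.length := by
  classical
  rw [← List.toFinset_card_of_nodup hA.verts_nodup, ← Set.ncard_coe_finset]
  exact Set.ncard_le_ncard (fun v _ => by simp [hA.mem_verts v]) (Set.toFinite _)

open Classical in
/-- The predecessor of `v` in a search that starts simultaneously from all vertices of the path from
`r` to `g`. -/
noncomputable def pathPred (G : SimpleGraph V) (r g v : V) : Option V :=
  if IsAnc G r v g then none else some (parent G r v)

theorem isLabelling_pathPred (hG : G.IsTree) {active : V → Bool}
    (hactive : ∀ v, active v = true → ¬ IsAnc G r v g) :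
    IsLabelling G active (pathPred G r g) (pathDist G r g) Set.univ := by
  intro x w _ hxw hw hpred
  have hwg := hactive w hw
  rcases parent_eq_or_parent_eq_of_adj (r := r) hG hxw with ⟨-, hx⟩ | ⟨-, rfl⟩
  · have hxg : ¬ IsAnc G r x g := fun h => hwg ((hx ▸ IsAnc.parent_left x : IsAnc G r w x).trans h)
    exact absurd (by rw [pathPred, if_neg hxg, hx]) hpred
  · exact ⟨trivial, if_neg hwg, pathDist_eq_succ hG hwg⟩

variable [DecidableEq V] {A : AdjLists V}

/-- The visits of a search of the whole graph from `q`, in reverse order. -/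
def searchFrom (A : AdjLists V) (q : V) : List (Visit V) :=
  (search A (fun _ => true) A.verts.length [⟨q, none, 0⟩] []).val

/-- The vertex farthest from `q` that is found by a search of the whole graph. -/
def farthest (A : AdjLists V) (q : V) : V :=
  (argMaxT Visit.depth ⟨q, none, 0⟩ (searchFrom A q)).val.vertex

/-- The path from `q` to `farthest A q`, as a list that starts at its far end. -/
def farthestPath (A : AdjLists V) (q : V) : List V :=
  (traceBack (some (farthest A q)) (searchFrom A q)).val

theorem isSearchState_searchFrom [Finite V] (hG : G.IsTree) (hA : A.Represents G) (q : V) :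
    IsSearchState G (fun _ => true) (treePred G q) (G.dist q) {_v | true = true} []
      (searchFrom A q) ∧ ∀ v, v ∈ (searchFrom A q).map Visit.vertex := by
  obtain ⟨hsearch, hmem⟩ := isSearchState_search_of_forall_active_parent hG hA (q := q)
    (active := fun _ => true) rfl (fun _ _ => rfl) (hA.ncard_le_length_verts _)
  exact ⟨hsearch, fun v => hmem v rfl⟩

theorem dist_le_dist_farthest [Finite V] (hG : G.IsTree) (hA : A.Represents G) (q v : V) :
    G.dist q v ≤ G.dist q (farthest A q) := by
  obtain ⟨hsearch, hmem⟩ := isSearchState_searchFrom hG hA q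
  obtain ⟨hmax, hle⟩ := argMaxT_mem_and_le Visit.depth ⟨q, none, 0⟩ (searchFrom A q)
  have hdepth : ∀ e ∈ (⟨q, none, 0⟩ :: searchFrom A q : List (Visit V)),
      e.depth = G.dist q e.vertex := by
    intro e he
    rcases List.mem_cons.1 he with rfl | he
    · exact SimpleGraph.dist_self.symm
    · exact (hsearch.label e he).2.2
  obtain ⟨e, he, rfl⟩ := List.mem_map.1 (hmem v)
  rw [farthest, ← hdepth _ hmax, ← hdepth e (List.mem_cons_of_mem _ he)]
  exact hle e (List.mem_cons_of_mem _ he)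

theorem nodup_farthestPath [Finite V] (hG : G.IsTree) (hA : A.Represents G) (q : V) :
    (farthestPath A q).Nodup := by
  obtain ⟨hsearch, hmem⟩ := isSearchState_searchFrom hG hA q
  rw [farthestPath, traceBack_eq_iterate_parent hG hsearch (hmem _)]
  exact nodup_iterate_parent hG

theorem mem_farthestPath_iff [Finite V] (hG : G.IsTree) (hA : A.Represents G) {q v : V} :
    v ∈ farthestPath A q ↔ IsAnc G (farthest A q) v q := by
  obtain ⟨hsearch, hmem⟩ := isSearchState_searchFrom hG hA q
  rw [farthestPath, traceBack_eq_iterate_parent hG hsearch (hmem _), mem_iterate_parent hG,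
    isAnc_comm hG]

theorem storeT_true_eq_true_iff {p : List V} {v : V} :
    (storeT id (fun _ => true) p fun _ => false).val v = true ↔ v ∈ p := by
  rw [storeT_val id _ (fun _ => true) p fun _ _ => rfl, List.map_id]
  split_ifs with h <;> simp [h]

theorem isSearchState_search_path [Finite V] (hG : G.IsTree) (hA : A.Represents G)
    {active : V → Bool} (hactive : ∀ v, active v = true ↔ ¬ IsAnc G r v g) {p : List V}
    (hp : p.Nodup) (hmem : ∀ v, v ∈ p ↔ IsAnc G r v g) {l : List (Visit V)}
    (hl : l = (search A active A.verts.length (p.map fun v => ⟨v, none, 0⟩) []).val) :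
    IsSearchState G active (pathPred G r g) (pathDist G r g) Set.univ [] l ∧
      ∀ v, v ∈ l.map Visit.vertex := by
  subst hl
  have hinitial : IsSearchState G active (pathPred G r g) (pathDist G r g) Set.univ
      (p.map fun v => ⟨v, none, 0⟩) [] := by
    refine ⟨?_, by simpa [Function.comp_def] using hp, by simp, trivial, by simp⟩
    intro e he
    rw [List.append_nil] at he
    obtain ⟨v, hv, rfl⟩ := List.mem_map.1 he
    have hvg := (hmem v).1 hv
    exact ⟨trivial, (if_pos hvg).symm, (pathDist_eq_zero hvg).symm⟩
  obtain ⟨hsearch, hstart⟩ := hinitial.search hA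
    (isLabelling_pathPred hG fun v => (hactive v).1) (m := A.verts.length)
    (hA.ncard_le_length_verts _)
  refine ⟨hsearch, fun v => ?_⟩
  by_cases hv : IsAnc G r v g
  · exact hstart ⟨v, none, 0⟩ (by simpa using (hmem v).2 hv)
  induction v using parent_induction hG (r := r) with
  | root => exact absurd (IsAnc.root hG g) hv
  | step v hvr ih =>
    have hparent : parent G r v ∈ (search A active A.verts.length
        (p.map fun v => ⟨v, none, 0⟩) []).val.map Visit.vertex := by
      by_cases hpv : IsAnc G r (parent G r v) g
      · exact hstart ⟨parent G r v, none, 0⟩ (by simpa using (hmem _).2 hpv)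
      · exact ih hpv
    refine hsearch.closed _ hparent v (adj_parent hG hvr).symm ((hactive v).2 hv) fun h => ?_
    rw [pathPred] at h
    split_ifs at h with hpv
    have hback := Option.some.inj h
    have hpr : parent G r v ≠ r := fun h => hpv (h.symm ▸ IsAnc.root hG g)
    have := dist_parent hG hvr
    have := dist_parent hG hpr
    rw [hback] at this
    omega

theorem isPrep_prepare [Finite V] (hG : G.IsTree) (hA : A.Represents G) (root : V) :
    IsPrep G (prepare A root).val := by
  set a := farthest A root
  set b := farthest A a
  set onPath := (storeT id (fun _ => true) (farthestPath A a) fun _ => false).val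
  set l := (search A (fun v => !onPath v) A.verts.length
    ((farthestPath A a).map fun v => ⟨v, none, 0⟩) []).val with hl
  have hval : (prepare A root).val =
    ⟨b, a, onPath, (storeT Visit.vertex Visit.depth l fun _ => 0).val⟩ := rfl
  have hmem (v : V) : v ∈ farthestPath A a ↔ IsAnc G b v a := mem_farthestPath_iff hG hA
  have hon (v : V) : onPath v = true ↔ IsAnc G b v a := storeT_true_eq_true_iff.trans (hmem v)
  obtain ⟨hsearch, hall⟩ := isSearchState_search_path hG hA
    (active := fun v => !onPath v) (fun v => by simp [← hon]) (nodup_farthestPath hG hA a) hmem hl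
  have hdistP : (storeT Visit.vertex Visit.depth l fun _ => 0).val = pathDist G b a := by
    funext v
    rw [storeT_val Visit.vertex Visit.depth (pathDist G b a) l
      fun e he => (hsearch.label e he).2.2, if_pos (hall v)]
  rw [hval, hdistP]
  refine ⟨hon, fun v => pathDist_eq_zero, fun v => pathDist_eq_succ hG, fun x y => ?_⟩
  rw [G.dist_comm (u := b)]
  exact dist_le_of_farthest hG (dist_le_dist_farthest hG hA root) (dist_le_dist_farthest hG hA a)
    x y

theorem argMaxT_search_cost_le {d : ℕ} (hd : ∀ v, (A.nbrs v).length ≤ d) (q : V) :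
    (search A (fun _ => true) A.verts.length [⟨q, none, 0⟩] []).cost +
      (argMaxT Visit.depth ⟨q, none, 0⟩ (searchFrom A q)).cost ≤
        A.verts.length * (d + 2) + A.verts.length + 2 := by
  have := search_cost_le A (fun _ => true) hd A.verts.length [⟨q, none, 0⟩] []
  have := search_length_le A (fun _ => true) A.verts.length [⟨q, none, 0⟩] []
  rw [argMaxT_cost, searchFrom]
  rw [List.length_nil] at this
  omega

theorem prepare_cost_le {d : ℕ} (hd : ∀ v, (A.nbrs v).length ≤ d) (root : V) :
    (prepare A root).cost ≤ 3 * (A.verts.length * (d + 2) + 1) + 8 * (A.verts.length + 1) := by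
  set a := farthest A root
  set p := farthestPath A a
  set onPath := storeT id (fun _ => true) p fun _ => false with honPath
  set third := search A (fun v => !onPath.val v) A.verts.length
    (p.map fun v => ⟨v, none, 0⟩) []
  have hcost : (prepare A root).cost =
      (search A (fun _ => true) A.verts.length [⟨root, none, 0⟩] []).cost +
      ((argMaxT Visit.depth ⟨root, none, 0⟩ (searchFrom A root)).cost +
      ((search A (fun _ => true) A.verts.length [⟨a, none, 0⟩] []).cost +
      ((argMaxT Visit.depth ⟨a, none, 0⟩ (searchFrom A a)).cost +
      ((traceBack (some (farthest A a)) (searchFrom A a)).cost +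
      ((A.verts.length + 1 + 0) + (onPath.cost + (p.length + (third.cost +
      ((A.verts.length + 1 + 0) +
      ((storeT Visit.vertex Visit.depth third.val fun _ => 0).cost + 0)))))))))) := rfl
  have hfirst := argMaxT_search_cost_le hd root
  have hsecond := argMaxT_search_cost_le hd a
  have hvisits : (searchFrom A a).length ≤ A.verts.length :=
    search_length_le A (fun _ => true) _ _ []
  have htrace := traceBack_cost_le (some (farthest A a)) (searchFrom A a)
  have hpath : p.length ≤ _ := traceBack_length_le (some (farthest A a)) (searchFrom A a)
  have hthird_cost : third.cost ≤ _ := search_cost_le A _ hd _ _ []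
  have hthird_length : third.val.length ≤ A.verts.length := search_length_le A _ _ _ []
  rw [hcost, honPath, storeT_cost, storeT_cost]
  omega

end Prepare

namespace WhileRun

variable {σ : Type} {guard : σ → Bool} {body : σ → Timed σ}

theorem exists_of_measure (Inv : σ → Prop) (μ : σ → ℕ)
    (hstep : ∀ s, Inv s → guard s = true → Inv (body s).val ∧ μ (body s).val < μ s) (s : σ)
    (hs : Inv s) : ∃ s' t, WhileRun guard body s s' t := by
  induction hn : μ s using Nat.strong_induction_on generalizing s with
  | _ n ih =>
    cases hguard : guard s with
    | false => exact ⟨s, 1, exit hguard⟩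
    | true =>
      obtain ⟨hinv, hlt⟩ := hstep s hs hguard
      obtain ⟨s', t, hrun⟩ := ih _ (by omega) _ hinv rfl
      exact ⟨s', _, iter hguard hrun⟩

theorem inv_and_time_le (Inv : σ → Prop) (μ : σ → ℕ) (c : ℕ)
    (hstep : ∀ s, Inv s → guard s = true → Inv (body s).val ∧ μ (body s).val < μ s)
    (hcost : ∀ s, (body s).cost ≤ c) {s s' : σ} {t : ℕ} (h : WhileRun guard body s s' t)
    (hs : Inv s) : Inv s' ∧ guard s' = false ∧ t ≤ μ s * (c + 1) + 1 := by
  induction h with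
  | exit hguard => exact ⟨hs, hguard, by omega⟩
  | @iter s s' t hguard _ ih =>
    obtain ⟨hinv, hlt⟩ := hstep s hs hguard
    obtain ⟨hinv', hguard', htime⟩ := ih hinv
    refine ⟨hinv', hguard', ?_⟩
    have hbody := hcost s
    have hmul : (μ (body s).val + 1) * (c + 1) ≤ μ s * (c + 1) := Nat.mul_le_mul_right _ hlt
    rw [Nat.succ_mul] at hmul
    omega

end WhileRun

/-! ## The order of exploration -/

section Explore

variable {V : Type} {G : SimpleGraph V} {S : Prep V}

theorem nextUnexplored_eq_some {explored : V → Bool} {nbrs : List V} {w : V}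
    (h : (nextUnexplored S explored nbrs).val = some w) :
    w ∈ nbrs ∧ explored w = false ∧
      (S.onPath w = true → ∀ w' ∈ nbrs, explored w' = false → S.onPath w' = true) := by
  rw [nextUnexplored, val_bind, findT_val] at h
  cases hoff : nbrs.find? fun w => !explored w && !S.onPath w with
  | some x =>
    rw [hoff] at h
    obtain rfl : x = w := Option.some.inj h
    have hfound := List.find?_some hoff
    simp only [Bool.and_eq_true, Bool.not_eq_true'] at hfound
    exact ⟨List.mem_of_find?_eq_some hoff, hfound.1, fun hon => by simp [hfound.2] at hon⟩
  | none =>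
    rw [hoff] at h
    change (findT _ _).val = some w at h
    rw [findT_val] at h
    rw [List.find?_eq_none] at hoff
    exact ⟨List.mem_of_find?_eq_some h, by simpa using List.find?_some h,
      fun _ w' hw' he => by simpa [he] using hoff w' hw'⟩

theorem explored_of_nextUnexplored_eq_none {explored : V → Bool} {nbrs : List V}
    (h : (nextUnexplored S explored nbrs).val = none) {w : V} (hw : w ∈ nbrs) :
    explored w = true := by
  rw [nextUnexplored, val_bind, findT_val] at h
  cases hoff : nbrs.find? fun w => !explored w && !S.onPath w with
  | some x =>
    rw [hoff] at h
    exact absurd h (Option.some_ne_none x)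
  | none =>
    rw [hoff] at h
    change (findT _ _).val = none at h
    rw [findT_val, List.find?_eq_none] at h
    simpa using h w hw

theorem nextUnexplored_cost_le (explored : V → Bool) (nbrs : List V) :
    (nextUnexplored S explored nbrs).cost ≤ 2 * (nbrs.length + 1) := by
  rw [nextUnexplored, cost_bind]
  have := findT_cost_le (fun w => !explored w && !S.onPath w) nbrs
  have := findT_cost_le (fun w => !explored w) nbrs
  cases (findT (fun w => !explored w && !S.onPath w) nbrs).val with
  | some x => simp only [cost_pure]; omega
  | none => simp only; omega

theorem update_eq_true_iff [DecidableEq V] {explored : V → Bool} {w v : V} :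
    Function.update explored w true v = true ↔ v = w ∨ explored v = true := by
  by_cases hvw : v = w <;> simp [hvw]

theorem update_eq_false_iff [DecidableEq V] {explored : V → Bool} {w v : V} :
    Function.update explored w true v = false ↔ v ≠ w ∧ explored v = false := by
  by_cases hvw : v = w <;> simp [hvw]

/-- The exploration proceeds as a depth-first search from the start of the selected path, which
leaves the path whenever it can; `cur` is the vertex that the search has reached. -/
structure IsExploration (G : SimpleGraph V) (S : Prep V) (explored : V → Bool)
    (par : V → Option V) (stamp : V → ℕ) (clock : ℕ) (cur : V) : Prop where
  cur_mem : explored cur = true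
  parent_mem : ∀ v, explored v = true → explored (parent G S.start v) = true
  par_eq : ∀ v, explored v = true → v ≠ S.start → par v = some (parent G S.start v)
  open_isAnc : ∀ v w, explored v = true → G.Adj v w → explored w = false → IsAnc G S.start v cur
  stamp_lt : ∀ v, explored v = true → stamp v < clock
  stamp_mono : ∀ a y c, explored a = true → explored y = true → IsAnc G S.start c cur →
    IsAnc G S.start c y → ¬ IsAnc G S.start c a → stamp a < stamp y
  path_closed : ∀ y, IsAnc G S.start y S.goal → explored y = true → y ≠ S.start →
    ∀ w, G.Adj (parent G S.start y) w → explored w = true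
  goal_eq : explored S.goal = true → cur = S.goal

namespace IsExploration

variable {explored : V → Bool} {par : V → Option V} {stamp : V → ℕ} {clock : ℕ} {cur : V}

theorem mem_of_isAnc (h : IsExploration G S explored par stamp clock cur) {a b : V}
    (hb : explored b = true) (hab : IsAnc G S.start a b) : explored a = true := by
  obtain ⟨m, rfl⟩ := hab
  induction m with
  | zero => exact hb
  | succ m ih =>
    rw [Function.iterate_succ_apply']
    exact h.parent_mem _ ih

theorem start_mem (hG : G.IsTree) (h : IsExploration G S explored par stamp clock cur) :
    explored S.start = true :=
  h.mem_of_isAnc h.cur_mem (IsAnc.root hG cur)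

theorem mem_of_forall_adj_mem (hG : G.IsTree) (h : IsExploration G S explored par stamp clock cur)
    (hclosed : ∀ v w, explored v = true → G.Adj v w → explored w = true) (v : V) :
    explored v = true := by
  induction v using parent_induction hG (r := S.start) with
  | root => exact h.start_mem hG
  | step v hv ih => exact hclosed _ v ih (adj_parent hG hv).symm

theorem ne_start_and_parent_eq (hG : G.IsTree) (h : IsExploration G S explored par stamp clock cur)
    {u w : V} (hu : explored u = true) (huw : G.Adj u w) (hw : explored w = false) :
    w ≠ S.start ∧ parent G S.start w = u := by
  rcases parent_eq_or_parent_eq_of_adj (r := S.start) hG huw with ⟨-, rfl⟩ | hchild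
  · simp [h.parent_mem _ hu] at hw
  · exact hchild

theorem mem_of_goal_mem (hG : G.IsTree) (hS : IsPrep G S)
    (h : IsExploration G S explored par stamp clock cur) (hg : explored S.goal = true) (v : V) :
    explored v = true := by
  refine h.mem_of_forall_adj_mem hG (fun u w hu huw => ?_) v
  by_contra hw
  rw [Bool.not_eq_true] at hw
  have hanc := h.open_isAnc u w hu huw hw
  rw [h.goal_eq hg] at hanc
  by_cases hug : u = S.goal
  · obtain ⟨hwr, hparent⟩ := h.ne_start_and_parent_eq hG hu huw hw
    have := dist_parent hG hwr
    have := hS.diam S.start w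
    rw [hparent, hug] at *
    omega
  · obtain ⟨y, hy, rfl, hyg⟩ := hanc.exists_child hG hug
    simp [h.path_closed y hyg (h.mem_of_isAnc hg hyg) hy w huw] at hw

theorem exists_last_on_path [Finite V] (hG : G.IsTree)
    (h : IsExploration G S explored par stamp clock cur) (hg : explored S.goal = false) :
    ∃ x w, IsAnc G S.start x S.goal ∧ explored x = true ∧ IsAnc G S.start x cur ∧
      (∀ y, IsAnc G S.start y S.goal → explored y = true → IsAnc G S.start y x) ∧
      G.Adj x w ∧ explored w = false := by
  obtain ⟨x, ⟨hx, hxe⟩, hmax⟩ := Set.exists_max_image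
    {x | IsAnc G S.start x S.goal ∧ explored x = true} (G.dist S.start) (Set.toFinite _)
    ⟨S.start, IsAnc.root hG _, h.start_mem hG⟩
  have hxg : x ≠ S.goal := fun hxg => by simp [hxg, hg] at hxe
  obtain ⟨w, hw, hwx, hwg⟩ := hx.exists_child hG hxg
  have hadj : G.Adj x w := hwx ▸ (adj_parent hG hw).symm
  have hwe : explored w = false := by
    by_contra hwe
    have := hmax w ⟨hwg, Bool.not_eq_false _ ▸ hwe⟩
    have := dist_parent hG hw
    rw [hwx] at this
    omega
  exact ⟨x, w, hx, hxe, h.open_isAnc x w hxe hadj hwe,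
    fun y hy hye => hy.of_dist_le hG hx (hmax y ⟨hy, hye⟩), hadj, hwe⟩

theorem eq_of_adj_of_isAnc_goal (hG : G.IsTree) (hS : IsPrep G S)
    (h : IsExploration G S explored par stamp clock cur) {u w x : V} (hu : explored u = true)
    (huw : G.Adj u w) (hw : explored w = false) (hwg : IsAnc G S.start w S.goal)
    (hpref : S.onPath w = true → ∀ x, G.Adj u x → explored x = false → S.onPath x = true)
    (hux : G.Adj u x) (hx : explored x = false) : x = w := by
  have hxg := (hS.onPath x).1 (hpref ((hS.onPath w).2 hwg) x hux hx)
  obtain ⟨hxr, hxu⟩ := h.ne_start_and_parent_eq hG hu hux hx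
  obtain ⟨hwr, hwu⟩ := h.ne_start_and_parent_eq hG hu huw hw
  have hdx := dist_parent hG hxr
  have hdw := dist_parent hG hwr
  rw [hxu] at hdx
  rw [hwu] at hdw
  exact hxg.eq_of_dist_eq hG hwg (by omega)

theorem update_stamp_lt_update_stamp [DecidableEq V] (hG : G.IsTree)
    (h : IsExploration G S explored par stamp clock cur) {u w : V} (hu : explored u = true)
    (huc : IsAnc G S.start u cur) (huw : G.Adj u w) (hw : explored w = false) {a y c : V}
    (ha : Function.update explored w true a = true)
    (hy : Function.update explored w true y = true) (hcw : IsAnc G S.start c w)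
    (hcy : IsAnc G S.start c y) (hca : ¬ IsAnc G S.start c a) :
    Function.update stamp w clock a < Function.update stamp w clock y := by
  have hne {v : V} (hv : explored v = true) : v ≠ w := fun hvw => by simp [hvw, hw] at hv
  have haw : a ≠ w := fun haw => hca (haw ▸ hcw)
  have hae := (update_eq_true_iff.1 ha).resolve_left haw
  rw [Function.update_of_ne haw]
  rcases update_eq_true_iff.1 hy with rfl | hye
  · rw [Function.update_self]
    exact h.stamp_lt a hae
  · rw [Function.update_of_ne (hne hye)]
    have hcu := hcw.parent_right (hne (h.mem_of_isAnc hye hcy))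
    rw [(h.ne_start_and_parent_eq hG hu huw hw).2] at hcu
    exact h.stamp_mono a y c hae hye (hcu.trans huc) hcy hca

theorem explore [DecidableEq V] (hG : G.IsTree) (hS : IsPrep G S)
    (h : IsExploration G S explored par stamp clock cur) {u w : V} {clock' : ℕ}
    (hu : explored u = true) (huc : IsAnc G S.start u cur)
    (hopen : ∀ v x, explored v = true → G.Adj v x → explored x = false → IsAnc G S.start v u)
    (huw : G.Adj u w) (hw : explored w = false)
    (hpref : S.onPath w = true → ∀ x, G.Adj u x → explored x = false → S.onPath x = true)
    (hclock : clock < clock') :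
    IsExploration G S (Function.update explored w true) (Function.update par w (some u))
      (Function.update stamp w clock) clock' w := by
  obtain ⟨-, hwu⟩ := h.ne_start_and_parent_eq hG hu huw hw
  have hg : explored S.goal = false := by
    by_contra hg
    simp [h.mem_of_goal_mem hG hS (Bool.not_eq_false _ ▸ hg) w] at hw
  have hne {v : V} (hv : explored v = true) : v ≠ w := fun hvw => by simp [hvw, hw] at hv
  constructor
  case cur_mem => exact update_eq_true_iff.2 (Or.inl rfl)
  case parent_mem =>
    intro v hv
    rcases update_eq_true_iff.1 hv with rfl | hv
    · exact update_eq_true_iff.2 (Or.inr (hwu ▸ hu))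
    · exact update_eq_true_iff.2 (Or.inr (h.parent_mem v hv))
  case par_eq =>
    intro v hv hvr
    rcases update_eq_true_iff.1 hv with rfl | hv
    · rw [Function.update_self, hwu]
    · rw [Function.update_of_ne (hne hv)]
      exact h.par_eq v hv hvr
  case open_isAnc =>
    intro v x hv hvx hx
    rcases update_eq_true_iff.1 hv with rfl | hv
    · exact IsAnc.refl v
    · exact (hopen v x hv hvx (update_eq_false_iff.1 hx).2).trans (hwu ▸ IsAnc.parent_left w)
  case stamp_lt =>
    intro v hv
    rcases update_eq_true_iff.1 hv with rfl | hv
    · rwa [Function.update_self]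
    · rw [Function.update_of_ne (hne hv)]
      exact (h.stamp_lt v hv).trans hclock
  case stamp_mono =>
    exact fun a y c ha hy => h.update_stamp_lt_update_stamp hG hu huc huw hw ha hy
  case path_closed =>
    intro y hyg hy hyr x hyx
    rcases update_eq_true_iff.1 hy with rfl | hy
    · by_contra hx
      obtain ⟨hxw, hx⟩ := update_eq_false_iff.1 (Bool.not_eq_true _ ▸ hx)
      exact hxw (h.eq_of_adj_of_isAnc_goal hG hS hu huw hw hyg hpref (hwu ▸ hyx) hx)
    · exact update_eq_true_iff.2 (Or.inr (h.path_closed y hyg hy hyr x hyx))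
  case goal_eq => exact fun hg' => ((update_eq_true_iff.1 hg').resolve_right (by simp [hg])).symm

theorem retreat (h : IsExploration G S explored par stamp clock cur) {u : V} {clock' : ℕ}
    (hu : IsAnc G S.start u cur) (hg : explored S.goal = false)
    (hopen : ∀ v x, explored v = true → G.Adj v x → explored x = false → IsAnc G S.start v u)
    (hclock : clock ≤ clock') : IsExploration G S explored par stamp clock' u where
  cur_mem := h.mem_of_isAnc h.cur_mem hu
  parent_mem := h.parent_mem
  par_eq := h.par_eq
  open_isAnc := hopen
  stamp_lt v hv := (h.stamp_lt v hv).trans_le hclock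
  stamp_mono a y c ha hy hc := h.stamp_mono a y c ha hy (hc.trans hu)
  path_closed := h.path_closed
  goal_eq hg' := by simp [hg'] at hg

end IsExploration

end Explore

/-! ## The deployment -/

section Deployment

variable {V : Type} {G : SimpleGraph V} {S : Prep V} {k : ℕ}

/-- Agent `i < k` stands on `pos i`, and `occ` tells which agent stands on a vertex. -/
def IsPlacement (k : ℕ) (pos : ℕ → V) (occ : V → Option ℕ) : Prop :=
  ∀ v i, occ v = some i ↔ i < k ∧ pos i = v

namespace IsPlacement

variable {pos : ℕ → V} {occ : V → Option ℕ}

theorem isSome_iff (h : IsPlacement k pos occ) {v : V} :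
    (occ v).isSome = true ↔ ∃ i < k, pos i = v := by
  rw [Option.isSome_iff_exists]
  exact exists_congr fun i => h v i

theorem isSome_pos (h : IsPlacement k pos occ) {i : ℕ} (hi : i < k) :
    (occ (pos i)).isSome = true := h.isSome_iff.2 ⟨i, hi, rfl⟩

theorem pos_injOn (h : IsPlacement k pos occ) : Set.InjOn pos (Set.Iio k) := by
  intro i hi j hj hij
  have hocc := (h (pos j) i).2 ⟨hi, hij⟩
  rw [(h (pos j) j).2 ⟨hj, rfl⟩] at hocc
  exact (Option.some.inj hocc).symm

theorem ncard_eq (h : IsPlacement k pos occ) : {v | (occ v).isSome = true}.ncard = k := by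
  have himage : {v | (occ v).isSome = true} = pos '' Set.Iio k := by
    ext v
    rw [Set.mem_ofPred_eq, h.isSome_iff]
    rfl
  rw [himage, h.pos_injOn.ncard_image, ← Finset.coe_range, Set.ncard_coe_finset, Finset.card_range]

theorem update_succ [DecidableEq V] (h : IsPlacement k pos occ) {w : V} (hw : occ w = none) :
    IsPlacement (k + 1) (Function.update pos k w) (Function.update occ w (some k)) := by
  intro v i
  have hold : i ≠ k → (Function.update pos k w i = v ↔ pos i = v) := fun hik => by
    rw [Function.update_of_ne hik]
  by_cases hv : v = w
  · subst hv
    rw [Function.update_self, Option.some.injEq]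
    refine ⟨fun hki => hki ▸ ⟨Nat.lt_succ_self _, Function.update_self ..⟩, fun ⟨_, hp⟩ => ?_⟩
    by_contra hik
    have hocc := (h v i).2 ⟨by omega, (hold (Ne.symm hik)).1 hp⟩
    exact absurd (hw.symm.trans hocc) (Option.some_ne_none i).symm
  · rw [Function.update_of_ne hv, h v i]
    refine ⟨fun ⟨_, hp⟩ => ⟨by omega, (hold (by omega)).2 hp⟩, fun ⟨_, hp⟩ => ?_⟩
    have hik : i ≠ k := fun hik => hv (by rw [← hp, hik, Function.update_self])
    exact ⟨by omega, (hold hik).1 hp⟩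

end IsPlacement

theorem IsExploration.start [DecidableEq V] (G : SimpleGraph V) (S : Prep V) :
    IsExploration G S (Function.update (fun _ => false) S.start true) (fun _ => none) (fun _ => 0) 1
      S.start := by
  have hmem {v : V} (hv : Function.update (fun _ => false) S.start true v = true) : v = S.start :=
    (update_eq_true_iff.1 hv).resolve_right (by simp)
  have hstart := Function.update_self S.start true fun _ => false
  exact
    { cur_mem := hstart
      parent_mem v hv := by rw [hmem hv, parent_root, hstart]
      par_eq v hv hvr := absurd (hmem hv) hvr
      open_isAnc v _ hv _ _ := hmem hv ▸ IsAnc.refl v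
      stamp_lt _ _ := Nat.one_pos
      stamp_mono a _ c ha _ hc _ hca := absurd (hmem ha ▸ hc) hca
      path_closed y _ hy hyr := absurd (hmem hy) hyr
      goal_eq hg := (hmem hg).symm }

/-- The invariant of the deployment: the agents stand on the explored vertices, and the agent that
is placed last stands on a vertex with no explored vertex below it. -/
structure IsDeployState (G : SimpleGraph V) (S : Prep V) (k : ℕ) (d : Deploy V) : Prop where
  exploration : IsExploration G S d.explored d.parent d.stamp d.count d.cur
  one_le : 1 ≤ d.count
  le : d.count ≤ k
  placement : IsPlacement d.count d.pos d.occ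
  explored_eq : ∀ v, d.explored v = (d.occ v).isSome
  first : d.pos 0 = S.start
  last : d.count = k → d.cur = d.pos (k - 1) ∧
    ∀ x, d.explored x = true → IsAnc G S.start d.cur x → x = d.cur

/-- The state of the deployment after the unexplored vertex `w` is entered. -/
def Deploy.enter [DecidableEq V] (d : Deploy V) (w : V) : Deploy V where
  cur := w
  explored := Function.update d.explored w true
  parent := Function.update d.parent w (some d.cur)
  stamp := Function.update d.stamp w d.count
  count := d.count + 1
  pos := Function.update d.pos d.count w
  occ := Function.update d.occ w (some d.count)

namespace IsDeployState

variable {d : Deploy V}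

theorem card_le [Fintype V] (h : IsDeployState G S k d) (hall : ∀ v, d.explored v = true) :
    Fintype.card V ≤ d.count := by
  have hoccupied : {v | (d.occ v).isSome = true} = Set.univ := by
    ext v
    simp [← h.explored_eq, hall v]
  rw [← Nat.card_eq_fintype_card, ← Set.ncard_univ, ← hoccupied, h.placement.ncard_eq]

theorem explored_goal_eq_false [Fintype V] (hG : G.IsTree) (hS : IsPrep G S)
    (h : IsDeployState G S k d) (hd : d.count < Fintype.card V) : d.explored S.goal = false := by
  by_contra hg
  have := h.card_le (h.exploration.mem_of_goal_mem hG hS (Bool.not_eq_false _ ▸ hg))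
  omega

theorem open_isAnc_parent (h : IsDeployState G S k d)
    (hclosed : ∀ w, G.Adj d.cur w → d.explored w = true) {v x : V} (hv : d.explored v = true)
    (hvx : G.Adj v x) (hx : d.explored x = false) : IsAnc G S.start v (parent G S.start d.cur) :=
  (h.exploration.open_isAnc v x hv hvx hx).parent_right fun hvd => by
    simp [hclosed x (hvd ▸ hvx)] at hx

theorem cur_ne_start (hG : G.IsTree) (h : IsDeployState G S k d)
    (hclosed : ∀ w, G.Adj d.cur w → d.explored w = true) (hg : d.explored S.goal = false) :
    d.cur ≠ S.start := by
  intro hcur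
  have hall := h.exploration.mem_of_forall_adj_mem hG fun v w hv hvw => by
    by_contra hw
    have hanc := h.open_isAnc_parent hclosed hv hvw (Bool.not_eq_true _ ▸ hw)
    rw [hcur, parent_root] at hanc
    exact hw (hclosed w ((hcur.trans (hanc.antisymm hG (IsAnc.root hG v)).symm) ▸ hvw))
  simp [hall] at hg

variable [DecidableEq V] {A : AdjLists V}

theorem of_deployInit (G : SimpleGraph V) (S : Prep V) (A : AdjLists V) (hk : 1 ≤ k) :
    IsDeployState G S k (deployInit A k S).val where
  exploration := IsExploration.start G S
  one_le := le_rfl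
  le := hk
  placement := by
    have hempty : IsPlacement 0 (fun _ => S.start) fun _ => none := fun v i => by simp
    rw [← Function.update_eq_self 0 fun _ => S.start] at hempty
    have hplaced := hempty.update_succ (w := S.start) rfl
    rwa [Function.update_idem, Function.update_eq_self 0 fun _ => S.start] at hplaced
  explored_eq v := by
    change Function.update (fun _ => false) S.start true v =
      (Function.update (fun _ => none) S.start (some 0) v).isSome
    by_cases hv : v = S.start <;> simp [hv]
  first := rfl
  last _ := ⟨rfl, fun _ hx _ => (update_eq_true_iff.1 hx).resolve_right Bool.false_ne_true⟩

theorem enter (hG : G.IsTree) (hS : IsPrep G S) (h : IsDeployState G S k d) (hd : d.count < k)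
    {w : V} (hdw : G.Adj d.cur w) (hw : d.explored w = false)
    (hpref : S.onPath w = true → ∀ x, G.Adj d.cur x → d.explored x = false → S.onPath x = true) :
    IsDeployState G S k (d.enter w) where
  exploration := h.exploration.explore hG hS h.exploration.cur_mem (IsAnc.refl _)
    h.exploration.open_isAnc hdw hw hpref (Nat.lt_succ_self _)
  one_le := Nat.succ_pos _
  le := hd
  placement := h.placement.update_succ (by simpa [hw] using (h.explored_eq w).symm)
  explored_eq v := by
    change Function.update d.explored w true v = (Function.update d.occ w (some d.count) v).isSome
    by_cases hv : v = w <;> simp [hv, h.explored_eq v]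
  first := (Function.update_of_ne (Nat.pos_iff_ne_zero.1 h.one_le).symm _ _).trans h.first
  last hk := by
    have hpos : (d.enter w).pos d.count = w := Function.update_self ..
    refine ⟨by rw [← hk]; exact hpos.symm, fun x hx hwx => ?_⟩
    refine (update_eq_true_iff.1 hx).resolve_right fun hxe => ?_
    have hmem : d.explored w = true := h.exploration.mem_of_isAnc hxe hwx
    simp [hmem] at hw

theorem step [Fintype V] (hG : G.IsTree) (hS : IsPrep G S) (hA : A.Represents G)
    (hkn : k ≤ Fintype.card V) (h : IsDeployState G S k d) (hd : d.count < k) :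
    IsDeployState G S k (deployStep A S d).val ∧
      2 * (k - (deployStep A S d).val.count) + G.dist S.start (deployStep A S d).val.cur <
        2 * (k - d.count) + G.dist S.start d.cur := by
  have hg := h.explored_goal_eq_false hG hS (hd.trans_le hkn)
  cases hnext : (nextUnexplored S d.explored (A.nbrs d.cur)).val with
  | some w =>
    have hval : (deployStep A S d).val = d.enter w := by
      rw [deployStep, val_bind, val_bind, hnext]
      rfl
    obtain ⟨hdw, hw, hpref⟩ := nextUnexplored_eq_some hnext
    rw [hA.mem_nbrs] at hdw
    obtain ⟨hwr, hwd⟩ := h.exploration.ne_start_and_parent_eq hG h.exploration.cur_mem hdw hw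
    rw [hval]
    refine ⟨h.enter hG hS hd hdw hw fun hon x hx => hpref hon x ((hA.mem_nbrs _ _).2 hx), ?_⟩
    have hdist := dist_parent hG hwr
    rw [hwd] at hdist
    change 2 * (k - (d.count + 1)) + G.dist S.start w < _
    omega
  | none =>
    have hclosed (w : V) (hw : G.Adj d.cur w) : d.explored w = true :=
      explored_of_nextUnexplored_eq_none hnext ((hA.mem_nbrs _ _).2 hw)
    have hcur := h.cur_ne_start hG hclosed hg
    have hval : (deployStep A S d).val = { d with cur := parent G S.start d.cur } := by
      rw [deployStep, val_bind, val_bind, hnext, val_pure,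
        h.exploration.par_eq _ h.exploration.cur_mem hcur]
      rfl
    rw [hval]
    refine ⟨⟨h.exploration.retreat (IsAnc.parent_left _) hg
      (fun _ _ => h.open_isAnc_parent hclosed) le_rfl, h.one_le, h.le, h.placement,
      h.explored_eq, h.first, fun hk => absurd hk hd.ne⟩, ?_⟩
    have := dist_parent hG hcur
    change 2 * (k - d.count) + G.dist S.start (parent G S.start d.cur) < _
    omega

end IsDeployState

theorem deployStep_cost_le [DecidableEq V] {A : AdjLists V} {m : ℕ}
    (hm : ∀ v, (A.nbrs v).length ≤ m) (d : Deploy V) :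
    (deployStep A S d).cost ≤ 2 * m + 3 := by
  rw [deployStep, cost_bind, cost_tick, cost_bind]
  have := nextUnexplored_cost_le (S := S) d.explored (A.nbrs d.cur)
  have := hm d.cur
  cases (nextUnexplored S d.explored (A.nbrs d.cur)).val <;> simp only [cost_pure] <;> omega

end Deployment

/-! ## Moving the agents -/

section Follow

variable {V : Type} [DecidableEq V] {G : SimpleGraph V} {k : ℕ} {pos : ℕ → V} {occ : V → Option ℕ}

theorem followHead_cost_le (dest : V) (p : List V) (pos : ℕ → V) (occ : V → Option ℕ) :
    (followHead dest p pos occ).cost ≤ p.length + 1 := by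
  induction p generalizing dest pos occ with
  | nil => exact le_rfl
  | cons v vs ih =>
    cases vs with
    | nil => simp [followHead, cost_bind, cost_pure, cost_tick]
    | cons v' vs =>
      rw [followHead, cost_bind, cost_tick, List.length_cons]
      have := ih v (Function.update pos ((occ v).getD 0) dest)
        (Function.update (Function.update occ dest (some ((occ v).getD 0))) v none)
      dsimp only
      omega

theorem IsPlacement.move (h : IsPlacement k pos occ) {v dest : V} {i : ℕ} (hi : occ v = some i)
    (hdest : occ dest = none) :
    IsPlacement k (Function.update pos i dest)
      (Function.update (Function.update occ dest (some i)) v none) := by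
  have hvd : dest ≠ v := fun hdv => by simp [← hdv, hdest] at hi
  obtain ⟨hik, hiv⟩ := (h v i).1 hi
  intro x j
  by_cases hji : j = i
  · subst hji
    rw [Function.update_self]
    by_cases hxd : x = dest
    · simp [hxd, hvd, hik]
    · have hxj : x ≠ v → occ x ≠ some j := fun hxv hx => hxv (((h x j).1 hx).2.symm.trans hiv)
      by_cases hxv : x = v <;> simp_all [Ne.symm hxd]
  · rw [Function.update_of_ne hji, ← h x j]
    by_cases hxv : x = v
    · simp [hxv, hi, Ne.symm hji]
    · by_cases hxd : x = dest <;> simp_all [Ne.symm hji]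

theorem isSome_move_iff {v dest x : V} {i : ℕ} :
    (Function.update (Function.update occ dest (some i)) v none x).isSome = true ↔
      (x = dest ∨ (occ x).isSome = true) ∧ x ≠ v := by
  by_cases hxv : x = v
  · simp [hxv]
  · by_cases hxd : x = dest
    · simp [hxd, hxd ▸ hxv]
    · simp [hxv, hxd]

/-- The effect of a move in which the agents on the path `p`, which ends at `t`, follow each other
to `dest`: `m` consists of the new positions, the new occupation and the vertex entered from `t`. -/
structure IsFollowed (G : SimpleGraph V) (k : ℕ) (dest : V) (p : List V) (t : V) (pos : ℕ → V)
    (occ : V → Option ℕ) (m : (ℕ → V) × (V → Option ℕ) × V) : Prop where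
  placement : IsPlacement k m.1 m.2.1
  isSome_iff : ∀ v, (m.2.1 v).isSome = true ↔ (v = dest ∨ (occ v).isSome = true) ∧ v ≠ t
  eq_or_adj : ∀ i < k, pos i = m.1 i ∨ G.Adj (pos i) (m.1 i)
  eq_of_notMem : ∀ i < k, pos i ∉ p → m.1 i = pos i
  adj_tail : G.Adj t m.2.2
  tail_mem : p.length = 1 ∧ m.2.2 = dest ∨ m.2.2 ∈ p

namespace IsFollowed

variable {v dest : V} {i : ℕ}

theorem singleton (h : IsPlacement k pos occ) (hi : occ v = some i) (hdest : occ dest = none)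
    (hadj : G.Adj dest v) :
    IsFollowed G k dest [v] v pos occ (Function.update pos i dest,
      Function.update (Function.update occ dest (some i)) v none, dest) where
  placement := h.move hi hdest
  isSome_iff _ := isSome_move_iff
  eq_or_adj j _ := by
    by_cases hji : j = i
    · right
      rw [hji, ((h v i).1 hi).2]
      simpa using hadj.symm
    · exact Or.inl (Function.update_of_ne hji ..).symm
  eq_of_notMem j _ hjv := Function.update_of_ne
    (fun hji => hjv (List.mem_singleton.2 ((congrArg pos hji).trans ((h v i).1 hi).2))) ..
  adj_tail := hadj.symm
  tail_mem := Or.inl ⟨rfl, rfl⟩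

theorem cons (h : IsPlacement k pos occ) (hi : occ v = some i) (hadj : G.Adj dest v) {p : List V}
    (hdest : dest ∉ p) {t : V} (hvt : v ≠ t) {m : (ℕ → V) × (V → Option ℕ) × V}
    (hm : IsFollowed G k v p t (Function.update pos i dest)
      (Function.update (Function.update occ dest (some i)) v none) m) :
    IsFollowed G k dest (v :: p) t pos occ m where
  placement := hm.placement
  isSome_iff x := by
    rw [hm.isSome_iff, isSome_move_iff]
    by_cases hxv : x = v <;> simp [hxv, hi, hvt]
  eq_or_adj j hj := by
    by_cases hji : j = i
    · subst hji
      rw [hm.eq_of_notMem j hj (by rwa [Function.update_self]), Function.update_self,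
        ((h v j).1 hi).2]
      exact Or.inr hadj.symm
    · simpa [Function.update_of_ne hji] using hm.eq_or_adj j hj
  eq_of_notMem j hj hjv := by
    have hji : j ≠ i := by
      rintro rfl
      exact hjv (by simp [((h v j).1 hi).2])
    have hpos : Function.update pos i dest j = pos j := Function.update_of_ne hji ..
    rw [hm.eq_of_notMem j hj (hpos ▸ fun h => hjv (List.mem_cons_of_mem _ h)), hpos]
  adj_tail := hm.adj_tail
  tail_mem := by
    rcases hm.tail_mem with ⟨-, htail⟩ | htail
    · exact Or.inr (htail ▸ List.mem_cons_self)
    · exact Or.inr (List.mem_cons_of_mem _ htail)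

end IsFollowed

theorem isFollowed_followHead {p : List V} (hp : p ≠ []) {dest : V} (h : IsPlacement k pos occ)
    (hdest : occ dest = none) (hocc : ∀ v ∈ p, (occ v).isSome = true) (hnodup : p.Nodup)
    (hchain : (dest :: p).IsChain G.Adj) :
    IsFollowed G k dest p (p.getLast hp) pos occ (followHead dest p pos occ).val := by
  induction p generalizing dest pos occ with
  | nil => exact absurd rfl hp
  | cons v vs ih =>
    obtain ⟨i, hi⟩ := Option.isSome_iff_exists.1 (hocc v List.mem_cons_self)
    obtain ⟨hdv, hchain⟩ := List.isChain_cons_cons.1 hchain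
    obtain ⟨hv, hnodup⟩ := List.nodup_cons.1 hnodup
    rw [followHead, val_bind, hi]
    cases vs with
    | nil => exact IsFollowed.singleton h hi hdest hdv
    | cons v' vs =>
      have hdest_mem : dest ∉ v' :: vs := fun hd => by
        simpa [hdest] using hocc dest (List.mem_cons_of_mem _ hd)
      rw [List.getLast_cons (List.cons_ne_nil _ _)]
      refine IsFollowed.cons h hi hdv hdest_mem (fun hvt => hv (hvt ▸ List.getLast_mem _)) ?_
      exact ih _ (h.move hi hdest) (Function.update_self ..)
        (fun x hx => isSome_move_iff.2
          ⟨Or.inr (hocc x (List.mem_cons_of_mem _ hx)), fun hxv => hv (hxv ▸ hx)⟩)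
        hnodup hchain

end Follow

/-! ## The shape of the occupied set -/

section Occupied

variable {V : Type*} {G : SimpleGraph V} {r g : V} {O : Set V} {k : ℕ}

/-- `t` has exactly one neighbour in `O`, namely `u`: for `t ∈ O`, a leaf of the subgraph induced by
`O`. -/
def IsLeafAt (G : SimpleGraph V) (O : Set V) (t u : V) : Prop :=
  u ∈ O ∧ G.Adj t u ∧ ∀ x ∈ O, G.Adj t x → x = u

/-- No branch of `O` leaves the path from the tail `t` to the head `h` on the part of it that
descends to `h`. -/
def IsBareTrail (G : SimpleGraph V) (r : V) (O : Set V) (h t : V) : Prop :=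
  ∀ x ∈ O, ¬ IsAnc G r x h → ∀ c, IsAnc G r c x → IsAnc G r c h → IsAnc G r c t

/-- The initial phase, in which the tail `t` follows the path from the root `r` to `g`: all of `O`
hangs below `t`, and its branches leave the path to the head `h` near the root. -/
def IsFirstTrail (G : SimpleGraph V) (r g : V) (O : Set V) (h t : V) : Prop :=
  IsAnc G r t g ∧ (∀ x ∈ O, IsAnc G r t x) ∧ ∀ x ∈ O, ¬ IsAnc G r x h →
    ∀ c, IsAnc G r c x → IsAnc G r c h → G.dist r c + G.dist r t < G.dist r h

/-- Only deep branches off the path from the root `r` to `g` contain all of `O`. -/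
def OnlyInDeep (G : SimpleGraph V) (r g : V) (k : ℕ) (O : Set V) : Prop :=
  ∀ v, ¬ IsAnc G r v g → (∀ x ∈ O, IsAnc G r v x) → IsDeep G r k v

namespace IsLeafAt

variable {top h t u : V}

theorem of_isAnc (hG : G.IsTree) (hu : IsLeafAt G O t u) (hO : IsTop G r O top) (ht : t ∈ O)
    (hh : h ∈ O) (hth : t ≠ h) (hanc : IsAnc G r t h) :
    u ≠ r ∧ parent G r u = t ∧ IsAnc G r u h ∧ top = t := by
  obtain ⟨c, hcr, rfl, hch⟩ := hanc.exists_child hG hth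
  have hc : c ∈ O := hO.mem_of_isAnc hG hh ((hO.isAnc hG ht).trans (IsAnc.parent_left c)) hch
  obtain rfl := hu.2.2 c hc (adj_parent hG hcr).symm
  refine ⟨hcr, rfl, hch, by_contra fun htop => ?_⟩
  obtain ⟨htr, hp⟩ := hO.2 _ ht (Ne.symm htop)
  have hgrandparent := hu.2.2 _ hp (adj_parent hG htr)
  have hdist := dist_parent hG htr
  have := dist_parent hG hcr
  rw [hgrandparent] at hdist
  omega

theorem of_not_isAnc (hG : G.IsTree) (hu : IsLeafAt G O t u) (hO : IsTop G r O top) (ht : t ∈ O)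
    (hh : h ∈ O) (hanc : ¬ IsAnc G r t h) : t ≠ r ∧ u = parent G r t ∧ t ≠ top := by
  have htop : t ≠ top := fun htop => hanc (htop ▸ hO.isAnc hG hh)
  obtain ⟨htr, hp⟩ := hO.2 t ht htop
  exact ⟨htr, (hu.2.2 _ hp (adj_parent hG htr)).symm, htop⟩

theorem parent_ne (hG : G.IsTree) (ht : t ≠ r) (hu : IsLeafAt G O t (parent G r t)) {x : V}
    (hx : x ∈ O) (hxr : x ≠ r) : parent G r x ≠ t := by
  rintro rfl
  have hcycle := hu.2.2 x hx (adj_parent hG hxr).symm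
  have hdist := dist_parent hG hxr
  have := dist_parent hG ht
  rw [← hcycle] at this
  omega

end IsLeafAt

namespace IsTop

variable {top h t u w x : V}

theorem isLeafAt_parent (hG : G.IsTree) (hO : IsTop G r O top) (hx : x ∈ O) (hxt : x ≠ top)
    (hno : ∀ z ∈ O, z ≠ r → parent G r z ≠ x) : IsLeafAt G O x (parent G r x) := by
  obtain ⟨hxr, hp⟩ := hO.2 x hx hxt
  refine ⟨hp, adj_parent hG hxr, fun z hz hxz => ?_⟩
  rcases parent_eq_or_parent_eq_of_adj (r := r) hG hxz with ⟨-, hpx⟩ | ⟨hzr, hpz⟩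
  · exact hpx.symm
  · exact absurd hpz (hno z hz hzr)

theorem exists_isLeafAt_of_not_isAnc [Finite V] (hG : G.IsTree) (hO : IsTop G r O top) (hh : h ∈ O)
    (hx : x ∈ O) (hxh : ¬ IsAnc G r x h) :
    ∃ y ∈ O, IsAnc G r x y ∧ ¬ IsAnc G r y h ∧ ∃ u, IsLeafAt G O y u := by
  obtain ⟨y, hy, hxy, hno⟩ := exists_isAnc_childless (r := r) hG hx
  have hyh : ¬ IsAnc G r y h := fun hyh => hxh (hxy.trans hyh)
  have hyt : y ≠ top := fun hyt => hyh (hyt ▸ hO.isAnc hG hh)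
  exact ⟨y, hy, hxy, hyh, _, hO.isLeafAt_parent hG hy hyt hno⟩

theorem exists_isLeafAt_of_forall_isAnc (hG : G.IsTree) (hO : IsTop G r O top) (hh : h ∈ O)
    (hth : top ≠ h) (hall : ∀ x ∈ O, IsAnc G r x h) : ∃ u, IsLeafAt G O top u := by
  obtain ⟨c, hcr, rfl, hch⟩ := (hO.isAnc hG hh).exists_child hG hth
  have hc : c ∈ O := hO.mem_of_isAnc hG hh (IsAnc.parent_left c) hch
  refine ⟨c, hc, (adj_parent hG hcr).symm, fun x hx hadj => ?_⟩
  have hle := (hO.isAnc hG hx).dist_le hG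
  rcases parent_eq_or_parent_eq_of_adj (r := r) hG hadj with ⟨htr, rfl⟩ | ⟨hxr, hxp⟩
  · have := dist_parent hG htr
    omega
  · refine (hall x hx).eq_of_dist_eq hG hch ?_
    rw [← dist_parent hG hxr, ← dist_parent hG hcr, hxp]

theorem exists_isLeafAt_ne [Finite V] (hG : G.IsTree) (hO : IsTop G r O top) (hh : h ∈ O)
    (hcard : 2 ≤ O.ncard) : ∃ y ∈ O, y ≠ h ∧ ∃ u, IsLeafAt G O y u := by
  by_cases hall : ∀ x ∈ O, IsAnc G r x h
  · obtain ⟨x, hx, hxh⟩ := Set.exists_ne_of_one_lt_ncard hcard h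
    have hth : top ≠ h := fun hth => hxh ((hall x hx).antisymm hG (hth ▸ hO.isAnc hG hx))
    exact ⟨top, hO.1, hth, hO.exists_isLeafAt_of_forall_isAnc hG hh hth hall⟩
  · push Not at hall
    obtain ⟨x, hx, hxh⟩ := hall
    obtain ⟨y, hy, -, hyh, hu⟩ := hO.exists_isLeafAt_of_not_isAnc hG hh hx hxh
    exact ⟨y, hy, fun hyh' => hyh (hyh' ▸ IsAnc.refl _), hu⟩

theorem move_down (hG : G.IsTree) (hO : IsTop G r O top) (ht : t ∈ O) (hh : h ∈ O) (hth : t ≠ h)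
    (hu : IsLeafAt G O t u) (hw : w ≠ r) (hwh : parent G r w = h) :
    ∃ top', IsTop G r (insert w O \ {t}) top' := by
  subst hwh
  by_cases hanc : IsAnc G r t (parent G r w)
  · obtain ⟨-, -, -, rfl⟩ := hu.of_isAnc hG hO ht hh hth hanc
    refine ⟨u, ⟨Or.inr hu.1, hu.2.1.ne'⟩, ?_⟩
    rintro x ⟨rfl | hx, hxt⟩ hxu
    · exact ⟨hw, Or.inr hh, hth.symm⟩
    · obtain ⟨hxr, hp⟩ := hO.2 x hx hxt
      exact ⟨hxr, Or.inr hp, fun hpt => hxu (hu.2.2 x hx (hpt ▸ (adj_parent hG hxr).symm))⟩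
  · obtain ⟨htr, rfl, htop⟩ := hu.of_not_isAnc hG hO ht hh hanc
    refine ⟨top, ⟨Or.inr hO.1, htop.symm⟩, ?_⟩
    rintro x ⟨rfl | hx, -⟩ hxtop
    · exact ⟨hw, Or.inr hh, hth.symm⟩
    · obtain ⟨hxr, hp⟩ := hO.2 x hx hxtop
      exact ⟨hxr, Or.inr hp, hu.parent_ne hG htr hx hxr⟩

theorem move_up (hG : G.IsTree) (hO : IsTop G r O h) (ht : t ∈ O) (hth : t ≠ h)
    (hu : IsLeafAt G O t u) (hr : h ≠ r) :
    IsTop G r (insert (parent G r h) O \ {t}) (parent G r h) := by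
  have hanc : ¬ IsAnc G r t h := fun hanc => hth (hanc.antisymm hG (hO.isAnc hG ht))
  obtain ⟨htr, rfl, -⟩ := hu.of_not_isAnc hG hO ht hO.1 hanc
  have hpt : parent G r h ≠ t := fun hpt => not_isAnc_parent hG hr (hpt ▸ hO.isAnc hG ht)
  refine ⟨⟨Or.inl rfl, hpt⟩, ?_⟩
  rintro x ⟨rfl | hx, -⟩ hxtop
  · exact absurd rfl hxtop
  · by_cases hxh : x = h
    · rw [hxh]
      exact ⟨hr, Or.inl rfl, hpt⟩
    · obtain ⟨hxr, hp⟩ := hO.2 x hx hxh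
      exact ⟨hxr, Or.inr hp, hu.parent_ne hG htr hx hxr⟩

end IsTop

theorem isAnc_head_of_not_isAnc_goal (hG : G.IsTree) (hL : ∀ x y, G.dist x y ≤ G.dist r g)
    {h t u w x : V} (htrail : IsBareTrail G r O h t ∨ IsFirstTrail G r g O h t) (hur : u ≠ r)
    (hut : parent G r u = t) (huh : IsAnc G r u h) (hug : ¬ IsAnc G r u g) (hw : w ≠ r)
    (hwh : parent G r w = h) (hx : x ∈ O) (hux : IsAnc G r u x) : IsAnc G r x h := by
  by_contra hxh
  have hdu := dist_parent hG hur
  rw [hut] at hdu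
  rcases htrail with hbare | hfirst
  · have := (hbare x hx hxh u hux huh).dist_le hG
    omega
  · have := hfirst.2.2 x hx hxh u hux huh
    have hdw := dist_parent hG hw
    -- The descendant `w` of `u` is off the longest path, hence close to the path to `g`.
    obtain ⟨c, -, hcu, hne, hc⟩ := exists_isAnc_dist_le_two_mul hG hL hug
      (huh.trans (hwh ▸ IsAnc.parent_left w))
    have := (hut ▸ hcu.parent_right hne : IsAnc G r c t).dist_le hG
    rw [hwh] at hdw
    omega

theorem isBareTrail_down (hG : G.IsTree) {top h t u w : V} (hO : IsTop G r O top) (ht : t ∈ O)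
    (hh : h ∈ O) (hth : t ≠ h) (hu : IsLeafAt G O t u) (hwh : parent G r w = h)
    (hwO : ∀ x ∈ O, ¬ IsAnc G r w x) (hbare : IsBareTrail G r O h t) :
    IsBareTrail G r (insert w O \ {t}) w u := by
  rintro x ⟨rfl | hx, -⟩ hxw c hcx hcw
  · exact absurd (IsAnc.refl _) hxw
  have hhw : IsAnc G r h w := hwh ▸ IsAnc.parent_left w
  have hch : IsAnc G r c h := hwh ▸ hcw.parent_right fun hcw => hwO x hx (hcw ▸ hcx)
  have hct := hbare x hx (fun hxh => hxw (hxh.trans hhw)) c hcx hch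
  by_cases hanc : IsAnc G r t h
  · obtain ⟨-, rfl, -, -⟩ := hu.of_isAnc hG hO ht hh hth hanc
    exact hct.trans (IsAnc.parent_left u)
  · obtain ⟨-, rfl, -⟩ := hu.of_not_isAnc hG hO ht hh hanc
    exact hct.parent_right fun hct => hanc (hct ▸ hch)

theorem isFirstTrail_down (hG : G.IsTree) (hL : ∀ x y, G.dist x y ≤ G.dist r g) {top h t u w : V}
    (hO : IsTop G r O top) (ht : t ∈ O) (hh : h ∈ O) (hth : t ≠ h) (hu : IsLeafAt G O t u)
    (hw : w ≠ r) (hwh : parent G r w = h) (hwO : ∀ x ∈ O, ¬ IsAnc G r w x)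
    (hfirst : IsFirstTrail G r g O h t) :
    IsBareTrail G r (insert w O \ {t}) w u ∨ IsFirstTrail G r g (insert w O \ {t}) w u := by
  have hhw : IsAnc G r h w := hwh ▸ IsAnc.parent_left w
  obtain ⟨hur, hut, huh, -⟩ := hu.of_isAnc hG hO ht hh hth (hfirst.2.1 h hh)
  have hbelow : ∀ x ∈ O, x ≠ t → IsAnc G r u x := fun x hx hxt =>
    (hu.of_isAnc hG hO ht hx hxt.symm (hfirst.2.1 x hx)).2.2.1
  by_cases hug : IsAnc G r u g
  · refine Or.inr ⟨hug, ?_, ?_⟩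
    · rintro x ⟨rfl | hx, hxt⟩
      · exact huh.trans hhw
      · exact hbelow x hx hxt
    · rintro x ⟨rfl | hx, -⟩ hxw c hcx hcw
      · exact absurd (IsAnc.refl _) hxw
      have hch : IsAnc G r c h := hwh ▸ hcw.parent_right fun hcw => hwO x hx (hcw ▸ hcx)
      have := hfirst.2.2 x hx (fun hxh => hxw (hxh.trans hhw)) c hcx hch
      have := hwh ▸ dist_parent hG hw
      have := hut ▸ dist_parent hG hur
      omega
  · left
    rintro x ⟨rfl | hx, hxt⟩ hxw
    · exact absurd (IsAnc.refl _) hxw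
    · exact absurd ((isAnc_head_of_not_isAnc_goal hG hL (Or.inr hfirst) hur hut huh hug hw hwh hx
        (hbelow x hx hxt)).trans hhw) hxw

theorem isTrail_down (hG : G.IsTree) (hL : ∀ x y, G.dist x y ≤ G.dist r g) {top h t u w : V}
    (hO : IsTop G r O top) (ht : t ∈ O) (hh : h ∈ O) (hth : t ≠ h) (hu : IsLeafAt G O t u)
    (hw : w ≠ r) (hwh : parent G r w = h) (hwO : ∀ x ∈ O, ¬ IsAnc G r w x)
    (htrail : IsBareTrail G r O h t ∨ IsFirstTrail G r g O h t) :
    IsBareTrail G r (insert w O \ {t}) w u ∨ IsFirstTrail G r g (insert w O \ {t}) w u :=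
  htrail.elim (fun hbare => Or.inl (isBareTrail_down hG hO ht hh hth hu hwh hwO hbare))
    (isFirstTrail_down hG hL hO ht hh hth hu hw hwh hwO)

theorem isDeep_ncard_of_forall_isAnc (hG : G.IsTree) {v w : V} (hvw : IsAnc G r v w)
    (hv : ∀ x ∈ O, IsAnc G r v x) (hw : ∀ x ∈ O, IsAnc G r x w) : IsDeep G r O.ncard v := by
  have hle : O.ncard ≤ (Finset.Icc (G.dist r v) (G.dist r w)).card := by
    rw [← Set.ncard_coe_finset]
    refine Set.ncard_le_ncard_of_injOn (G.dist r) (fun x hx => ?_) (fun x hx y hy hxy => ?_)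
      (Finset.finite_toSet _)
    · exact Finset.mem_coe.2 (Finset.mem_Icc.2 ⟨(hv x hx).dist_le hG, (hw x hx).dist_le hG⟩)
    · exact (hw x hx).eq_of_dist_eq hG (hw y hy) hxy
  have := hvw.dist_add_dist hG
  rw [Nat.card_Icc] at hle
  exact ⟨w, hvw, by omega⟩

theorem onlyInDeep_down (hG : G.IsTree) (hL : ∀ x y, G.dist x y ≤ G.dist r g)
    {top h t u w : V} (hO : IsTop G r O top) (ht : t ∈ O) (hh : h ∈ O) (hth : t ≠ h)
    (hu : IsLeafAt G O t u) (hw : w ≠ r) (hwh : parent G r w = h)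
    (hwO : ∀ x ∈ O, ¬ IsAnc G r w x) (hcard : (insert w O \ {t}).ncard = k)
    (htrail : IsBareTrail G r O h t ∨ IsFirstTrail G r g O h t) (hdeep : OnlyInDeep G r g k O) :
    OnlyInDeep G r g k (insert w O \ {t}) := by
  intro v hvg hv
  by_cases hvt : IsAnc G r v t
  · refine hdeep v hvg fun x hx => ?_
    by_cases hxt : x = t
    · rwa [hxt]
    · exact hv x ⟨Or.inr hx, hxt⟩
  have hvw : IsAnc G r v w := hv w ⟨Or.inl rfl, fun hwt => hwO t ht (hwt ▸ IsAnc.refl w)⟩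
  have hvu : IsAnc G r v u := hv u ⟨Or.inr hu.1, hu.2.1.ne'⟩
  by_cases hanc : IsAnc G r t h
  · obtain ⟨hur, hut, huh, -⟩ := hu.of_isAnc hG hO ht hh hth hanc
    obtain rfl : v = u := by_contra fun hne => hvt (hut ▸ hvu.parent_right hne)
    rw [← hcard]
    refine isDeep_ncard_of_forall_isAnc hG hvw hv ?_
    rintro x ⟨rfl | hx, hxt⟩
    · exact IsAnc.refl _
    · exact (isAnc_head_of_not_isAnc_goal hG hL htrail hur hut huh hvg hw hwh hx
        (hv x ⟨Or.inr hx, hxt⟩)).trans (hwh ▸ IsAnc.parent_left w)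
  · obtain ⟨-, rfl, -⟩ := hu.of_not_isAnc hG hO ht hh hanc
    exact absurd (hvu.trans (IsAnc.parent_left t)) hvt

end Occupied

/-! ## The choice of head and tail -/

section Choice

variable {V : Type} {G : SimpleGraph V} {S : Prep V} {A : AdjLists V} {k : ℕ}

/-- The set of the occupied vertices. -/
def occupied (occ : V → Option ℕ) : Set V := {v | (occ v).isSome = true}

/-- The last explored vertex of `l₂`, or of `l₁` if `l₂` is empty, or `t` if both are empty: the
final step of `chooseTail`. -/
def pickTail (stamp : V → ℕ) (t : V) (l₂ l₁ : List V) : Timed V :=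
  match l₂, l₁ with
  | y :: ys, _ => argMaxT stamp y ys
  | [], y :: ys => argMaxT stamp y ys
  | [], [] => pure t

/-- The leaves of the occupied subgraph other than `h`, as listed by `chooseTail`. -/
def tailCandidates [DecidableEq V] (A : AdjLists V) (s : State V k) (h : V) : List V :=
  (((List.range k).map s.pos).filter fun v => (isLeafT A s.occ v).val).filter fun v =>
    decide (v ≠ h)

/-- The occupied vertex nearest to the selected path that `chooseTail` avoids. -/
def nearestOccupied (S : Prep V) (s : State V k) (h : V) : V :=
  (argMinT S.distP h ((List.range k).map s.pos)).val

/-- `t` is a leaf of `O` that the algorithm may choose as the tail when the head is `h`: among the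
leaves other than `h` and a vertex `n` of `O` nearest to the selected path, none was explored after
`t`. -/
structure IsLastLeaf (G : SimpleGraph V) (S : Prep V) (O : Set V) (stamp : V → ℕ) (h t : V) :
    Prop where
  mem : t ∈ O
  ne : t ≠ h
  isLeafAt : ∃ u, IsLeafAt G O t u
  exists_nearest : ∃ n ∈ O, (∀ x ∈ O, S.distP n ≤ S.distP x) ∧
    ∀ y ∈ O, y ≠ h → y ≠ n → (∃ u, IsLeafAt G O y u) → stamp y ≤ stamp t

theorem isLeafT_val_eq_true_iff (hA : A.Represents G) (occ : V → Option ℕ) (v : V) :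
    (isLeafT A occ v).val = true ↔ ∃ u, IsLeafAt G (occupied occ) v u := by
  have hmem (x : V) : x ∈ (A.nbrs v).filter (fun w => (occ w).isSome) ↔
      G.Adj v x ∧ x ∈ occupied occ := by
    rw [List.mem_filter, hA.mem_nbrs]
    rfl
  rw [isLeafT, val_bind, val_pure, countT_val, decide_eq_true_iff]
  constructor
  · intro hone
    obtain ⟨u, hu⟩ := List.length_eq_one_iff.1 hone
    simp only [hu, List.mem_singleton] at hmem
    obtain ⟨hvu, huO⟩ := (hmem u).1 rfl
    exact ⟨u, huO, hvu, fun x hx hvx => (hmem x).2 ⟨hvx, hx⟩⟩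
  · rintro ⟨u, hu, hvu, huniq⟩
    have hsub : (A.nbrs v).filter (fun w => (occ w).isSome) ⊆ [u] := fun x hx =>
      List.mem_singleton.2 (huniq x ((hmem x).1 hx).2 ((hmem x).1 hx).1)
    exact le_antisymm (((hA.nbrs_nodup v).filter _).subperm hsub).length_le
      (List.length_pos_of_mem ((hmem u).2 ⟨hvu, hu⟩))

theorem isLeafT_cost_le {m : ℕ} (hm : ∀ v, (A.nbrs v).length ≤ m) (occ : V → Option ℕ) (v : V) :
    (isLeafT A occ v).cost ≤ m + 1 := by
  rw [isLeafT, cost_bind, cost_pure, countT_cost]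
  have := hm v
  omega

theorem pickTail_val (stamp : V → ℕ) (t : V) {l₁ l₂ : List V} (hsub : l₂ ⊆ l₁) :
    (l₁ = [] ∧ (pickTail stamp t l₂ l₁).val = t) ∨ ((pickTail stamp t l₂ l₁).val ∈ l₁ ∧
      ∀ y ∈ l₂, stamp y ≤ stamp (pickTail stamp t l₂ l₁).val) := by
  match l₂, l₁ with
  | y :: ys, l₁ =>
    obtain ⟨hmem, hmax⟩ := argMaxT_mem_and_le stamp y ys
    exact Or.inr ⟨hsub hmem, hmax⟩
  | [], y :: ys => exact Or.inr ⟨(argMaxT_mem_and_le stamp y ys).1, by simp⟩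
  | [], [] => exact Or.inl ⟨rfl, rfl⟩

theorem pickTail_cost_le (stamp : V → ℕ) (t : V) {l₁ l₂ : List V} {m : ℕ} (h₁ : l₁.length ≤ m)
    (h₂ : l₂.length ≤ m) : (pickTail stamp t l₂ l₁).cost ≤ m + 1 := by
  match l₂, l₁ with
  | y :: ys, _ =>
    rw [pickTail, argMaxT_cost]
    exact h₂.trans m.le_succ
  | [], y :: ys =>
    rw [pickTail, argMaxT_cost]
    exact h₁.trans m.le_succ
  | [], [] => exact Nat.zero_le _

theorem IsPlacement.mem_map_pos_iff {pos : ℕ → V} {occ : V → Option ℕ} (h : IsPlacement k pos occ)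
    {v : V} : v ∈ (List.range k).map pos ↔ v ∈ occupied occ := by
  simp only [List.mem_map, List.mem_range]
  exact h.isSome_iff.symm

theorem nearestOccupied_mem_and_le {s : State V k} (hs : IsPlacement k s.pos s.occ) {h : V}
    (hh : h ∈ occupied s.occ) : nearestOccupied S s h ∈ occupied s.occ ∧
      ∀ x ∈ occupied s.occ, S.distP (nearestOccupied S s h) ≤ S.distP x := by
  obtain ⟨hmem, hmin⟩ := argMinT_mem_and_le S.distP h ((List.range k).map s.pos)
  constructor
  · rcases List.mem_cons.1 hmem with heq | hmem
    · rwa [nearestOccupied, heq]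
    · exact hs.mem_map_pos_iff.1 hmem
  · exact fun x hx => hmin x (List.mem_cons_of_mem _ (hs.mem_map_pos_iff.2 hx))

/-- The test by which `chooseHead` finds the vertices with an unexplored neighbour. -/
def hasUnexploredT (A : AdjLists V) (explored : V → Bool) (y : Visit V) : Timed Bool := do
  let z ← findT (fun w => !explored w) (A.nbrs y.vertex)
  pure z.isSome

theorem hasUnexploredT_val_eq_true_iff (hA : A.Represents G) {explored : V → Bool} {y : Visit V} :
    (hasUnexploredT A explored y).val = true ↔ ∃ w, G.Adj y.vertex w ∧ explored w = false := by
  rw [hasUnexploredT, val_bind, val_pure, findT_val, List.find?_isSome]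
  simp only [hA.mem_nbrs, Bool.not_eq_true']

theorem hasUnexploredT_cost_le {m : ℕ} (hm : ∀ v, (A.nbrs v).length ≤ m) (explored : V → Bool)
    (y : Visit V) : (hasUnexploredT A explored y).cost ≤ m + 1 := by
  rw [hasUnexploredT, cost_bind, cost_pure]
  exact (findT_cost_le _ _).trans (Nat.succ_le_succ (hm _))

variable [DecidableEq V]

theorem mem_tailCandidates_iff (hA : A.Represents G) {s : State V k}
    (hs : IsPlacement k s.pos s.occ) {h v : V} : v ∈ tailCandidates A s h ↔
      v ∈ occupied s.occ ∧ v ≠ h ∧ ∃ u, IsLeafAt G (occupied s.occ) v u := by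
  rw [tailCandidates, List.mem_filter, List.mem_filter, hs.mem_map_pos_iff,
    isLeafT_val_eq_true_iff hA, decide_eq_true_iff, and_assoc, and_comm (a := v ≠ h)]

theorem chooseTail_of_isLeafAt (hA : A.Represents G) (s : State V k) {h t : V}
    (ht : ∃ u, IsLeafAt G (occupied s.occ) t u) : (chooseTail A S s h t).val = t := by
  rw [chooseTail, val_bind, if_pos ((isLeafT_val_eq_true_iff hA s.occ t).2 ht), val_pure]

theorem chooseTail_of_not_isLeafAt (hA : A.Represents G) (s : State V k) {h t : V}
    (ht : ¬ ∃ u, IsLeafAt G (occupied s.occ) t u) : (chooseTail A S s h t).val =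
      (pickTail s.stamp t ((tailCandidates A s h).filter fun v =>
        decide (v ≠ nearestOccupied S s h)) (tailCandidates A s h)).val := by
  rw [chooseTail, val_bind, if_neg (mt (isLeafT_val_eq_true_iff hA s.occ t).1 ht)]
  simp only [val_bind, filterT_val]
  rfl

theorem chooseTail_eq_or_isLastLeaf (hA : A.Represents G) {s : State V k}
    (hs : IsPlacement k s.pos s.occ) {h t : V} (hh : h ∈ occupied s.occ)
    (ht : ¬ ∃ u, IsLeafAt G (occupied s.occ) t u) :
    ((∀ y ∈ occupied s.occ, y ≠ h → ¬ ∃ u, IsLeafAt G (occupied s.occ) y u) ∧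
      (chooseTail A S s h t).val = t) ∨
    IsLastLeaf G S (occupied s.occ) s.stamp h (chooseTail A S s h t).val := by
  rw [chooseTail_of_not_isLeafAt hA s ht]
  rcases pickTail_val s.stamp t (List.filter_subset_self (tailCandidates A s h)
    (p := fun v => decide (v ≠ nearestOccupied S s h))) with ⟨hnil, hval⟩ | ⟨hmem, hmax⟩
  · refine Or.inl ⟨fun y hy hyh hleaf => ?_, hval⟩
    have := (mem_tailCandidates_iff hA hs).2 ⟨hy, hyh, hleaf⟩
    simp [hnil] at this
  · obtain ⟨hO, hne, hleaf⟩ := (mem_tailCandidates_iff hA hs).1 hmem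
    obtain ⟨hn, hmin⟩ := nearestOccupied_mem_and_le (S := S) hs hh
    refine Or.inr ⟨hO, hne, hleaf, _, hn, hmin, fun y hy hyh hyn hyleaf => hmax y ?_⟩
    exact List.mem_filter.2
      ⟨(mem_tailCandidates_iff hA hs).2 ⟨hy, hyh, hyleaf⟩, decide_eq_true hyn⟩

theorem chooseTail_cost_le {m : ℕ} (hm : ∀ v, (A.nbrs v).length ≤ m) (s : State V k) (h t : V) :
    (chooseTail A S s h t).cost ≤ (m + 1) + (k + (k + 1) + (k * (m + 2) + 1) + (k + 1) + (k + 1) +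
      (k + 1)) := by
  rw [chooseTail, cost_bind]
  have htail := isLeafT_cost_le hm s.occ t
  split_ifs
  · rw [cost_pure]
    omega
  simp only [cost_bind, cost_charge, argMinT_cost, List.length_map, List.length_range]
  have hfilter (l : List V) (x : V) :=
    filterT_cost_le (fun v => (pure (decide (v ≠ x)) : Timed Bool)) l (c := 0) fun _ => le_rfl
  have hlength (p : V → Timed Bool) {l : List V} (hl : l.length ≤ k) :
      (filterT p l).val.length ≤ k := by
    rw [filterT_val]
    exact (List.length_filter_le _ _).trans hl
  have hleaves : (filterT (isLeafT A s.occ) ((List.range k).map s.pos)).cost ≤ k * (m + 2) + 1 :=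
    (filterT_cost_le _ _ fun x => isLeafT_cost_le hm s.occ x).trans_eq
      (by rw [List.length_map, List.length_range])
  have hlen₀ := hlength (isLeafT A s.occ) (l := (List.range k).map s.pos) (by simp)
  have hcost₁ := hfilter (filterT (isLeafT A s.occ) ((List.range k).map s.pos)).val h
  have hlen₁ := hlength (fun v => pure (decide (v ≠ h))) hlen₀
  have hcost₂ := hfilter (filterT (fun v => pure (decide (v ≠ h)))
    (filterT (isLeafT A s.occ) ((List.range k).map s.pos)).val).val (nearestOccupied S s h)
  have hlen₂ := hlength (fun v => pure (decide (v ≠ nearestOccupied S s h))) hlen₁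
  have hpick := pickTail_cost_le s.stamp t hlen₁ hlen₂
  change _ + (_ + (_ + (_ + (_ + (_ + (pickTail s.stamp t _ _).cost))))) ≤ _
  unfold nearestOccupied at *
  omega

theorem chooseHead_cost_le {m : ℕ} (hm : ∀ v, (A.nbrs v).length ≤ m) (s : State V k) :
    (chooseHead A S s).cost ≤
      1 + 4 * (m + 1) + (k * (m + 2) + 1) + (k * (m + 2) + 1) + (k + 1) := by
  have hnext (v : V) : (nextUnexplored S s.explored (A.nbrs v)).cost ≤ 2 * (m + 1) :=
    (nextUnexplored_cost_le s.explored _).trans (by have := hm v; omega)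
  rw [chooseHead, cost_bind, cost_tick, cost_bind]
  have hhead := hnext s.head
  cases (nextUnexplored S s.explored (A.nbrs s.head)).val with
  | some w =>
    simp only [cost_pure]
    omega
  | none =>
    simp only [cost_bind]
    have hsearch := search_cost_le A (fun v => (s.occ v).isSome) hm k [⟨s.head, none, 0⟩] []
    have hlength := search_length_le A (fun v => (s.occ v).isSome) k [⟨s.head, none, 0⟩] []
    generalize (search A (fun v => (s.occ v).isSome) k [⟨s.head, none, 0⟩] []).val = l at hlength ⊢
    rw [List.length_nil, add_zero] at hlength
    have hfilter := (filterT_cost_le (hasUnexploredT A s.explored) l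
      (hasUnexploredT_cost_le hm s.explored)).trans
        (Nat.succ_le_succ (Nat.mul_le_mul_right (m + 2) hlength))
    have hcands : (filterT (hasUnexploredT A s.explored) l).val.length ≤ l.length := by
      rw [filterT_val]
      exact List.length_filter_le _ _
    unfold hasUnexploredT at hfilter hcands
    split
    next y ys heq =>
      rw [heq, List.length_cons] at hcands
      simp only [cost_bind, cost_pure, argMinT_cost]
      have := hnext (argMinT Visit.depth y ys).val.vertex
      omega
    next =>
      simp only [cost_bind, cost_pure, argMinT_cost]
      omega

end Choice

section Transition

variable {V : Type} {G : SimpleGraph V} {S : Prep V} {k : ℕ}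

namespace IsPlacement

variable {pos : ℕ → V} {occ : V → Option ℕ}

theorem range_eq (h : IsPlacement k pos occ) :
    (Set.range fun i : Fin k => pos i) = occupied occ := by
  ext v
  constructor
  · rintro ⟨i, rfl⟩
    exact h.isSome_pos i.2
  · intro hv
    obtain ⟨i, hi, rfl⟩ := h.isSome_iff.1 hv
    exact ⟨⟨i, hi⟩, rfl⟩

theorem isConfiguration (hG : G.IsTree) {r top : V} (h : IsPlacement k pos occ)
    (htop : IsTop G r (occupied occ) top) : IsConfiguration G fun i : Fin k => pos i := by
  refine ⟨fun i j hij => Fin.ext (h.pos_injOn i.2 j.2 hij), ?_⟩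
  rw [h.range_eq]
  exact htop.connected hG

end IsPlacement

/-- The invariant of the transition phase for the occupied set `O`, the head `h` and the tail
`t`. -/
structure IsFormation (G : SimpleGraph V) (S : Prep V) (k : ℕ) (O : Set V) (h t : V) : Prop where
  top : ∃ top, IsTop G S.start O top
  head_mem : h ∈ O
  tail_mem : t ∈ O
  tail_ne : 2 ≤ k → t ≠ h
  trail : IsBareTrail G S.start O h t ∨ IsFirstTrail G S.start S.goal O h t
  deep : OnlyInDeep G S.start S.goal k O

/-- The invariant of the transition phase. -/
structure IsWalkState (G : SimpleGraph V) (S : Prep V) (s : State V k) : Prop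
    extends IsFormation G S k (occupied s.occ) s.head s.tail where
  exploration : IsExploration G S s.explored s.parent s.stamp s.clock s.head
  placement : IsPlacement k s.pos s.occ
  explored : ∀ v ∈ occupied s.occ, s.explored v = true
  walk_head : ∃ W, s.walk = (fun i : Fin k => s.pos i) :: W
  config : ∀ c ∈ s.walk, IsConfiguration G c
  chain : s.walk.IsChain fun c c' => IsTransition G 1 c' c
  spanning : ∀ v, s.explored v = true → ∃ c ∈ s.walk, v ∈ Set.range c

/-- The head `h` and the provisional tail `t` chosen for a transition. -/
structure IsHeadChoice (G : SimpleGraph V) (S : Prep V) (s : State V k) (h t : V) : Prop where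
  mem : h ∈ occupied s.occ
  isAnc_head : IsAnc G S.start h s.head
  kept_or_moved : (h = s.head ∧ t = s.tail) ∨ (h ≠ s.head ∧ t = s.head)

/-- The choice of the head and the target `w`, when a new vertex is explored. -/
structure IsDownChoice (G : SimpleGraph V) (S : Prep V) (s : State V k) (h t w : V) : Prop
    extends IsHeadChoice G S s h t where
  adj : G.Adj h w
  unexplored : s.explored w = false
  onPath_of_onPath : S.onPath w = true →
    ∀ x, G.Adj h x → s.explored x = false → S.onPath x = true
  open_isAnc : ∀ v x, s.explored v = true → G.Adj v x → s.explored x = false →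
    IsAnc G S.start v h

/-- The choice of the head and the target `w`, when all neighbours of occupied vertices are
explored. -/
structure IsUpChoice (G : SimpleGraph V) (S : Prep V) (s : State V k) (h t w : V) : Prop
    extends IsHeadChoice G S s h t where
  isTop : IsTop G S.start (occupied s.occ) h
  not_isAnc_goal : ¬ IsAnc G S.start h S.goal
  eq_parent : w = parent G S.start h
  open_isAnc : ∀ v x, s.explored v = true → G.Adj v x → s.explored x = false →
    IsAnc G S.start v w

/-- A leaf of the occupied subgraph that may be vacated when the head is `h`. -/
structure IsTailChoice (G : SimpleGraph V) (S : Prep V) (s : State V k) (h t : V) : Prop where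
  mem : t ∈ occupied s.occ
  ne : t ≠ h
  isLeafAt : ∃ u, IsLeafAt G (occupied s.occ) t u
  trail : IsBareTrail G S.start (occupied s.occ) h t ∨
    IsFirstTrail G S.start S.goal (occupied s.occ) h t

/-- The occupied vertices that have an unexplored neighbour, as found by `chooseHead`. -/
def openVisits [DecidableEq V] (A : AdjLists V) (s : State V k) : List (Visit V) :=
  (search A (fun v => (s.occ v).isSome) k [⟨s.head, none, 0⟩] []).val.filter fun y =>
    (hasUnexploredT A s.explored y).val

section ChooseHead

variable [DecidableEq V] {A : AdjLists V} {s : State V k}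

theorem chooseHead_of_eq_some {w : V}
    (hw : (nextUnexplored S s.explored (A.nbrs s.head)).val = some w) :
    (chooseHead A S s).val = (s.head, s.tail, w) := by
  simp only [chooseHead, val_bind, hw]
  rfl

theorem chooseHead_of_openVisits_eq_cons {y : Visit V} {ys : List (Visit V)}
    (hnone : (nextUnexplored S s.explored (A.nbrs s.head)).val = none)
    (hcons : openVisits A s = y :: ys) :
    (chooseHead A S s).val = ((argMinT Visit.depth y ys).val.vertex, s.head,
      (nextUnexplored S s.explored (A.nbrs (argMinT Visit.depth y ys).val.vertex)).val.getD
        (argMinT Visit.depth y ys).val.vertex) := by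
  simp only [chooseHead, val_bind, hnone, filterT_val]
  simp only [openVisits, hasUnexploredT, val_bind] at hcons
  rw [hcons]
  rfl

theorem chooseHead_of_openVisits_eq_nil
    (hnone : (nextUnexplored S s.explored (A.nbrs s.head)).val = none)
    (hnil : openVisits A s = []) {e : Visit V}
    (he : e = (argMinT (fun y : Visit V => S.distP y.vertex) ⟨s.head, none, 0⟩
      (search A (fun v => (s.occ v).isSome) k [⟨s.head, none, 0⟩] []).val).val) :
    (chooseHead A S s).val = (e.vertex, (if e.vertex = s.head then s.tail else s.head),
      (s.parent e.vertex).getD e.vertex) := by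
  simp only [chooseHead, val_bind, hnone, filterT_val]
  simp only [openVisits, hasUnexploredT, val_bind] at hnil
  rw [hnil, he]
  rfl

end ChooseHead

namespace IsHeadChoice

variable {s : State V k} {h t : V}

theorem tail_mem (hc : IsHeadChoice G S s h t) (hs : IsWalkState G S s) : t ∈ occupied s.occ := by
  rcases hc.kept_or_moved with ⟨-, rfl⟩ | ⟨-, rfl⟩
  · exact hs.tail_mem
  · exact hs.head_mem

theorem tail_ne (hc : IsHeadChoice G S s h t) (hs : IsWalkState G S s) (hk : 2 ≤ k) : t ≠ h := by
  rcases hc.kept_or_moved with ⟨rfl, rfl⟩ | ⟨hne, rfl⟩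
  · exact hs.tail_ne hk
  · exact hne.symm

theorem trail (hc : IsHeadChoice G S s h t) (hs : IsWalkState G S s) :
    IsBareTrail G S.start (occupied s.occ) h t ∨
      IsFirstTrail G S.start S.goal (occupied s.occ) h t := by
  rcases hc.kept_or_moved with ⟨rfl, rfl⟩ | ⟨-, rfl⟩
  · exact hs.trail
  · exact Or.inl fun _ _ _ _ _ hch => hch.trans hc.isAnc_head

end IsHeadChoice

namespace IsWalkState

variable {s : State V k}

theorem explored_goal_eq_false (hs : IsWalkState G S s) (hg : s.head ≠ S.goal) :
    s.explored S.goal = false :=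
  Bool.eq_false_iff.2 (mt hs.exploration.goal_eq hg)

theorem isTop_of_nearest (hS : IsPrep G S) (hs : IsWalkState G S s)
    (hoff : ∀ x ∈ occupied s.occ, ¬ IsAnc G S.start x S.goal) {n : V} (hn : n ∈ occupied s.occ)
    (hmin : ∀ x ∈ occupied s.occ, S.distP n ≤ S.distP x) :
    IsTop G S.start (occupied s.occ) n := by
  obtain ⟨t, ht⟩ := hs.top
  obtain rfl : n = t := by
    by_contra hnt
    have := hS.dist_off n (hoff n hn)
    have := hmin _ (ht.2 n hn hnt).2
    omega
  exact ht

theorem isAnc_head_of_nearest [Finite V] (hG : G.IsTree) (hS : IsPrep G S) (hs : IsWalkState G S s)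
    (hg : s.head ≠ S.goal) {n : V} (hn : n ∈ occupied s.occ)
    (hmin : ∀ x ∈ occupied s.occ, S.distP n ≤ S.distP x) : IsAnc G S.start n s.head := by
  by_cases hoff : ∀ x ∈ occupied s.occ, ¬ IsAnc G S.start x S.goal
  · exact (hs.isTop_of_nearest hS hoff hn hmin).isAnc hG hs.head_mem
  · push Not at hoff
    obtain ⟨x, hx, hxg⟩ := hoff
    have hng : IsAnc G S.start n S.goal := by
      by_contra hng
      have := hS.dist_off n hng
      have := hmin x hx
      rw [hS.dist_on x hxg] at this
      omega
    obtain ⟨y, w, -, -, hyh, hall, -⟩ :=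
      hs.exploration.exists_last_on_path hG (hs.explored_goal_eq_false hg)
    exact (hall n hng (hs.explored n hn)).trans hyh

theorem not_isAnc_goal_of_closed [Finite V] (hG : G.IsTree) (hs : IsWalkState G S s)
    (hg : s.head ≠ S.goal)
    (hclosed : ∀ v ∈ occupied s.occ, ∀ w, G.Adj v w → s.explored w = true) {x : V}
    (hx : x ∈ occupied s.occ) : ¬ IsAnc G S.start x S.goal := by
  intro hxg
  obtain ⟨t, ht⟩ := hs.top
  obtain ⟨y, w, -, -, hyh, hall, hyw, hw⟩ :=
    hs.exploration.exists_last_on_path hG (hs.explored_goal_eq_false hg)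
  have hy : y ∈ occupied s.occ := ht.mem_of_isAnc hG hs.head_mem
    ((ht.isAnc hG hx).trans (hall x hxg (hs.explored x hx))) hyh
  simp [hclosed y hy w hyw] at hw

theorem isSearchState_search [Finite V] [DecidableEq V] {A : AdjLists V} (hG : G.IsTree)
    (hA : A.Represents G) (hs : IsWalkState G S s) {q : V} (hq : q ∈ occupied s.occ) :
    IsSearchState G (fun v => (s.occ v).isSome) (treePred G q) (G.dist q) (occupied s.occ) []
      (search A (fun v => (s.occ v).isSome) k [⟨q, none, 0⟩] []).val ∧
    ∀ v ∈ occupied s.occ,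
      v ∈ (search A (fun v => (s.occ v).isSome) k [⟨q, none, 0⟩] []).val.map Visit.vertex := by
  obtain ⟨t, ht⟩ := hs.top
  exact isSearchState_search_of_forall_active_parent (active := fun v => (s.occ v).isSome) hG hA hq
    (fun v hv => ht.parent_mem hG hq hv) hs.placement.ncard_eq.le

theorem isDownChoice_head {A : AdjLists V} (hA : A.Represents G)
    (hs : IsWalkState G S s) {w : V}
    (hw : (nextUnexplored S s.explored (A.nbrs s.head)).val = some w) :
    IsDownChoice G S s s.head s.tail w := by
  obtain ⟨hmem, hunexplored, hpref⟩ := nextUnexplored_eq_some hw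
  constructor
  case toIsHeadChoice => exact ⟨hs.head_mem, IsAnc.refl _, Or.inl ⟨rfl, rfl⟩⟩
  case adj => exact (hA.mem_nbrs _ _).1 hmem
  case unexplored => exact hunexplored
  case onPath_of_onPath => exact fun hwP x hx => hpref hwP x ((hA.mem_nbrs _ _).2 hx)
  case open_isAnc => exact hs.exploration.open_isAnc

theorem isDownChoice_of_nearest (hG : G.IsTree) {A : AdjLists V} (hA : A.Represents G)
    (hs : IsWalkState G S s) (hclosed : ∀ w, G.Adj s.head w → s.explored w = true) {h w : V}
    (hh : h ∈ occupied s.occ)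
    (hnearest : ∀ v ∈ occupied s.occ, ∀ x, G.Adj v x → s.explored x = false →
      G.dist s.head h ≤ G.dist s.head v)
    (hw : (nextUnexplored S s.explored (A.nbrs h)).val = some w) :
    IsDownChoice G S s h s.head w := by
  obtain ⟨hmem, hunexplored, hpref⟩ := nextUnexplored_eq_some hw
  have hadj : G.Adj h w := (hA.mem_nbrs _ _).1 hmem
  have hanc := hs.exploration.open_isAnc h w (hs.explored h hh) hadj hunexplored
  constructor
  case toIsHeadChoice =>
    refine ⟨hh, hanc, Or.inr ⟨?_, rfl⟩⟩
    rintro rfl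
    simp [hclosed w hadj] at hunexplored
  case adj => exact hadj
  case unexplored => exact hunexplored
  case onPath_of_onPath => exact fun hwP x hx => hpref hwP x ((hA.mem_nbrs _ _).2 hx)
  case open_isAnc =>
    intro v x hv hvx hx
    have hvh := hs.exploration.open_isAnc v x hv hvx hx
    rcases hvh.total hanc with hle | hle
    · exact hle
    obtain ⟨t, ht⟩ := hs.top
    have hdist := hnearest v
      (ht.mem_of_isAnc hG hs.head_mem ((ht.isAnc hG hh).trans hle) hvh) x hvx hx
    have := hvh.dist_add_dist hG
    have := hanc.dist_add_dist hG
    rw [SimpleGraph.dist_comm, SimpleGraph.dist_comm (v := v)] at hdist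
    rw [hle.eq_of_dist_le hG (by omega)]
    exact IsAnc.refl _

theorem isUpChoice_of_nearest [Finite V] [DecidableEq V] (hG : G.IsTree) (hS : IsPrep G S)
    (hs : IsWalkState G S s) (hg : s.head ≠ S.goal)
    (hclosed : ∀ v ∈ occupied s.occ, ∀ w, G.Adj v w → s.explored w = true) {h : V}
    (hh : h ∈ occupied s.occ) (hmin : ∀ x ∈ occupied s.occ, S.distP h ≤ S.distP x) :
    IsUpChoice G S s h (if h = s.head then s.tail else s.head) ((s.parent h).getD h) := by
  have hoff := fun x hx => hs.not_isAnc_goal_of_closed hG hg hclosed (x := x) hx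
  have htop := hs.isTop_of_nearest hS hoff hh hmin
  have hhead := htop.isAnc hG hs.head_mem
  have hroot : h ≠ S.start := fun hr => hoff h hh (hr ▸ IsAnc.root hG S.goal)
  rw [hs.exploration.par_eq h (hs.explored h hh) hroot, Option.getD_some]
  constructor
  case toIsHeadChoice =>
    refine ⟨hh, hhead, ?_⟩
    split_ifs with hheq
    · exact Or.inl ⟨hheq, rfl⟩
    · exact Or.inr ⟨hheq, rfl⟩
  case isTop => exact htop
  case not_isAnc_goal => exact hoff h hh
  case eq_parent => rfl
  case open_isAnc =>
    intro v x hv hvx hx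
    have hvh := hs.exploration.open_isAnc v x hv hvx hx
    have hvO : v ∉ occupied s.occ := fun hvO => by simp [hclosed v hvO x hvx] at hx
    rcases hvh.total hhead with hle | hle
    · exact hle.parent_right fun hvh => hvO (hvh ▸ hh)
    · exact absurd (htop.mem_of_isAnc hG hs.head_mem hle hvh) hvO

theorem exists_mem_openVisits [Finite V] [DecidableEq V] (hG : G.IsTree) {A : AdjLists V}
    (hA : A.Represents G) (hs : IsWalkState G S s) {v w : V} (hv : v ∈ occupied s.occ)
    (hvw : G.Adj v w) (hw : s.explored w = false) :
    ∃ e ∈ openVisits A s, e.vertex = v ∧ e.depth = G.dist s.head v := by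
  obtain ⟨hvisits, hvisited⟩ := hs.isSearchState_search hG hA hs.head_mem
  obtain ⟨e, he, rfl⟩ := List.mem_map.1 (hvisited v hv)
  exact ⟨e, List.mem_filter.2 ⟨he, (hasUnexploredT_val_eq_true_iff hA).2 ⟨w, hvw, hw⟩⟩, rfl,
    (hvisits.label e he).2.2⟩

theorem isDownChoice_of_openVisits_eq_cons [Finite V] [DecidableEq V] (hG : G.IsTree)
    {A : AdjLists V} (hA : A.Represents G) (hs : IsWalkState G S s)
    (hnext : (nextUnexplored S s.explored (A.nbrs s.head)).val = none) {y : Visit V}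
    {ys : List (Visit V)} (hcands : openVisits A s = y :: ys) :
    IsDownChoice G S s (chooseHead A S s).val.1 (chooseHead A S s).val.2.1
      (chooseHead A S s).val.2.2 := by
  obtain ⟨hvisits, -⟩ := hs.isSearchState_search hG hA hs.head_mem
  obtain ⟨hmem, hmin⟩ := argMinT_mem_and_le Visit.depth y ys
  rw [chooseHead_of_openVisits_eq_cons hnext hcands]
  rw [← hcands] at hmem hmin
  generalize (argMinT Visit.depth y ys).val = e at hmem hmin ⊢
  obtain ⟨he, hunexplored⟩ := List.mem_filter.1 hmem
  obtain ⟨heO, -, hdepth⟩ := hvisits.label e he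
  obtain ⟨x, hx, hxe⟩ := (hasUnexploredT_val_eq_true_iff hA).1 hunexplored
  cases htarget : (nextUnexplored S s.explored (A.nbrs e.vertex)).val with
  | none => simp [explored_of_nextUnexplored_eq_none htarget ((hA.mem_nbrs _ _).2 hx)] at hxe
  | some w =>
    refine hs.isDownChoice_of_nearest hG hA (fun w hw =>
      explored_of_nextUnexplored_eq_none hnext ((hA.mem_nbrs _ _).2 hw)) heO ?_ htarget
    intro v hv x hvx hx
    obtain ⟨e', he', -, hdepth'⟩ := hs.exists_mem_openVisits hG hA hv hvx hx
    exact hdepth ▸ hdepth' ▸ hmin e' he'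

theorem isUpChoice_of_openVisits_eq_nil [Finite V] [DecidableEq V] (hG : G.IsTree)
    (hS : IsPrep G S) {A : AdjLists V} (hA : A.Represents G) (hs : IsWalkState G S s)
    (hg : s.head ≠ S.goal) (hnext : (nextUnexplored S s.explored (A.nbrs s.head)).val = none)
    (hcands : openVisits A s = []) :
    IsUpChoice G S s (chooseHead A S s).val.1 (chooseHead A S s).val.2.1
      (chooseHead A S s).val.2.2 := by
  obtain ⟨hvisits, hvisited⟩ := hs.isSearchState_search hG hA hs.head_mem
  obtain ⟨hmem, hmin⟩ := argMinT_mem_and_le (fun y : Visit V => S.distP y.vertex)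
    ⟨s.head, none, 0⟩ (search A (fun v => (s.occ v).isSome) k [⟨s.head, none, 0⟩] []).val
  rw [chooseHead_of_openVisits_eq_nil hnext hcands rfl]
  generalize (argMinT _ _ _).val = e at hmem hmin ⊢
  refine hs.isUpChoice_of_nearest hG hS hg (fun v hv w hvw => ?_) ?_ fun x hx => ?_
  · by_contra hw
    obtain ⟨e, he, -⟩ := hs.exists_mem_openVisits hG hA hv hvw (Bool.eq_false_iff.2 hw)
    simp [hcands] at he
  · rcases List.mem_cons.1 hmem with heq | he
    · rw [heq]
      exact hs.head_mem
    · exact (hvisits.label _ he).1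
  · obtain ⟨e, he, rfl⟩ := List.mem_map.1 (hvisited x hx)
    exact hmin e (List.mem_cons_of_mem _ he)

theorem isDownChoice_or_isUpChoice_chooseHead [Finite V] [DecidableEq V] (hG : G.IsTree)
    (hS : IsPrep G S) {A : AdjLists V} (hA : A.Represents G) (hs : IsWalkState G S s)
    (hg : s.head ≠ S.goal) :
    IsDownChoice G S s (chooseHead A S s).val.1 (chooseHead A S s).val.2.1
      (chooseHead A S s).val.2.2 ∨
    IsUpChoice G S s (chooseHead A S s).val.1 (chooseHead A S s).val.2.1
      (chooseHead A S s).val.2.2 := by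
  cases hnext : (nextUnexplored S s.explored (A.nbrs s.head)).val with
  | some w => exact Or.inl (chooseHead_of_eq_some hnext ▸ hs.isDownChoice_head hA hnext)
  | none =>
    cases hcands : openVisits A s with
    | cons y ys => exact Or.inl (hs.isDownChoice_of_openVisits_eq_cons hG hA hnext hcands)
    | nil => exact Or.inr (hs.isUpChoice_of_openVisits_eq_nil hG hS hA hg hnext hcands)

theorem isBareTrail_of_isLastLeaf [Finite V] (hG : G.IsTree) (hS : IsPrep G S)
    (hs : IsWalkState G S s) (hg : s.head ≠ S.goal) {h t t' : V} (hc : IsHeadChoice G S s h t)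
    (ht : ¬ ∃ u, IsLeafAt G (occupied s.occ) t u)
    (ht' : IsLastLeaf G S (occupied s.occ) s.stamp h t') :
    IsBareTrail G S.start (occupied s.occ) h t' := by
  obtain ⟨top, htop⟩ := hs.top
  obtain ⟨n, hn, hmin, hlast⟩ := ht'.exists_nearest
  intro x hx hxh c hcx hch
  by_contra hct
  -- The branch of `x` has a leaf; it was explored after `t'`, against the choice of `t'`.
  obtain ⟨y, hy, hxy, hyh, hleaf⟩ := htop.exists_isLeafAt_of_not_isAnc hG hc.mem hx hxh
  have hyn : y ≠ n := by
    rintro rfl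
    have hyhead := hs.isAnc_head_of_nearest hG hS hg hn hmin
    rcases hc.kept_or_moved with ⟨rfl, -⟩ | ⟨-, rfl⟩
    · exact hyh hyhead
    · obtain ⟨u, hu⟩ := hleaf
      have hytop := (hu.of_isAnc hG htop hy hs.head_mem
        (fun hyhead => ht ⟨u, hyhead ▸ hu⟩) hyhead).2.2.2
      exact hyh (hytop ▸ htop.isAnc hG hc.mem)
  have hyne : y ≠ h := fun hyh' => hyh (hyh' ▸ IsAnc.refl _)
  have := hlast y hy hyne hyn hleaf
  have := hs.exploration.stamp_mono _ y c (hs.explored _ ht'.mem) (hs.explored y hy)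
    (hch.trans hc.isAnc_head) (hcx.trans hxy) hct
  omega

theorem chooseTail_mem [DecidableEq V] {A : AdjLists V} (hA : A.Represents G)
    (hs : IsWalkState G S s) {h t : V} (hc : IsHeadChoice G S s h t) :
    (chooseTail A S s h t).val ∈ occupied s.occ := by
  by_cases hleaf : ∃ u, IsLeafAt G (occupied s.occ) t u
  · exact (chooseTail_of_isLeafAt hA s hleaf).symm ▸ hc.tail_mem hs
  · rcases chooseTail_eq_or_isLastLeaf (S := S) hA hs.placement hc.mem hleaf with ⟨-, hval⟩ | hlast
    · exact hval.symm ▸ hc.tail_mem hs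
    · exact hlast.mem

theorem isTailChoice_chooseTail [Finite V] [DecidableEq V] {A : AdjLists V} (hG : G.IsTree)
    (hS : IsPrep G S) (hA : A.Represents G) (hs : IsWalkState G S s) (hg : s.head ≠ S.goal)
    (hk : 2 ≤ k) {h t : V} (hc : IsHeadChoice G S s h t) :
    IsTailChoice G S s h (chooseTail A S s h t).val := by
  by_cases hleaf : ∃ u, IsLeafAt G (occupied s.occ) t u
  · rw [chooseTail_of_isLeafAt hA s hleaf]
    exact ⟨hc.tail_mem hs, hc.tail_ne hs hk, hleaf, hc.trail hs⟩
  · rcases chooseTail_eq_or_isLastLeaf (S := S) hA hs.placement hc.mem hleaf with ⟨hnone, -⟩ | hlast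
    · obtain ⟨top, htop⟩ := hs.top
      obtain ⟨y, hy, hyh, hyleaf⟩ :=
        htop.exists_isLeafAt_ne hG hc.mem (hk.trans_eq hs.placement.ncard_eq.symm)
      exact absurd hyleaf (hnone y hy hyh)
    · exact ⟨hlast.mem, hlast.ne, hlast.isLeafAt,
        Or.inl (hs.isBareTrail_of_isLastLeaf hG hS hg hc hleaf hlast)⟩

end IsWalkState

end Transition

/-! ## The effect of a transition -/

section Move

variable {V : Type} {G : SimpleGraph V} {S : Prep V} {k : ℕ} {s : State V k}

/-- The effect of a transition in which the head moves from `h` to `w` and `t` is vacated: `m`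
consists of the new positions, the new occupation and the new tail. -/
structure IsMove (G : SimpleGraph V) (s : State V k) (h w t : V)
    (m : (ℕ → V) × (V → Option ℕ) × V) : Prop where
  placement : IsPlacement k m.1 m.2.1
  occupied_eq : occupied m.2.1 = insert w (occupied s.occ) \ {t}
  isTransition : IsTransition G 1 (fun i : Fin k => s.pos i) fun i => m.1 i
  adj_tail : G.Adj t m.2.2
  tail_eq_or_mem : (h = t ∧ m.2.2 = w) ∨ m.2.2 ∈ occupied s.occ

namespace IsWalkState

theorem isFollowed_followHead [Finite V] [DecidableEq V] {A : AdjLists V} (hG : G.IsTree)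
    (hA : A.Represents G) (hs : IsWalkState G S s) {h t w : V} (hh : h ∈ occupied s.occ)
    (ht : t ∈ occupied s.occ) (hw : w ∉ occupied s.occ) (hhw : G.Adj h w) :
    IsFollowed G k w (List.iterate (parent G t) h (G.dist t h + 1)) t s.pos s.occ
      (followHead w (traceBack (some h)
        (search A (fun v => (s.occ v).isSome) k [⟨t, none, 0⟩] []).val).val s.pos s.occ).val := by
  obtain ⟨hvisits, hvisited⟩ := hs.isSearchState_search hG hA ht
  rw [traceBack_eq_iterate_parent hG hvisits (hvisited h hh)]
  have hne : List.iterate (parent G t) h (G.dist t h + 1) ≠ [] := by simp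
  have hlast : (List.iterate (parent G t) h (G.dist t h + 1)).getLast hne = t := by
    simp only [List.getLast_eq_getElem, List.length_iterate, List.getElem_iterate,
      Nat.add_sub_cancel]
    exact iterate_parent_dist hG t h
  have hmem : ∀ v ∈ List.iterate (parent G t) h (G.dist t h + 1), v ∈ occupied s.occ := by
    obtain ⟨top, htop⟩ := hs.top
    exact fun v hv => htop.mem_of_isAnc_of_mem hG ht hh ((mem_iterate_parent hG).1 hv)
  have hchain : (w :: List.iterate (parent G t) h (G.dist t h + 1)).IsChain G.Adj :=
    List.isChain_cons_cons.2 ⟨hhw.symm, isChain_iterate_parent hG⟩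
  have hfollowed := RHWP.isFollowed_followHead hne hs.placement
    (by simpa [occupied] using hw) hmem (nodup_iterate_parent hG) hchain
  rwa [hlast] at hfollowed

theorem isMove_followHead [Finite V] [DecidableEq V] {A : AdjLists V} (hG : G.IsTree)
    (hA : A.Represents G) (hs : IsWalkState G S s) {h t w : V} (hh : h ∈ occupied s.occ)
    (ht : t ∈ occupied s.occ) (hw : w ∉ occupied s.occ) (hhw : G.Adj h w) :
    IsMove G s h w t (followHead w (traceBack (some h)
      (search A (fun v => (s.occ v).isSome) k [⟨t, none, 0⟩] []).val).val s.pos s.occ).val := by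
  have hfollowed := hs.isFollowed_followHead hG hA hh ht hw hhw
  have hoccupied := Set.ext hfollowed.isSome_iff
  constructor
  case placement => exact hfollowed.placement
  case occupied_eq => exact hoccupied
  case isTransition =>
    refine ⟨fun i => hfollowed.eq_or_adj i i.2, ?_⟩
    rw [hfollowed.placement.range_eq, hs.placement.range_eq, Set.ncard_eq_one]
    refine ⟨w, Set.ext fun v => ⟨?_, ?_⟩⟩
    · rintro ⟨hv, hvO⟩
      exact ((hfollowed.isSome_iff v).1 hv).1.resolve_right hvO
    · rintro rfl
      exact ⟨(hfollowed.isSome_iff v).2 ⟨Or.inl rfl, fun hvt => hw (hvt ▸ ht)⟩, hw⟩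
  case adj_tail => exact hfollowed.adj_tail
  case tail_eq_or_mem =>
    rcases hfollowed.tail_mem with ⟨hlength, hm⟩ | hm
    · rw [List.length_iterate] at hlength
      exact Or.inl ⟨(hG.connected.dist_eq_zero_iff.1 (by omega)).symm, hm⟩
    · obtain ⟨top, htop⟩ := hs.top
      exact Or.inr (htop.mem_of_isAnc_of_mem hG ht hh ((mem_iterate_parent hG).1 hm))

end IsWalkState

theorem IsFormation.singleton (G : SimpleGraph V) (S : Prep V) (hk : k ≤ 1) (v : V) :
    IsFormation G S k {v} v v where
  top := ⟨v, rfl, fun _ hx hxv => absurd hx hxv⟩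
  head_mem := rfl
  tail_mem := rfl
  tail_ne := by omega
  trail := Or.inl fun x hx hxv => absurd (hx ▸ IsAnc.refl x) hxv
  deep x _ _ := ⟨x, IsAnc.refl x, by omega⟩

namespace IsMove

variable {h w t : V} {m : (ℕ → V) × (V → Option ℕ) × V}

theorem head_mem (hm : IsMove G s h w t m) (hwt : w ≠ t) : w ∈ occupied m.2.1 := by
  rw [hm.occupied_eq]
  exact ⟨Or.inl rfl, hwt⟩

theorem tail_mem (hm : IsMove G s h w t m) : m.2.2 ∈ occupied m.2.1 := by
  rw [hm.occupied_eq]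
  exact ⟨hm.tail_eq_or_mem.imp And.right id, hm.adj_tail.ne'⟩

theorem tail_mem_of_ne (hm : IsMove G s h w t m) (hth : t ≠ h) : m.2.2 ∈ occupied s.occ :=
  hm.tail_eq_or_mem.resolve_left fun heq => hth heq.1.symm

theorem isLeafAt (hm : IsMove G s h w t m) (ht : IsTailChoice G S s h t) :
    IsLeafAt G (occupied s.occ) t m.2.2 := by
  obtain ⟨u, hu⟩ := ht.isLeafAt
  rwa [hu.2.2 _ (hm.tail_mem_of_ne ht.ne) hm.adj_tail]

theorem isFormation_of_le_one [Finite V] (hm : IsMove G s h w t m) (hwt : w ≠ t) (hk : k ≤ 1) :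
    IsFormation G S k (occupied m.2.1) w m.2.2 := by
  have hsub := (Set.ncard_le_one (Set.toFinite _)).1 (hm.placement.ncard_eq.trans_le hk)
  have hw := hm.head_mem hwt
  rw [hsub _ hm.tail_mem w hw,
    Set.eq_singleton_iff_unique_mem.2 ⟨hw, fun x hx => hsub x hx w hw⟩]
  exact IsFormation.singleton G S hk w

end IsMove

namespace IsDownChoice

variable {h t₀ w t : V} {m : (ℕ → V) × (V → Option ℕ) × V}

theorem not_isAnc_of_mem (hc : IsDownChoice G S s h t₀ w) (hs : IsWalkState G S s) {x : V}
    (hx : x ∈ occupied s.occ) : ¬ IsAnc G S.start w x := fun hwx =>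
  Bool.false_ne_true
    (hc.unexplored.symm.trans (hs.exploration.mem_of_isAnc (hs.explored x hx) hwx))

theorem notMem (hc : IsDownChoice G S s h t₀ w) (hs : IsWalkState G S s) : w ∉ occupied s.occ :=
  fun hw => hc.not_isAnc_of_mem hs hw (IsAnc.refl w)

theorem isFormation (hG : G.IsTree) (hS : IsPrep G S) (hs : IsWalkState G S s)
    (hc : IsDownChoice G S s h t₀ w) (ht : IsTailChoice G S s h t) (hm : IsMove G s h w t m) :
    IsFormation G S k (occupied m.2.1) w m.2.2 := by
  obtain ⟨top, htop⟩ := hs.top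
  obtain ⟨hwr, hparent⟩ := hs.exploration.ne_start_and_parent_eq hG (hs.explored h hc.mem) hc.adj
    hc.unexplored
  have hwt : w ≠ t := fun hwt => hc.notMem hs (hwt ▸ ht.mem)
  have hleaf := hm.isLeafAt ht
  have hbelow := fun x hx => hc.not_isAnc_of_mem hs (x := x) hx
  have hcard := hm.placement.ncard_eq
  change (occupied m.2.1).ncard = k at hcard
  constructor
  case head_mem => exact hm.head_mem hwt
  case tail_mem => exact hm.tail_mem
  case tail_ne => exact fun _ heq => hc.notMem hs (heq ▸ hleaf.1)
  all_goals rw [hm.occupied_eq] at *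
  case top => exact htop.move_down hG ht.mem hc.mem ht.ne hleaf hwr hparent
  case trail =>
    exact isTrail_down hG hS.diam htop ht.mem hc.mem ht.ne hleaf hwr hparent hbelow ht.trail
  case deep =>
    exact onlyInDeep_down hG hS.diam htop ht.mem hc.mem ht.ne hleaf hwr hparent hbelow hcard
      ht.trail hs.deep

theorem isExploration [DecidableEq V] (hG : G.IsTree) (hS : IsPrep G S) (hs : IsWalkState G S s)
    (hc : IsDownChoice G S s h t₀ w) :
    IsExploration G S (Function.update s.explored w true)
      (if (!s.explored w) = true then Function.update s.parent w (some h) else s.parent)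
      (if (!s.explored w) = true then Function.update s.stamp w s.clock else s.stamp)
      (s.clock + 1) w := by
  rw [hc.unexplored]
  exact hs.exploration.explore hG hS (hs.explored h hc.mem) hc.isAnc_head hc.open_isAnc hc.adj
    hc.unexplored hc.onPath_of_onPath (Nat.lt_succ_self _)

end IsDownChoice

namespace IsUpChoice

variable {h t₀ w t : V} {m : (ℕ → V) × (V → Option ℕ) × V}

theorem ne_start (hG : G.IsTree) (hc : IsUpChoice G S s h t₀ w) : h ≠ S.start := by
  rintro rfl
  exact hc.not_isAnc_goal (IsAnc.root hG S.goal)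

theorem adj (hG : G.IsTree) (hc : IsUpChoice G S s h t₀ w) : G.Adj h w := by
  rw [hc.eq_parent]
  exact adj_parent hG (hc.ne_start hG)

theorem notMem (hG : G.IsTree) (hc : IsUpChoice G S s h t₀ w) : w ∉ occupied s.occ := by
  rw [hc.eq_parent]
  exact fun hw => not_isAnc_parent hG (hc.ne_start hG) (hc.isTop.isAnc hG hw)

theorem isAnc_of_mem (hG : G.IsTree) (hc : IsUpChoice G S s h t₀ w) {x : V}
    (hx : x ∈ occupied s.occ) : IsAnc G S.start w x := by
  rw [hc.eq_parent]
  exact (IsAnc.parent_left h).trans (hc.isTop.isAnc hG hx)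

theorem isFormation (hG : G.IsTree) (hs : IsWalkState G S s) (hc : IsUpChoice G S s h t₀ w)
    (ht : IsTailChoice G S s h t) (hm : IsMove G s h w t m) :
    IsFormation G S k (occupied m.2.1) w m.2.2 := by
  have hwt : w ≠ t := fun hwt => hc.notMem hG (hwt ▸ ht.mem)
  have htail := hm.tail_mem_of_ne ht.ne
  have hw := hm.head_mem hwt
  constructor
  case head_mem => exact hw
  case tail_mem => exact hm.tail_mem
  case tail_ne => exact fun _ heq => hc.notMem hG (heq ▸ htail)
  case top =>
    rw [hm.occupied_eq, hc.eq_parent]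
    exact ⟨_, hc.isTop.move_up hG ht.mem ht.ne (hm.isLeafAt ht) (hc.ne_start hG)⟩
  case trail => exact Or.inl fun _ _ _ _ _ hcw => hcw.trans (hc.isAnc_of_mem hG htail)
  case deep =>
    exact fun v hvg hv => hs.deep v hvg fun x hx => (hv w hw).trans (hc.isAnc_of_mem hG hx)

theorem explored_target (hG : G.IsTree) (hs : IsWalkState G S s) (hc : IsUpChoice G S s h t₀ w) :
    s.explored w = true :=
  hs.exploration.mem_of_isAnc (hs.explored h hc.mem) (hc.isAnc_of_mem hG hc.mem)

theorem update_explored [DecidableEq V] (hG : G.IsTree) (hs : IsWalkState G S s)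
    (hc : IsUpChoice G S s h t₀ w) : Function.update s.explored w true = s.explored := by
  rw [← hc.explored_target hG hs, Function.update_eq_self]

theorem isExploration [DecidableEq V] (hG : G.IsTree) (hs : IsWalkState G S s)
    (hg : s.head ≠ S.goal) (hc : IsUpChoice G S s h t₀ w) :
    IsExploration G S (Function.update s.explored w true)
      (if (!s.explored w) = true then Function.update s.parent w (some h) else s.parent)
      (if (!s.explored w) = true then Function.update s.stamp w s.clock else s.stamp)
      (s.clock + 1) w := by
  rw [hc.update_explored hG hs, hc.explored_target hG hs]
  exact hs.exploration.retreat (hc.isAnc_of_mem hG hs.head_mem) (hs.explored_goal_eq_false hg)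
    hc.open_isAnc (Nat.le_succ _)

end IsUpChoice

end Move

section Potential

variable {V : Type} {G : SimpleGraph V} {S : Prep V} {k : ℕ}

open Classical in
/-- The number of transitions that can still be made: one for every unexplored vertex, and one for
every deep branch off `P*` that may still have to be left. -/
noncomputable def potential [Fintype V] (G : SimpleGraph V) (S : Prep V) (k : ℕ)
    (explored : V → Bool) (head : V) : ℕ :=
  (Finset.univ.filter fun v => explored v = false).card +
    ((detourVertices G S.start S.goal k).filter fun v =>
      IsAnc G S.start v head ∨ ∃ x, IsAnc G S.start v x ∧ explored x = false).card

theorem potential_update_lt [Fintype V] [DecidableEq V] {explored : V → Bool} {head w : V}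
    (hw : explored w = false) :
    potential G S k (Function.update explored w true) w < potential G S k explored head := by
  classical
  refine add_lt_add_of_lt_of_le (Finset.card_lt_card ?_)
    (Finset.card_le_card (Finset.monotone_filter_right _ ?_))
  · rw [Finset.ssubset_iff_of_subset
      (Finset.monotone_filter_right _ fun v _ hv => (update_eq_false_iff.1 hv).2)]
    exact ⟨w, by simp [hw], by simp⟩
  · rintro v - (hvw | ⟨x, hvx, hx⟩)
    · exact Or.inr ⟨w, hvw, hw⟩
    · exact Or.inr ⟨x, hvx, (update_eq_false_iff.1 hx).2⟩

theorem exists_adj_explored_unexplored {r : V} {explored : V → Bool} (hG : G.IsTree) {a x : V}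
    (ha : explored a = true) (hax : IsAnc G r a x) (hx : explored x = false) :
    ∃ v w, IsAnc G r a v ∧ explored v = true ∧ G.Adj v w ∧ explored w = false := by
  induction x using parent_induction hG (r := r) with
  | root => simp [← hax.antisymm hG (IsAnc.root hG a), ha] at hx
  | step x hxr ih =>
    have hap := hax.parent_right fun hax => by simp [← hax, ha] at hx
    cases hp : explored (parent G r x) with
    | true => exact ⟨_, x, hap, hp, (adj_parent hG hxr).symm, hx⟩
    | false => exact ih hap hp

theorem potential_parent_lt [Fintype V] (hG : G.IsTree) {explored : V → Bool} {head h : V}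
    (hexplored : explored h = true) (hh : IsAnc G S.start h head)
    (hg : ¬ IsAnc G S.start h S.goal) (hdeep : IsDeep G S.start k h)
    (hopen : ∀ v x, explored v = true → G.Adj v x → explored x = false →
      IsAnc G S.start v (parent G S.start h)) :
    potential G S k explored (parent G S.start h) < potential G S k explored head := by
  classical
  have hr : h ≠ S.start := by
    rintro rfl
    exact hg (IsAnc.root hG _)
  refine Nat.add_lt_add_left (Finset.card_lt_card ?_) _
  rw [Finset.ssubset_iff_of_subset (Finset.monotone_filter_right _ fun v _ hv =>
    hv.imp_left fun hvp => hvp.trans ((IsAnc.parent_left h).trans hh))]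
  refine ⟨h, by simp [detourVertices, hg, hdeep, hh], ?_⟩
  rw [Finset.mem_filter]
  rintro ⟨-, hhp | ⟨x, hhx, hx⟩⟩
  · exact not_isAnc_parent hG hr hhp
  · obtain ⟨v, w, hhv, hv, hvw, hw⟩ := exists_adj_explored_unexplored hG hexplored hhx hx
    exact not_isAnc_parent hG hr (hhv.trans (hopen v w hv hvw hw))

theorem IsUpChoice.potential_lt [Fintype V] [DecidableEq V] {s : State V k} {h t₀ w : V}
    (hG : G.IsTree) (hs : IsWalkState G S s) (hc : IsUpChoice G S s h t₀ w) :
    potential G S k (Function.update s.explored w true) w < potential G S k s.explored s.head := by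
  have hopen := hc.open_isAnc
  rw [hc.update_explored hG hs]
  rw [hc.eq_parent] at hopen ⊢
  exact potential_parent_lt hG (hs.explored h hc.mem) hc.isAnc_head hc.not_isAnc_goal
    (hs.deep h hc.not_isAnc_goal fun x hx => hc.isTop.isAnc hG hx) hopen

end Potential

section Step

variable {V : Type} {G : SimpleGraph V} {S : Prep V} {k : ℕ} {s : State V k}

/-- The state after a transition in which the head moves from `h` to `w`, with the new positions,
the new occupation and the new tail `m`. -/
def State.advance [DecidableEq V] (s : State V k) (h w : V)
    (m : (ℕ → V) × (V → Option ℕ) × V) : State V k where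
  pos := m.1
  occ := m.2.1
  explored := Function.update s.explored w true
  parent := if (!s.explored w) = true then Function.update s.parent w (some h) else s.parent
  stamp := if (!s.explored w) = true then Function.update s.stamp w s.clock else s.stamp
  clock := s.clock + 1
  head := w
  tail := m.2.2
  walk := (fun i : Fin k => m.1 i) :: s.walk

theorem transitionStep_val [DecidableEq V] (A : AdjLists V) (S : Prep V) (s : State V k) :
    (transitionStep A S s).val =
      s.advance (chooseHead A S s).val.1 (chooseHead A S s).val.2.2
        (followHead (chooseHead A S s).val.2.2 (traceBack (some (chooseHead A S s).val.1)
          (search A (fun v => (s.occ v).isSome) k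
            [⟨(chooseTail A S s (chooseHead A S s).val.1 (chooseHead A S s).val.2.1).val,
              none, 0⟩] []).val).val s.pos s.occ).val :=
  rfl

namespace IsWalkState

theorem advance [DecidableEq V] (hG : G.IsTree) (hs : IsWalkState G S s) {h t w : V}
    {m : (ℕ → V) × (V → Option ℕ) × V} (hm : IsMove G s h w t m)
    (hform : IsFormation G S k (occupied m.2.1) w m.2.2)
    (hexp : IsExploration G S (s.advance h w m).explored (s.advance h w m).parent
      (s.advance h w m).stamp (s.advance h w m).clock w) :
    IsWalkState G S (s.advance h w m) where
  toIsFormation := hform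
  exploration := hexp
  placement := hm.placement
  explored v hv := by
    change v ∈ occupied m.2.1 at hv
    rw [hm.occupied_eq] at hv
    exact update_eq_true_iff.2 (hv.1.imp_right (hs.explored v))
  walk_head := ⟨s.walk, rfl⟩
  config := by
    obtain ⟨top, htop⟩ := hform.top
    exact List.forall_mem_cons.2 ⟨hm.placement.isConfiguration hG htop, hs.config⟩
  chain := by
    obtain ⟨W, hW⟩ := hs.walk_head
    have hchain := hs.chain
    rw [hW] at hchain
    rw [State.advance, hW]
    exact List.isChain_cons_cons.2 ⟨hm.isTransition, hchain⟩
  spanning v hv := by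
    rcases update_eq_true_iff.1 hv with rfl | hv
    · refine ⟨_, List.mem_cons_self, ?_⟩
      rw [hm.placement.range_eq]
      exact hform.head_mem
    · obtain ⟨c, hc, hvc⟩ := hs.spanning v hv
      exact ⟨c, List.mem_cons_of_mem _ hc, hvc⟩

theorem step [Fintype V] [DecidableEq V] (hG : G.IsTree) (hS : IsPrep G S) {A : AdjLists V}
    (hA : A.Represents G) (hs : IsWalkState G S s) (hg : s.head ≠ S.goal) :
    IsWalkState G S (transitionStep A S s).val ∧
      potential G S k (transitionStep A S s).val.explored (transitionStep A S s).val.head <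
        potential G S k s.explored s.head := by
  rw [transitionStep_val]
  have hchoice := hs.isDownChoice_or_isUpChoice_chooseHead hG hS hA hg
  generalize (chooseHead A S s).val = c at hchoice ⊢
  obtain ⟨h, t₀, w⟩ := c
  have hhead := hchoice.elim (·.toIsHeadChoice) (·.toIsHeadChoice)
  have htO := hs.chooseTail_mem hA hhead
  have htail := fun hk => hs.isTailChoice_chooseTail hG hS hA hg hk hhead
  have hwO := hchoice.elim (·.notMem hs) (·.notMem hG)
  have hm := hs.isMove_followHead hG hA hhead.mem htO hwO (hchoice.elim (·.adj) (·.adj hG))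
  generalize (chooseTail A S s h t₀).val = t at htO htail hm ⊢
  generalize (followHead w _ s.pos s.occ).val = m at hm ⊢
  have hform : IsFormation G S k (occupied m.2.1) w m.2.2 := by
    rcases Nat.lt_or_ge k 2 with hk | hk
    · exact hm.isFormation_of_le_one (fun hwt => hwO (hwt ▸ htO)) (Nat.le_of_lt_succ hk)
    · exact hchoice.elim (·.isFormation hG hS hs (htail hk) hm) (·.isFormation hG hs (htail hk) hm)
  refine ⟨hs.advance hG hm hform ?_, ?_⟩
  · exact hchoice.elim (·.isExploration hG hS hs) (·.isExploration hG hs hg)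
  · exact hchoice.elim (fun hc => potential_update_lt hc.unexplored) (·.potential_lt hG hs)

theorem isRestrictedSpanningWalk (hG : G.IsTree) (hS : IsPrep G S) (hs : IsWalkState G S s)
    (hg : s.head = S.goal) : IsRestrictedSpanningWalk G s.walk.reverse where
  nonempty := by
    obtain ⟨W, hW⟩ := hs.walk_head
    simp [hW]
  config c hc := hs.config c (List.mem_reverse.1 hc)
  chain := List.isChain_reverse.2 hs.chain
  spanning v := by
    obtain ⟨c, hc, hv⟩ :=
      hs.spanning v (hs.exploration.mem_of_goal_mem hG hS (hg ▸ hs.exploration.cur_mem) v)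
    exact ⟨c, List.mem_reverse.2 hc, hv⟩

end IsWalkState

namespace IsDeployState

variable {d : Deploy V}

theorem isTop (hG : G.IsTree) (hd : IsDeployState G S k d) :
    IsTop G S.start (occupied d.occ) S.start := by
  have hmem (v : V) : v ∈ occupied d.occ ↔ d.explored v = true := by
    rw [hd.explored_eq v]
    rfl
  exact ⟨(hmem _).2 (hd.exploration.start_mem hG), fun x hx hxr =>
    ⟨hxr, (hmem _).2 (hd.exploration.parent_mem x ((hmem x).1 hx))⟩⟩

theorem isFormation (hG : G.IsTree) (hk : 1 ≤ k) (hd : IsDeployState G S k d)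
    (hdk : d.count = k) : IsFormation G S k (occupied d.occ) (d.pos (k - 1)) S.start := by
  obtain ⟨hcur, hlast⟩ := hd.last hdk
  have hplacement : IsPlacement k d.pos d.occ := hdk ▸ hd.placement
  have htop := hd.isTop hG
  constructor
  case top => exact ⟨_, htop⟩
  case head_mem => exact hplacement.isSome_pos (Nat.sub_lt hk one_pos)
  case tail_mem => exact htop.1
  case tail_ne =>
    intro hk2 heq
    have := hplacement.pos_injOn (Set.mem_Iio.2 hk) (Set.mem_Iio.2 (Nat.sub_lt hk one_pos))
      (hd.first.trans heq)
    omega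
  case trail =>
    rw [← hcur]
    refine Or.inr ⟨IsAnc.root hG _, fun x _ => IsAnc.root hG x, fun x hx hxc c hcx hcc => ?_⟩
    rw [SimpleGraph.dist_self, add_zero]
    refine hcc.dist_lt hG ?_
    rintro rfl
    exact hxc ((hlast x ((hd.explored_eq x).trans hx) hcx).symm ▸ IsAnc.refl _)
  case deep =>
    intro v hvg hv
    rw [(hv S.start htop.1).antisymm hG (IsAnc.root hG v)] at hvg
    exact absurd (IsAnc.root hG _) hvg

theorem isWalkState_startState (hG : G.IsTree) (hk : 1 ≤ k) (hd : IsDeployState G S k d)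
    (hdk : d.count = k) : IsWalkState G S (startState k S d).val where
  toIsFormation := hd.isFormation hG hk hdk
  exploration := by
    change IsExploration G S d.explored d.parent d.stamp d.count (d.pos (k - 1))
    rw [← (hd.last hdk).1]
    exact hd.exploration
  placement := hdk ▸ hd.placement
  explored v hv := (hd.explored_eq v).trans hv
  walk_head := ⟨[], rfl⟩
  config := List.forall_mem_singleton.2
    (IsPlacement.isConfiguration hG (hdk ▸ hd.placement) (hd.isTop hG))
  chain := List.isChain_singleton _
  spanning v hv := by
    refine ⟨_, List.mem_singleton.2 rfl, ?_⟩
    have hrange := IsPlacement.range_eq (hdk ▸ hd.placement : IsPlacement k d.pos d.occ)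
    change v ∈ Set.range fun i : Fin k => d.pos i
    rw [hrange]
    exact (hd.explored_eq v).symm.trans hv

end IsDeployState

end Step

/-! ## The run of the algorithm -/

section Run

variable {V : Type} {G : SimpleGraph V} {S : Prep V} {k : ℕ}

theorem AdjLists.Represents.length_nbrs_le [Fintype V] [DecidableRel G.Adj] {A : AdjLists V}
    (hA : A.Represents G) (v : V) : (A.nbrs v).length ≤ G.maxDegree := by
  classical
  rw [← List.toFinset_card_of_nodup (hA.nbrs_nodup v)]
  refine (Finset.card_le_card fun w hw => ?_).trans (G.degree_le_maxDegree v)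
  rw [SimpleGraph.mem_neighborFinset]
  exact (hA.mem_nbrs v w).1 (List.mem_toFinset.1 hw)

theorem AdjLists.exists_represents [Finite V] (G : SimpleGraph V) :
    ∃ A : AdjLists V, A.Represents G := by
  classical
  have := Fintype.ofFinite V
  exact ⟨⟨Finset.univ.toList, fun v => (G.neighborFinset v).toList⟩, Finset.nodup_toList _,
    fun v => by simp, fun v => Finset.nodup_toList _, fun v w => by simp⟩

theorem transitionStep_cost_le [DecidableEq V] {A : AdjLists V} {m : ℕ}
    (hm : ∀ v, (A.nbrs v).length ≤ m) (s : State V k) :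
    (transitionStep A S s).cost ≤ 4 * (k * (m + 2)) + 5 * m + 9 * k + 20 := by
  set c := chooseHead A S s
  set t := chooseTail A S s c.val.1 c.val.2.1
  set l := search A (fun v => (s.occ v).isSome) k [⟨t.val, none, 0⟩] []
  set p := traceBack (some c.val.1) l.val
  set f := followHead c.val.2.2 p.val s.pos s.occ
  have hcost : (transitionStep A S s).cost =
    1 + (c.cost + (t.cost + (l.cost + (p.cost + (f.cost + (k + 1 + 0 + 0)))))) := rfl
  have hhead : c.cost ≤ _ := chooseHead_cost_le (S := S) hm s
  have htail : t.cost ≤ _ := chooseTail_cost_le (S := S) hm s c.val.1 c.val.2.1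
  have hsearch : l.cost ≤ _ := search_cost_le A (fun v => (s.occ v).isSome) hm k _ _
  have hlength : l.val.length ≤ _ := search_length_le A (fun v => (s.occ v).isSome) k _ _
  have htrace : p.cost ≤ _ := traceBack_cost_le (some c.val.1) l.val
  have hpath : p.val.length ≤ _ := traceBack_length_le (some c.val.1) l.val
  have hfollow : f.cost ≤ _ := followHead_cost_le c.val.2.2 p.val s.pos s.occ
  rw [List.length_nil, add_zero] at hlength
  omega

theorem le_length_of_isRestrictedSpanningWalk [Fintype V] (hG : G.IsTree) (hS : IsPrep G S)
    (hk : 1 ≤ k) {W : List (Fin k → V)} (hW : IsRestrictedSpanningWalk G W) :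
    Fintype.card V - k + (detourVertices G S.start S.goal k).card + 1 ≤ W.length := by
  have hsweep := hW.isSweep.card_add_card_detourVertices_le hG hk hS.diam
  have hpos := List.length_pos_of_ne_nil hW.nonempty
  have hkV : k ≤ Fintype.card V := by
    obtain ⟨c, hc⟩ := List.exists_mem_of_ne_nil _ hW.nonempty
    simpa using Fintype.card_le_of_injective c (hW.config c hc).1
  omega

theorem potential_startState_le [Fintype V] {d : Deploy V}
    (hd : IsDeployState G S k d) (hdk : d.count = k) :
    potential G S k (startState k S d).val.explored (startState k S d).val.head ≤
      Fintype.card V - k + (detourVertices G S.start S.goal k).card := by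
  classical
  refine Nat.add_le_add ?_ (Finset.card_filter_le _ _)
  have hexplored : (Finset.univ.filter fun v => d.explored v = true).card = k := by
    rw [← hdk, ← hd.placement.ncard_eq, Set.ncard_eq_toFinset_card']
    congr 1
    ext v
    simp [hd.explored_eq v]
  have hcompl := Finset.card_filter_add_card_filter_not (s := Finset.univ)
    fun v => d.explored v = true
  simp only [Bool.not_eq_true, Finset.card_univ] at hcompl
  change (Finset.univ.filter fun v => d.explored v = false).card ≤ _
  omega

variable [Fintype V] {A : AdjLists V}

section Runs

variable [DecidableEq V]

theorem exists_deployment (hG : G.IsTree) (hS : IsPrep G S) (hA : A.Represents G) (hk : 1 ≤ k)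
    (hkn : k ≤ Fintype.card V) : ∃ d t,
      WhileRun (fun d => decide (d.count < k)) (deployStep A S) (deployInit A k S).val d t :=
  WhileRun.exists_of_measure (IsDeployState G S k)
    (fun d => 2 * (k - d.count) + G.dist S.start d.cur)
    (fun _ hd hg => hd.step hG hS hA hkn (of_decide_eq_true hg)) _
    (IsDeployState.of_deployInit G S A hk)

theorem deployment_spec (hG : G.IsTree) (hS : IsPrep G S) (hA : A.Represents G) (hk : 1 ≤ k)
    (hkn : k ≤ Fintype.card V) {m : ℕ} (hm : ∀ v, (A.nbrs v).length ≤ m) {d : Deploy V} {t : ℕ}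
    (h : WhileRun (fun d => decide (d.count < k)) (deployStep A S) (deployInit A k S).val d t) :
    IsDeployState G S k d ∧ d.count = k ∧ t ≤ 2 * (k - 1) * (2 * m + 4) + 1 := by
  obtain ⟨hd, hguard, htime⟩ := WhileRun.inv_and_time_le (IsDeployState G S k)
    (fun d => 2 * (k - d.count) + G.dist S.start d.cur) (2 * m + 3)
    (fun _ hd hg => hd.step hG hS hA hkn (of_decide_eq_true hg))
    (fun d => deployStep_cost_le hm d) h (IsDeployState.of_deployInit G S A hk)
  refine ⟨hd, le_antisymm hd.le (not_lt.1 (of_decide_eq_false hguard)), ?_⟩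
  have hmeasure : 2 * (k - (deployInit A k S).val.count) +
      G.dist S.start (deployInit A k S).val.cur = 2 * (k - 1) := by
    change 2 * (k - 1) + G.dist S.start S.start = _
    rw [SimpleGraph.dist_self, add_zero]
  rwa [hmeasure] at htime

theorem exists_runs (hG : G.IsTree) (hS : IsPrep G S) (hA : A.Represents G) (hk : 1 ≤ k)
    (hkn : k ≤ Fintype.card V) : ∃ d t₁,
      WhileRun (fun d => decide (d.count < k)) (deployStep A S) (deployInit A k S).val d t₁ ∧
      ∃ s t₂, WhileRun (fun s => decide (s.head ≠ S.goal)) (transitionStep A S)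
        (startState k S d).val s t₂ := by
  classical
  obtain ⟨d, t₁, hrun⟩ := exists_deployment hG hS hA hk hkn
  obtain ⟨hd, hdk, -⟩ := deployment_spec hG hS hA hk hkn hA.length_nbrs_le hrun
  exact ⟨d, t₁, hrun, WhileRun.exists_of_measure (IsWalkState G S)
    (fun s => potential G S k s.explored s.head)
    (fun _ hs hg => hs.step hG hS hA (of_decide_eq_true hg)) _
    (hd.isWalkState_startState hG hk hdk)⟩

theorem transitions_spec (hG : G.IsTree) (hS : IsPrep G S) (hA : A.Represents G) (hk : 1 ≤ k)
    {m : ℕ} (hm : ∀ v, (A.nbrs v).length ≤ m) {d : Deploy V}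
    (hd : IsDeployState G S k d) (hdk : d.count = k) {s : State V k} {t : ℕ}
    (h : WhileRun (fun s => decide (s.head ≠ S.goal)) (transitionStep A S)
      (startState k S d).val s t) :
    IsRestrictedSpanningWalk G s.walk.reverse ∧
      s.walk.length = Fintype.card V - k + (detourVertices G S.start S.goal k).card + 1 ∧
      t ≤ (Fintype.card V - k + (detourVertices G S.start S.goal k).card) *
        (4 * (k * (m + 2)) + 5 * m + 9 * k + 20 + 1) + 1 := by
  have hpot := potential_startState_le hd hdk
  obtain ⟨⟨hs, hlen⟩, hguard, htime⟩ := WhileRun.inv_and_time_le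
    (fun s => IsWalkState G S s ∧ s.walk.length + potential G S k s.explored s.head ≤
      Fintype.card V - k + (detourVertices G S.start S.goal k).card + 1)
    (fun s => potential G S k s.explored s.head) _
    (fun s hs hg => by
      obtain ⟨hs', hlt⟩ := hs.1.step hG hS hA (of_decide_eq_true hg)
      have hlen : (transitionStep A S s).val.walk.length = s.walk.length + 1 := rfl
      exact ⟨⟨hs', by have := hs.2; omega⟩, hlt⟩)
    (fun s => transitionStep_cost_le hm s) h
    ⟨hd.isWalkState_startState hG hk hdk, by rw [Nat.add_comm]; exact Nat.succ_le_succ hpot⟩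
  have hW := hs.isRestrictedSpanningWalk hG hS (not_not.1 (of_decide_eq_false hguard))
  have hlow := le_length_of_isRestrictedSpanningWalk hG hS hk hW
  rw [List.length_reverse] at hlow
  exact ⟨hW, by omega, htime.trans (Nat.add_le_add_right (Nat.mul_le_mul_right _ hpot) 1)⟩

end Runs

theorem isLeast_restrictedWalkLengths (hG : G.IsTree) (hS : IsPrep G S) (hk : 1 ≤ k)
    (hkn : k ≤ Fintype.card V) :
    IsLeast (restrictedWalkLengths G k)
      (Fintype.card V - k + (detourVertices G S.start S.goal k).card) := by
  obtain ⟨A, hA⟩ := AdjLists.exists_represents G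
  classical
  obtain ⟨d, _, hrun, s, _, hrun'⟩ := exists_runs hG hS hA hk hkn
  obtain ⟨hd, hdk, -⟩ := deployment_spec hG hS hA hk hkn hA.length_nbrs_le hrun
  obtain ⟨hW, hlen, -⟩ := transitions_spec hG hS hA hk hA.length_nbrs_le hd hdk hrun'
  refine ⟨⟨_, hW, by rw [List.length_reverse, hlen]⟩, ?_⟩
  rintro l ⟨W, hW, hl⟩
  have := le_length_of_isRestrictedSpanningWalk hG hS hk hW
  omega

variable [DecidableEq V]

theorem exists_KRHWPForTree (hG : G.IsTree) (hA : A.Represents G) (hk : 1 ≤ k)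
    (hkn : k ≤ Fintype.card V) : ∃ W t, KRHWPForTree A k W t := by
  obtain ⟨root, rest, hverts⟩ := List.exists_cons_of_length_pos (l := A.verts)
    (hA.length_verts ▸ hk.trans hkn)
  obtain ⟨d, t₁, hrun, s, t₂, hrun'⟩ := exists_runs hG (isPrep_prepare hG hA root) hA hk hkn
  exact ⟨_, _, root, by rw [hverts, List.head?_cons], d, t₁, hrun, s, t₂, hrun', rfl, rfl⟩

theorem KRHWPForTree.isRestrictedSpanningWalk_and_isLeast (hG : G.IsTree) (hA : A.Represents G)
    (hk : 1 ≤ k) (hkn : k ≤ Fintype.card V) {W : List (Fin k → V)} {t : ℕ}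
    (h : KRHWPForTree A k W t) :
    IsRestrictedSpanningWalk G W ∧ IsLeast (restrictedWalkLengths G k) (W.length - 1) := by
  classical
  obtain ⟨root, -, d, t₁, hrun, s, t₂, hrun', rfl, -⟩ := h
  have hS := isPrep_prepare hG hA root
  obtain ⟨hd, hdk, -⟩ := deployment_spec hG hS hA hk hkn hA.length_nbrs_le hrun
  obtain ⟨hW, hlen, -⟩ := transitions_spec hG hS hA hk hA.length_nbrs_le hd hdk hrun'
  refine ⟨hW, ?_⟩
  rw [List.length_reverse, hlen, Nat.add_sub_cancel]
  exact isLeast_restrictedWalkLengths hG hS hk hkn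

theorem KRHWPForTree.exists_time_le (hG : G.IsTree) (hA : A.Represents G) (hk : 1 ≤ k)
    (hkn : k ≤ Fintype.card V) {m : ℕ} (hm : ∀ v, (A.nbrs v).length ≤ m)
    {W : List (Fin k → V)} {t : ℕ} (h : KRHWPForTree A k W t) :
    ∃ l ≤ 2 * Fintype.card V, t ≤ l * (4 * (k * (m + 2)) + 5 * m + 9 * k + 22) +
      2 * (k - 1) * (2 * m + 4) + 3 * (Fintype.card V * (m + 2)) + 12 * Fintype.card V +
      2 * k + 20 := by
  obtain ⟨root, -, d, t₁, hrun, s, t₂, hrun', -, rfl⟩ := h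
  have hS := isPrep_prepare hG hA root
  have hprep := prepare_cost_le hm root
  have hinitial : (deployInit A k (prepare A root).val).cost =
    A.verts.length + 1 + 0 + (A.verts.length + 1 + 0 + (A.verts.length + 1 + 0 +
      (A.verts.length + 1 + 0 + (k + 1 + 0)))) := rfl
  obtain ⟨hd, hdk, htime⟩ := deployment_spec hG hS hA hk hkn hm hrun
  have hstart : (startState k (prepare A root).val d).cost = k + 1 + 0 + 0 := rfl
  obtain ⟨-, hlen, htime'⟩ := transitions_spec hG hS hA hk hm hd hdk hrun'
  have hcard :=
    (detourVertices G (prepare A root).val.start (prepare A root).val.goal k).card_le_univ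
  rw [hA.length_verts] at hprep hinitial
  set l := Fintype.card V - k +
    (detourVertices G (prepare A root).val.start (prepare A root).val.goal k).card
  have hsplit : l * (4 * (k * (m + 2)) + 5 * m + 9 * k + 22) =
    l * (4 * (k * (m + 2)) + 5 * m + 9 * k + 20 + 1) + l := Nat.mul_succ l _
  exact ⟨l, by omega, by omega⟩

theorem time_bound_le {n k m l : ℕ} (hk : 1 ≤ k) (hkn : k ≤ n) (hm : 1 ≤ m)
    (hl : l ≤ 2 * n) :
    l * (4 * (k * (m + 2)) + 5 * m + 9 * k + 22) + 2 * (k - 1) * (2 * m + 4) + 3 * (n * (m + 2)) +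
      12 * n + 2 * k + 20 ≤ 200 * (n * k * m) := by
  have hkm : k ≤ k * m := Nat.le_mul_of_pos_right k hm
  have hmk : m ≤ k * m := Nat.le_mul_of_pos_left m hk
  have hnm : n ≤ n * m := Nat.le_mul_of_pos_right n hm
  have hnkm : n * m ≤ n * k * m := Nat.mul_le_mul_right m (Nat.le_mul_of_pos_right n hk)
  have hkmn : k * m ≤ n * k * m := Nat.mul_le_mul_right m (Nat.le_mul_of_pos_left k (hk.trans hkn))
  have hstep : 4 * (k * (m + 2)) + 5 * m + 9 * k + 22 ≤ 48 * (k * m) := by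
    rw [Nat.mul_add k m 2]
    omega
  have htransitions : l * (4 * (k * (m + 2)) + 5 * m + 9 * k + 22) ≤ 96 * (n * k * m) :=
    calc _ ≤ (2 * n) * (48 * (k * m)) := Nat.mul_le_mul hl hstep
      _ = _ := by ring
  have hdeployment : 2 * (k - 1) * (2 * m + 4) ≤ 12 * (k * m) :=
    calc _ ≤ (2 * k) * (6 * m) := Nat.mul_le_mul (by omega) (by omega)
      _ = _ := by ring
  rw [Nat.mul_add n m 2]
  omega

theorem KRHWPForTree.time_le [DecidableRel G.Adj] (hG : G.IsTree) (hA : A.Represents G)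
    (hk : 1 ≤ k) (hkn : k ≤ Fintype.card V) (hn : 2 ≤ Fintype.card V) {W : List (Fin k → V)}
    {t : ℕ} (h : KRHWPForTree A k W t) : t ≤ 200 * (Fintype.card V * k * G.maxDegree) := by
  obtain ⟨l, hl, ht⟩ := h.exists_time_le hG hA hk hkn hA.length_nbrs_le
  have : Nontrivial V := Fintype.one_lt_card_iff_nontrivial.1 hn
  have hdegree : 1 ≤ G.maxDegree :=
    (hG.connected.preconnected.degree_pos_of_nontrivial hG.connected.nonempty.some).trans_le
      (G.degree_le_maxDegree _)
  exact ht.trans (time_bound_le hk hkn hdegree hl)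

end Run

end RHWP

theorem mainTheorem2 :
    ∃ C : ℕ, ∀ (V : Type) [Fintype V] [DecidableEq V] (G : SimpleGraph V) [DecidableRel G.Adj]
      (k : ℕ), G.IsTree → 1 ≤ k → k ≤ Fintype.card V →
      -- the value of the optimum
      (∀ (a b : V) (P : G.Walk a b), RHWP.IsLongestPath G P →
        IsLeast (RHWP.restrictedWalkLengths G k)
          ((Fintype.card V - k) + ∑ e ∈ G.edgeFinset, RHWP.detour G k P e)) ∧
      -- the algorithm
      ∀ A : RHWP.AdjLists V, A.Represents G →
        (∃ W t, RHWP.KRHWPForTree A k W t) ∧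
        ∀ W t, RHWP.KRHWPForTree A k W t →
          RHWP.IsRestrictedSpanningWalk G W ∧
          IsLeast (RHWP.restrictedWalkLengths G k) (W.length - 1) ∧
          (2 ≤ Fintype.card V → t ≤ C * (Fintype.card V * k * G.maxDegree)) := by
  refine ⟨200, fun V _ _ G _ k hG hk hkn => ⟨fun a b P hP => ?_, fun A hA =>
    ⟨RHWP.exists_KRHWPForTree hG hA hk hkn, fun W t h => ?_⟩⟩⟩
  · obtain ⟨S, hS, rfl, rfl⟩ := hP.exists_isPrep hG
    rw [RHWP.sum_detour hG hP k]
    exact RHWP.isLeast_restrictedWalkLengths hG hS hk hkn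
  · obtain ⟨hW, hleast⟩ := h.isRestrictedSpanningWalk_and_isLeast hG hA hk hkn
    exact ⟨hW, hleast, fun hn => h.time_le hG hA hk hkn hn⟩
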